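/- \textbf{Setting.} Let $K\ge 2$, $d\ge 1$, $T\ge 2$. In each round $t=1,\dots,T$ a context $X_t\in\mathcal X\subset\mathbb R^d$ is drawn, independently of the past, from a known distribution $\mathcal D$ whose second-moment matrix $\Sigma=\mathbb E[X_tX_t^\top]$ is positive definite with smallest eigenvalue $\lambda_{\min}>0$. An adversarial environment chooses parameters $\theta_t(a)\in\mathbb R^d$, $a\in[K]$, as an arbitrary function of the past (no assumption on how they are generated). The loss of arm $a$ is $\ell_t(a,x)=\langle x,\theta_t(a)\rangle+\varepsilon_t(a)$, where $\varepsilon_t(a)$ has conditional mean zero given the past, $X_t$ and the chosen arm $A_t$. The constants $C_{\mathcal X},C_\Theta,C_{\mathcal E},C_\ell>0$ satisfy $\|x\|_2\le C_{\mathcal X}$ on $\mathcal X$, $\|\theta_t(a)\|_2\le C_\Theta$, $|\varepsilon_t(a)|\le C_{\mathcal E}$ and $|\ell_t(a,x)|\le C_\ell$ for $x\in\mathcal X$. Put $\omega=C_\ell C_{\mathcal X}$ and $\delta=1/(2C_\ell C_{\mathcal X})$, and assume $\delta C_{\mathcal X}^2<2$. The regret is $$R_T=\sup_{\rho:\mathcal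 X\to[K]}\mathbb E\Big[\sum_{t=1}^T\{\ell_t(A_t,X_t)-\ell_t(\rho(X_t),X_t)\}\Big].$$ \textbf{Algorithm (BoBW-RealFTRL with initial rate $\beta_1$).} With $H(u)=\sum_a u_a\log(1/u_a)$, let $q_1(x)=(1/K,\dots,1/K)$ and, for $t\ge2$, let $q_t(x)$ minimize $\sum_{s<t}\sum_a\widehat\ell_s(a,x)u_a-\beta_tH(u)$ over probability vectors $u$; let $$\beta_{t+1}=\beta_t+\frac{\beta_1}{\sqrt{1+(\log K)^{-1}\sum_{s\le t}H(q_s(X_s))}},\qquad \gamma_t=\min\Big\{1,\frac{K\log T}{2\delta\lambda_{\min}\beta_t}\Big\}.$$ Draw $A_t$ from $\pi_t(a\mid X_t)=(1-\gamma_t)q_t(a\mid X_t)+\gamma_t/K$. For each arm $a$ draw independent copies $(X(k),V(k))$, $k\geq 1$, with $X(k)\sim\mathcal D$ and $V(k)\sim\pi_t(\cdot\mid X(k))$, independently of $(X_t,A_t,\varepsilon_t)$ given the past, and set $$\widehat\Sigma^\dagger_{t,a}=\delta I+\delta\sum_{k=1}^{M_t}\prod_{j=1}^k\big(I-\delta\mathbf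 1[V(j)=a]X(j)X(j)^\top\big),\qquad M_t=\max\{0,\lfloor2\beta_t-1\rfloor\},$$ $\widehat\theta_t(a)=\widehat\Sigma^\dagger_{t,a}\mathbf 1[A_t=a]X_t\ell_t(A_t,X_t)$ and $\widehat\ell_t(a,x)=\langle x,\widehat\theta_t(a)\rangle$. \textbf{Claim.} There is a constant $C$ depending only on $C_{\mathcal X},C_\Theta,C_{\mathcal E},C_\ell$ such that for all $K,d,T,\lambda_{\min}$ and every environment as above: (i) for every $\beta_1>0$, $$R_T\le C\left(\frac{K\log T}{\beta_1}\Big(\frac{\log T}{\delta\lambda_{\min}\log K}+d\Big)+\beta_1\sqrt{\log K}\right)\sqrt{\log(KT)}\,\sqrt T;$$ (ii) for $\beta_1=\omega\sqrt{K\log T\big(\frac{\log T}{\delta\lambda_{\min}\log K}+d\big)}$, $$R_T\le C\log(KT)\sqrt{K\log(K)\,T\log(T)\Big(\frac{\log T}{\delta\lambda_{\min}\log K}+d\Big)}.$$ (iii) Consequently, with $\beta_1$ as in (ii), for all fixed $K,d,\lambda_{\min}$ there is a constant $C'$ (depending on these and on the four bounds) such that $R_T\le C'\sqrt T(\log T)^2$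 for all $T\ge2$ and all such environments. -/

import Mathlib

open MeasureTheory ProbabilityTheory

universe u

noncomputable section

namespace LinBandit

/-- The ambient space `ℝ^d` of contexts and parameters, with the Euclidean norm. -/
abbrev Vec (d : ℕ) : Type := EuclideanSpace ℝ (Fin d)

/-- Shannon entropy `H(p) = ∑ₐ p(a) log (1 / p(a))` (with `0 log (1/0) = 0`). -/
def entropy {K : ℕ} (p : Fin K → ℝ) : ℝ := ∑ a, p a * Real.log (1 / p a)

/-- The second-moment matrix `Σ = 𝔼[X Xᵀ]` of a context distribution. -/
def secondMoment {d : ℕ} (D : Measure (Vec d)) : Matrix (Fin d) (Fin d) ℝ :=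
  Matrix.of fun i j => ∫ x, x i * x j ∂D

/-- `D` is a probability distribution on the context space `𝒳`, which lies in the ball of radius
`CX`, and its second-moment matrix is positive definite with smallest eigenvalue `lam > 0`. -/
structure IsContextLaw {d : ℕ} (D : Measure (Vec d)) (𝒳 : Set (Vec d)) (CX lam : ℝ) : Prop where
  prob : IsProbabilityMeasure D
  supported : ∀ᵐ x ∂D, x ∈ 𝒳
  bounded : ∀ x ∈ 𝒳, ‖x‖ ≤ CX
  posDef : (secondMoment D).PosDef
  lam_pos : 0 < lam
  lam_least :
    IsLeast {μ : ℝ | Module.End.HasEigenvalue (Matrix.toLin' (secondMoment D)) μ} lam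

/-! ### Matrix geometric resampling -/

/-- `W_{k,a} = 𝟙[V(k) = a] X(k) X(k)ᵀ`. -/
def mgrW {K d : ℕ} (a : Fin K) (x : Vec d) (v : Fin K) : Matrix (Fin d) (Fin d) ℝ :=
  if v = a then Matrix.vecMulVec x x else 0

/-- `V_{k,a} = (I - δ W_{1,a}) (I - δ W_{2,a}) ⋯ (I - δ W_{k,a})`. -/
def mgrV {K d : ℕ} (δ : ℝ) (a : Fin K) (xs : ℕ → Vec d) (vs : ℕ → Fin K) :
    ℕ → Matrix (Fin d) (Fin d) ℝ
  | 0 => 1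
  | k + 1 => mgrV δ a xs vs k * (1 - δ • mgrW a (xs (k + 1)) (vs (k + 1)))

/-- The output `δ I + δ ∑_{k=1}^M V_{k,a}` of matrix geometric resampling with `M` samples. -/
def mgrInv {K d : ℕ} (δ : ℝ) (a : Fin K) (xs : ℕ → Vec d) (vs : ℕ → Fin K) (M : ℕ) :
    Matrix (Fin d) (Fin d) ℝ :=
  δ • (1 : Matrix (Fin d) (Fin d) ℝ) + δ • ∑ k ∈ Finset.Icc 1 M, mgrV δ a xs vs k

/-! ### The interaction -/

/-- The random quantities occurring in a trial; rounds and resampling steps are numbered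
from `1`. -/
structure Trial (Ω : Type u) (K d : ℕ) where
  /-- the context `X_t` -/
  ctx : ℕ → Ω → Vec d
  /-- the chosen arm `A_t` -/
  arm : ℕ → Ω → Fin K
  /-- the regression parameter `θ_t(a)`, chosen by the environment -/
  param : ℕ → Ω → Fin K → Vec d
  /-- the error term `ε_t(a)` -/
  noise : ℕ → Ω → Fin K → ℝ
  /-- the simulated context `X(k)` used in round `t` for arm `a` -/
  simCtx : ℕ → Fin K → ℕ → Ω → Vec d
  /-- the simulated arm `V(k)` used in round `t` for arm `a` -/
  simArm : ℕ → Fin K → ℕ → Ω → Fin K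
  /-- the FTRL distribution `q_t(· ∣ x)` -/
  q : ℕ → Ω → Vec d → Fin K → ℝ
  /-- the (inverse) learning rate `β_t` -/
  rate : ℕ → Ω → ℝ

/-- The tuning parameters of the algorithm: horizon `T`, resampling step size `δ`, smallest
eigenvalue `lam`, and initial rate `β₁`. -/
structure Tuning where
  T : ℕ
  δ : ℝ
  lam : ℝ
  β₁ : ℝ

namespace Trial

variable {Ω : Type u} {K d : ℕ}

/-- The linear model `ℓ_t(a, x) = ⟨x, θ_t(a)⟩ + ε_t(a)`. -/
def loss (p : Trial Ω K d) (t : ℕ) (ω : Ω) (a : Fin K) (x : Vec d) : ℝ :=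
  inner ℝ x (p.param t ω a) + p.noise t ω a

/-- The exploration rate `γ_t = K log T / (2 δ λ_min β_t)`, capped at `1` so that the policy is
a probability vector. -/
def explore (p : Trial Ω K d) (c : Tuning) (t : ℕ) (ω : Ω) : ℝ :=
  min 1 (K / (2 * c.δ * c.lam * p.rate t ω) * Real.log c.T)

/-- The policy `π_t(a ∣ x) = (1 - γ_t) q_t(a ∣ x) + γ_t / K`. -/
def policy (p : Trial Ω K d) (c : Tuning) (t : ℕ) (ω : Ω) (x : Vec d) (a : Fin K) : ℝ :=
  (1 - p.explore c t ω) * p.q t ω x a + p.explore c t ω / K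

/-- The number of resampling steps `M_t = 2 β_t - 1`, rounded down to a natural number. -/
def simCount (p : Trial Ω K d) (t : ℕ) (ω : Ω) : ℕ := ⌊2 * p.rate t ω - 1⌋₊

/-- The estimate of the inverse of `𝔼[𝟙[A_t = a] X Xᵀ]` in round `t`. -/
def invEst (p : Trial Ω K d) (c : Tuning) (t : ℕ) (ω : Ω) (a : Fin K) :
    Matrix (Fin d) (Fin d) ℝ :=
  mgrInv c.δ a (fun k => p.simCtx t a k ω) (fun k => p.simArm t a k ω) (p.simCount t ω)

/-- The parameter estimate: the above matrix applied to `𝟙[A_t = a] X_t ℓ_t(A_t, X_t)`. -/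
def paramEst (p : Trial Ω K d) (c : Tuning) (t : ℕ) (ω : Ω) (a : Fin K) : Vec d :=
  if p.arm t ω = a then
    WithLp.toLp 2 ((p.invEst c t ω a).mulVec
      (p.loss t ω (p.arm t ω) (p.ctx t ω) • (p.ctx t ω).ofLp))
  else 0

/-- The loss estimate: the inner product of `x` with the parameter estimate. -/
def lossEst (p : Trial Ω K d) (c : Tuning) (t : ℕ) (ω : Ω) (a : Fin K) (x : Vec d) : ℝ :=
  inner ℝ x (p.paramEst c t ω a)

/-- The FTRL objective at `x` in round `t`: the linear part is the accumulated estimated loss of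
the rounds before `t`, and the regularizer is `ψ_t(u) = - β_t H(u)`. -/
def ftrlObjective (p : Trial Ω K d) (c : Tuning) (t : ℕ) (ω : Ω) (x : Vec d)
    (u : Fin K → ℝ) : ℝ :=
  (∑ s ∈ Finset.Ico 1 t, ∑ a, p.lossEst c s ω a x * u a) + -(p.rate t ω) * entropy u

/-- The rates and the distributions `q_t` are those of BoBW-RealFTRL. -/
structure IsBoBWRealFTRL (p : Trial Ω K d) (c : Tuning) : Prop where
  rate_one : ∀ ω, p.rate 1 ω = c.β₁
  rate_succ : ∀ t ∈ Finset.Icc 1 c.T, ∀ ω,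
    p.rate (t + 1) ω = p.rate t ω +
      c.β₁ / √(1 + (Real.log K)⁻¹ * ∑ s ∈ Finset.Icc 1 t, entropy (p.q s ω (p.ctx s ω)))
  q_one : ∀ ω x a, p.q 1 ω x a = 1 / K
  q_mem : ∀ t ∈ Finset.Icc 2 c.T, ∀ ω x, p.q t ω x ∈ stdSimplex ℝ (Fin K)
  q_min : ∀ t ∈ Finset.Icc 2 c.T, ∀ ω x,
    IsMinOn (p.ftrlObjective c t ω x) (stdSimplex ℝ (Fin K)) (p.q t ω x)

section Protocol

variable [mΩ : MeasurableSpace Ω]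

/-- The information before round `t` together with `X_t`. -/
abbrev afterCtx (p : Trial Ω K d) (ℱ : Filtration ℕ mΩ) (t : ℕ) : MeasurableSpace Ω :=
  ℱ (t - 1) ⊔ MeasurableSpace.comap (p.ctx t) inferInstance

/-- The information before round `t` together with `X_t` and `A_t`. -/
abbrev afterArm (p : Trial Ω K d) (ℱ : Filtration ℕ mΩ) (t : ℕ) : MeasurableSpace Ω :=
  p.afterCtx ℱ t ⊔ MeasurableSpace.comap (p.arm t) inferInstance

/-- The information before the `k`-th resampling step for arm `a` in round `t`: the past, `X_t`,
`A_t`, the errors of round `t`, and the resampling steps `1, …, k - 1` for arm `a`. -/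
abbrev beforeSim (p : Trial Ω K d) (ℱ : Filtration ℕ mΩ) (t : ℕ) (a : Fin K) (k : ℕ) :
    MeasurableSpace Ω :=
  p.afterArm ℱ t ⊔ MeasurableSpace.comap (p.noise t) inferInstance ⊔
    ⨆ j ∈ Finset.Ico 1 k, (MeasurableSpace.comap (p.simCtx t a j) inferInstance ⊔
      MeasurableSpace.comap (p.simArm t a j) inferInstance)

/-- The probabilistic protocol of a trial. The σ-algebra `ℱ t` contains everything that happened
up to the end of round `t`, including any internal randomness of the environment, so that `ℱ (t-1)`
is what the environment may use to choose `θ_t`. The environment is otherwise unrestricted. -/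
structure IsProtocol (p : Trial Ω K d) (c : Tuning) (P : Measure Ω) (ℱ : Filtration ℕ mΩ)
    (D : Measure (Vec d)) : Prop where
  meas_ctx : ∀ t ∈ Finset.Icc 1 c.T, Measurable[ℱ t] (p.ctx t)
  meas_arm : ∀ t ∈ Finset.Icc 1 c.T, Measurable[ℱ t] (p.arm t)
  meas_noise : ∀ t ∈ Finset.Icc 1 c.T, Measurable[ℱ t] (p.noise t)
  meas_simCtx : ∀ t ∈ Finset.Icc 1 c.T, ∀ a, ∀ k ≥ 1, Measurable[ℱ t] (p.simCtx t a k)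
  meas_simArm : ∀ t ∈ Finset.Icc 1 c.T, ∀ a, ∀ k ≥ 1, Measurable[ℱ t] (p.simArm t a k)
  /- the environment chooses the parameters from the past -/
  meas_param : ∀ t ∈ Finset.Icc 1 c.T, ∀ a, Measurable[ℱ (t - 1)] fun ω => p.param t ω a
  /- the context is a fresh draw from `D` -/
  ctx_law : ∀ t ∈ Finset.Icc 1 c.T, P.map (p.ctx t) = D
  ctx_indep : ∀ t ∈ Finset.Icc 1 c.T,
    Indep (MeasurableSpace.comap (p.ctx t) inferInstance) (ℱ (t - 1)) P
  /- given the past and the context, the arm is drawn from the policy -/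
  arm_law : ∀ t ∈ Finset.Icc 1 c.T, ∀ a,
    condExp (p.afterCtx ℱ t) P ({ω | p.arm t ω = a}.indicator fun _ => (1 : ℝ))
      =ᵐ[P] fun ω => p.policy c t ω (p.ctx t ω) a
  /- the errors are centred given the past, the context and the arm -/
  noise_centred : ∀ t ∈ Finset.Icc 1 c.T, ∀ a,
    condExp (p.afterArm ℱ t) P (fun ω => p.noise t ω a) =ᵐ[P] fun _ => (0 : ℝ)
  /- each simulated context is a fresh draw from `D` -/
  simCtx_law : ∀ t ∈ Finset.Icc 1 c.T, ∀ a, ∀ k ≥ 1, P.map (p.simCtx t a k) = D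
  simCtx_indep : ∀ t ∈ Finset.Icc 1 c.T, ∀ a, ∀ k ≥ 1,
    Indep (MeasurableSpace.comap (p.simCtx t a k) inferInstance) (p.beforeSim ℱ t a k) P
  /- each simulated arm is drawn from the policy of the round at the simulated context -/
  simArm_law : ∀ t ∈ Finset.Icc 1 c.T, ∀ a, ∀ k ≥ 1, ∀ b,
    condExp (p.beforeSim ℱ t a k ⊔ MeasurableSpace.comap (p.simCtx t a k) inferInstance) P
        ({ω | p.simArm t a k ω = b}.indicator fun _ => (1 : ℝ))
      =ᵐ[P] fun ω => p.policy c t ω (p.simCtx t a k ω) b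

/-- Parameters, errors and losses are bounded by `CΘ`, `CE` and `Cl`. -/
def IsBounded (p : Trial Ω K d) (c : Tuning) (P : Measure Ω) (𝒳 : Set (Vec d))
    (CΘ CE Cl : ℝ) : Prop :=
  ∀ᵐ ω ∂P, ∀ t ∈ Finset.Icc 1 c.T, ∀ a,
    ‖p.param t ω a‖ ≤ CΘ ∧ |p.noise t ω a| ≤ CE ∧ ∀ x ∈ 𝒳, |p.loss t ω a x| ≤ Cl

/-- The expected excess loss over the first `T` rounds relative to `ρ : 𝒳 → [K]`. -/
def regretAgainst (p : Trial Ω K d) (P : Measure Ω) (T : ℕ) (ρ : Vec d → Fin K) : ℝ :=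
  ∫ ω, ∑ t ∈ Finset.Icc 1 T,
    (p.loss t ω (p.arm t ω) (p.ctx t ω) - p.loss t ω (ρ (p.ctx t ω)) (p.ctx t ω)) ∂P

/-- The regret `R_T`: the supremum of the above over all measurable `ρ`. (For bounded losses the
set of values is bounded.) -/
def regret (p : Trial Ω K d) (P : Measure Ω) (T : ℕ) : ℝ :=
  ⨆ ρ : {ρ : Vec d → Fin K // Measurable ρ}, p.regretAgainst P T ρ.1

/-- `p` is a run over `c.T` rounds of BoBW-RealFTRL with parameters `c` in an arbitrary
(adversarial) environment with linear losses, with contexts drawn from `D`, and subject to the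
bounds `CX`, `CΘ`, `CE`, `Cl`. -/
structure IsRun (p : Trial Ω K d) (c : Tuning) (P : Measure Ω) (ℱ : Filtration ℕ mΩ)
    (D : Measure (Vec d)) (𝒳 : Set (Vec d)) (CX CΘ CE Cl : ℝ) : Prop where
  contextLaw : IsContextLaw D 𝒳 CX c.lam
  protocol : p.IsProtocol c P ℱ D
  algorithm : p.IsBoBWRealFTRL c
  bounded : p.IsBounded c P 𝒳 CΘ CE Cl

end Protocol

end Trial

/-- The resampling step size `δ = 1 / (2 C_ℓ C_𝒳)`. -/
def stepSize (CX Cl : ℝ) : ℝ := 1 / (2 * Cl * CX)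

/-- `log T / (δ λ_min log K) + d`. -/
def dimTerm (K d T : ℕ) (δ lam : ℝ) : ℝ :=
  Real.log T / (δ * lam * Real.log K) + d

/-- The tuned initial rate `ω √(K log T (log T / (δ λ_min log K) + d))`, with `ω = C_ℓ C_𝒳`. -/
def tunedRate (K d T : ℕ) (CX Cl lam : ℝ) : ℝ :=
  Cl * CX * √(K * Real.log T * dimTerm K d T (stepSize CX Cl) lam)

end LinBandit

end

/-!
The proof compares the run with its own independent copy of the context. Since the context of round
`t` and the past are independent, expected excess losses are integrals over `P.prod D` of
`(π_t(a ∣ x) - 𝟙[ρ(x) = a]) ⟨x, θ_t(a)⟩` (`integral_excess`), and for each fixed `x` the algorithm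
is entropic FTRL fed with the loss estimates at `x`. Four estimates carry the argument.

*Bias.* Given the past, the estimate has mean `⟨x, θ⟩ - ⟨x, (I - δ S)^(M + 1) θ⟩`, where `S` is the
second moment of the contexts on which the arm is played (`integral_mul_lossEst`). Exploration gives
`S ≥ γ λ / K`, so that eigenvalues of `I - δ S` near `1` contribute at most `e / T`; eigenvalues
near `-1` are possible because only `δ CX² < 2` is assumed, and contribute `O(1 / β_t)`
(`abs_bias_le`).

*Variance.* Expanding the square of the geometric series in the resampled products, the factors that
occur in only one of the two products average to powers of `I - δ S`, whose sum against `S` is at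
most `2 / δ`; the common factors act by the linear map `A ↦ 𝔼[N A Nᵀ]` on matrices. Hence the second
moment of the estimate is bounded by `∑ₖ xᵀ 𝓛ᵏ(I) x` with `𝓛` this map
(`integral_mul_lossEst_sq_le`). Averaged over the policy these sums telescope through the trace and
give a multiple of `d` per arm (`sum_trace_le`). Replacing the policy by `q_t` costs a share `γ_t`,
in which the sums are at most of order `K / (γ_t λ)`, so that `γ_t` cancels
(`sum_integral_q_mul_resForm_le`).

*Stability.* Resampled products are contractions, so an estimate is at most `CX / 2 (M + 1)` in
absolute value, with `M + 1 ≤ max 1 (2 β_t)`. This is enough for the second-order expansion of the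
free energy `-β log ∑ₐ exp (-Lₐ / β)` up to a factor `exp CX` (`freeEnergy_add_ge_of_simCount`), and
yields the pathwise regret bound `ae_ftrl_le`.

*Penalty.* The increments of the rates are measurable with respect to the past, so the independent
context in `(β_{t+1} - β_t) H(q_{t+1}(x))` may be exchanged for `X_{t+1}`. Then the entropies are
those by which the rates are defined, and the sum is `O(β₁ log K √T)` (`integral_penalty_le`).

Together these give `regretAgainst_le`. It implies the stated form when `K ≤ T`, because then
`log T / log K ≥ 1`; when `K > T` the stated bound exceeds `T` by the inequality between the
arithmetic and the geometric mean, and losses are bounded (`regret_le`).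
-/

namespace LinBandit

/-! ### Bounded measurable functions and fresh draws -/

/-- `f` is measurable with respect to the (sub-)σ-algebra `m` and `μ`-almost everywhere bounded. -/
def BddMeas {α : Type*} (m : MeasurableSpace α) {m0 : MeasurableSpace α} (μ : Measure α)
    (f : α → ℝ) : Prop :=
  Measurable[m] f ∧ ∃ C, ∀ᵐ ω ∂μ, |f ω| ≤ C

namespace BddMeas

variable {α : Type*} {m m' m0 : MeasurableSpace α} {μ : Measure α} {f g : α → ℝ}

theorem const (c : ℝ) : BddMeas m μ (fun _ => c) :=
  ⟨measurable_const, |c|, Filter.Eventually.of_forall fun _ => le_rfl⟩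

theorem add (hf : BddMeas m μ f) (hg : BddMeas m μ g) : BddMeas m μ (fun ω => f ω + g ω) := by
  obtain ⟨hf, C, hC⟩ := hf
  obtain ⟨hg, C', hC'⟩ := hg
  refine ⟨hf.add hg, C + C', ?_⟩
  filter_upwards [hC, hC'] with ω h h'
  exact (abs_add_le _ _).trans (add_le_add h h')

theorem mul (hf : BddMeas m μ f) (hg : BddMeas m μ g) : BddMeas m μ (fun ω => f ω * g ω) := by
  obtain ⟨hf, C, hC⟩ := hf
  obtain ⟨hg, C', hC'⟩ := hg
  refine ⟨hf.mul hg, C * C', ?_⟩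
  filter_upwards [hC, hC'] with ω h h'
  rw [abs_mul]
  exact mul_le_mul h h' (abs_nonneg _) ((abs_nonneg _).trans h)

theorem neg (hf : BddMeas m μ f) : BddMeas m μ (fun ω => -f ω) := by
  simpa using (const (-1)).mul hf

theorem sub (hf : BddMeas m μ f) (hg : BddMeas m μ g) : BddMeas m μ (fun ω => f ω - g ω) := by
  simpa [sub_eq_add_neg] using hf.add hg.neg

theorem pow (hf : BddMeas m μ f) (n : ℕ) : BddMeas m μ (fun ω => f ω ^ n) := by
  induction n with
  | zero => simpa using const 1
  | succ n ih => simpa [pow_succ] using ih.mul hf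

theorem sum {ι : Type*} (s : Finset ι) {F : ι → α → ℝ} (hF : ∀ i, BddMeas m μ (F i)) :
    BddMeas m μ (fun ω => ∑ i ∈ s, F i ω) := by
  classical
  induction s using Finset.induction_on with
  | empty => simpa using const 0
  | insert i s hi ih =>
    simp only [Finset.sum_insert hi]
    exact (hF i).add ih

theorem sum_mem {ι : Type*} (s : Finset ι) {F : ι → α → ℝ} (hF : ∀ i ∈ s, BddMeas m μ (F i)) :
    BddMeas m μ (fun ω => ∑ i ∈ s, F i ω) := by
  have : (fun ω => ∑ i ∈ s, F i ω) = fun ω => ∑ i ∈ s.attach, F i ω := by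
    ext ω; exact (Finset.sum_attach s fun i => F i ω).symm
  rw [this]
  exact sum (F := fun (i : s) ω => F i ω) s.attach fun i => hF i i.2

theorem mono (h : m ≤ m') (hf : BddMeas m μ f) : BddMeas m' μ f :=
  ⟨hf.1.mono h le_rfl, hf.2⟩

theorem integrable [IsFiniteMeasure μ] (hf : BddMeas m0 μ f) : Integrable f μ := by
  obtain ⟨hf, C, hC⟩ := hf
  exact Integrable.of_bound hf.aestronglyMeasurable C hC

theorem indicator {s : Set α} (hs : MeasurableSet[m] s) :
    BddMeas m μ (s.indicator fun _ => (1 : ℝ)) := by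
  refine ⟨measurable_const.indicator hs, 1, Filter.Eventually.of_forall fun ω => ?_⟩
  by_cases h : ω ∈ s <;> simp [h]

end BddMeas

theorem integral_comp_prodMk_of_indepFun {Ω Ω' E : Type*} [MeasurableSpace Ω] [MeasurableSpace Ω']
    [MeasurableSpace E] {P : Measure Ω} [IsProbabilityMeasure P] {Y : Ω → Ω'} {X : Ω → E}
    (hY : Measurable Y) (hX : Measurable X) (hind : IndepFun Y X P) {h : Ω' × E → ℝ}
    (hh : Measurable h) (hb : ∃ C, ∀ᵐ x ∂(P.map X), ∀ᵐ ω ∂P, |h (Y ω, x)| ≤ C) :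
    ∫ ω, h (Y ω, X ω) ∂P = ∫ x, ∫ ω, h (Y ω, x) ∂P ∂(P.map X) := by
  have hmap := (indepFun_iff_map_prod_eq_prod_map_map hY.aemeasurable hX.aemeasurable).1 hind
  have := Measure.isProbabilityMeasure_map (μ := P) hY.aemeasurable
  have := Measure.isProbabilityMeasure_map (μ := P) hX.aemeasurable
  obtain ⟨C, hC⟩ := hb
  have hset : MeasurableSet {z : Ω' × E | |h z| ≤ C} := measurableSet_le hh.abs measurable_const
  have hC' : ∀ᵐ x ∂(P.map X), ∀ᵐ y ∂(P.map Y), |h (y, x)| ≤ C := by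
    filter_upwards [hC] with x hx
    exact (ae_map_iff hY.aemeasurable
      (measurableSet_le (hh.comp measurable_prodMk_right).abs measurable_const)).2 hx
  have hint : Integrable h ((P.map Y).prod (P.map X)) :=
    Integrable.of_bound hh.aestronglyMeasurable C ((Measure.ae_prod_iff_ae_ae hset).2
      ((Measure.ae_ae_comm (p := fun y x => |h (y, x)| ≤ C) hset).2 hC'))
  calc ∫ ω, h (Y ω, X ω) ∂P = ∫ z, h z ∂(P.map fun ω => (Y ω, X ω)) :=
        (integral_map (hY.prodMk hX).aemeasurable hh.aestronglyMeasurable).symm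
    _ = ∫ x, ∫ y, h (y, x) ∂(P.map Y) ∂(P.map X) := by rw [hmap, integral_prod_symm _ hint]
    _ = ∫ x, ∫ ω, h (Y ω, x) ∂P ∂(P.map X) := by
        refine integral_congr_ae (Filter.Eventually.of_forall fun x => ?_)
        exact integral_map hY.aemeasurable (hh.comp measurable_prodMk_right).aestronglyMeasurable

/-- If `X` is a draw from `D` independent of `m`, then the expectation of an `m`-measurable random
function at `X` is the expectation of its `D`-average. -/
theorem integral_fresh {Ω E : Type*} {m mΩ : MeasurableSpace Ω} {mE : MeasurableSpace E}
    {P : Measure Ω} [IsProbabilityMeasure P] {D : Measure E}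
    (hm : m ≤ mΩ) {X : Ω → E} (hX : Measurable X)
    (hind : Indep (MeasurableSpace.comap X inferInstance) m P) (hlaw : P.map X = D)
    {h : Ω × E → ℝ} (hh : Measurable[m.prod mE] h)
    (hb : ∃ C, ∀ᵐ x ∂D, ∀ᵐ ω ∂P, |h (ω, x)| ≤ C) :
    ∫ ω, h (ω, X ω) ∂P = ∫ x, ∫ ω, h (ω, x) ∂P ∂D := by
  subst hlaw
  refine @integral_comp_prodMk_of_indepFun Ω Ω E mΩ m mE P _ id X (measurable_id'' hm) hX ?_ h hh hb
  refine (@IndepFun_iff_Indep Ω Ω E mΩ m mE id X P).2 ?_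
  rw [MeasurableSpace.comap_id]
  exact hind.symm

/-- Pulling a bounded `m`-measurable factor out of a conditional expectation, integrated. -/
theorem integral_mul_of_condExp {Ω : Type*} {m mΩ : MeasurableSpace Ω} {P : Measure Ω}
    [IsFiniteMeasure P] (hm : m ≤ mΩ) {f g g' : Ω → ℝ} (hf : BddMeas m P f)
    (hg : Integrable g P) (hgg : condExp m P g =ᵐ[P] g') :
    ∫ ω, f ω * g ω ∂P = ∫ ω, f ω * g' ω ∂P := by
  obtain ⟨hfm, C, hC⟩ := hf
  have hfg : Integrable (f * g) P :=
    hg.bdd_mul (hfm.mono hm le_rfl).aestronglyMeasurable hC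
  have h1 := condExp_mul_of_stronglyMeasurable_left (μ := P) hfm.stronglyMeasurable hfg hg
  calc ∫ ω, f ω * g ω ∂P = ∫ ω, (condExp m P (f * g)) ω ∂P := (integral_condExp hm).symm
    _ = ∫ ω, f ω * g' ω ∂P := by
        refine integral_congr_ae ?_
        filter_upwards [h1, hgg] with ω h h'
        rw [h, Pi.mul_apply, h']

end LinBandit

namespace LinBandit

/-! ### The joint law of a fresh context and an arm -/

/-- `f` maps each context to a probability vector, measurably. -/
structure IsPolicy {E : Type*} [MeasurableSpace E] {K : ℕ} (f : E → Fin K → ℝ) : Prop where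
  meas : ∀ b, Measurable fun x => f x b
  mem : ∀ x, f x ∈ stdSimplex ℝ (Fin K)

/-- A random policy which is measurable with respect to `m`. -/
structure IsRandomPolicy {Ω E : Type*} (m : MeasurableSpace Ω) [mE : MeasurableSpace E] {K : ℕ}
    (f : Ω → E → Fin K → ℝ) : Prop where
  meas : ∀ b, Measurable[m.prod mE] fun z : Ω × E => f z.1 z.2 b
  mem : ∀ ω x, f ω x ∈ stdSimplex ℝ (Fin K)

/-- The joint law of a context drawn from `D` and an arm drawn from the policy `f` at this context,
as the density `f` with respect to `D` times the counting measure. -/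
noncomputable def roundLaw {E : Type*} [MeasurableSpace E] {K : ℕ} (D : Measure E)
    (f : E → Fin K → ℝ) : Measure (E × Fin K) :=
  (D.prod Measure.count).withDensity fun z => ENNReal.ofReal (f z.1 z.2)

theorem integrable_prod_of_bound {α β : Type*} [MeasurableSpace α] [MeasurableSpace β]
    {μ : Measure α} {ν : Measure β} [IsFiniteMeasure μ] [IsFiniteMeasure ν] {h : α × β → ℝ}
    (hh : Measurable h) (hb : ∃ C, ∀ᵐ y ∂ν, ∀ᵐ x ∂μ, |h (x, y)| ≤ C) :
    Integrable h (μ.prod ν) := by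
  obtain ⟨C, hC⟩ := hb
  have hset : MeasurableSet {z : α × β | |h z| ≤ C} := measurableSet_le hh.abs measurable_const
  exact Integrable.of_bound hh.aestronglyMeasurable C ((Measure.ae_prod_iff_ae_ae hset).2
      ((Measure.ae_ae_comm (p := fun y x => |h (y, x)| ≤ C) hset).2 hC))

theorem IsRandomPolicy.isPolicy {Ω E : Type*} {m : MeasurableSpace Ω} [mE : MeasurableSpace E]
    {K : ℕ} {f : Ω → E → Fin K → ℝ} (hf : IsRandomPolicy m f) (ω : Ω) : IsPolicy (f ω) :=
  ⟨fun b => (hf.meas b).comp (@measurable_prodMk_left _ _ m mE ω), hf.mem ω⟩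

namespace IsPolicy

variable {E : Type*} [MeasurableSpace E] {K : ℕ} {f : E → Fin K → ℝ} {D : Measure E}

theorem nonneg (hf : IsPolicy f) (x : E) (b : Fin K) : 0 ≤ f x b := (hf.mem x).1 b

theorem le_one (hf : IsPolicy f) (x : E) (b : Fin K) : f x b ≤ 1 := by
  rw [← (hf.mem x).2]
  exact Finset.single_le_sum (fun i _ => hf.nonneg x i) (Finset.mem_univ b)

theorem measurable_uncurry (hf : IsPolicy f) : Measurable fun z : E × Fin K => f z.1 z.2 :=
  measurable_from_prod_countable_left fun b => hf.meas b

theorem map_fst_roundLaw [IsProbabilityMeasure D] (hf : IsPolicy f) :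
    (roundLaw D f).map Prod.fst = D := by
  ext s hs
  have hm : Measurable fun z : E × Fin K => ENNReal.ofReal (f z.1 z.2) :=
    ENNReal.measurable_ofReal.comp hf.measurable_uncurry
  rw [Measure.map_apply measurable_fst hs, roundLaw, withDensity_apply _ (measurable_fst hs)]
  have hpre : (Prod.fst ⁻¹' s : Set (E × Fin K)) = s ×ˢ Set.univ := by ext; simp
  rw [hpre, setLIntegral_prod _ hm.aemeasurable]
  simp only [Measure.restrict_univ, lintegral_count, tsum_fintype]
  have : ∀ x, ∑ b, ENNReal.ofReal (f x b) = 1 := fun x => by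
    rw [← ENNReal.ofReal_sum_of_nonneg fun b _ => hf.nonneg x b, (hf.mem x).2, ENNReal.ofReal_one]
  simp [this]

theorem isProbabilityMeasure_roundLaw [IsProbabilityMeasure D] (hf : IsPolicy f) :
    IsProbabilityMeasure (roundLaw D f) := by
  constructor
  have := hf.map_fst_roundLaw (D := D)
  rw [← Set.preimage_univ (f := Prod.fst), ← Measure.map_apply measurable_fst .univ, this]
  exact measure_univ

theorem ae_roundLaw [IsProbabilityMeasure D] (hf : IsPolicy f) {p : E → Prop}
    (hp : ∀ᵐ x ∂D, p x) : ∀ᵐ z ∂(roundLaw D f), p z.1 := by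
  rw [← hf.map_fst_roundLaw (D := D)] at hp
  exact ae_of_ae_map measurable_fst.aemeasurable hp

theorem integral_roundLaw [IsProbabilityMeasure D] (hf : IsPolicy f) {φ : E × Fin K → ℝ}
    (hφ : Measurable φ) (hb : ∃ C, ∀ᵐ x ∂D, ∀ b, |φ (x, b)| ≤ C) :
    ∫ z, φ z ∂(roundLaw D f) = ∫ x, ∑ b, f x b * φ (x, b) ∂D := by
  have hm : Measurable fun z : E × Fin K => ENNReal.ofReal (f z.1 z.2) :=
    ENNReal.measurable_ofReal.comp hf.measurable_uncurry
  rw [roundLaw, integral_withDensity_eq_integral_toReal_smul hm (by simp)]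
  simp only [ENNReal.toReal_ofReal (hf.nonneg _ _), smul_eq_mul]
  obtain ⟨C, hC⟩ := hb
  rw [integral_prod _ ?_]
  · simp
  · refine Integrable.of_bound (hf.measurable_uncurry.mul hφ).aestronglyMeasurable C ?_
    have : ∀ᵐ z ∂(D.prod (Measure.count : Measure (Fin K))), ∀ b, |φ (z.1, b)| ≤ C :=
      Measure.quasiMeasurePreserving_fst.ae hC
    filter_upwards [this] with z hz
    rw [norm_mul, Real.norm_eq_abs, Real.norm_eq_abs, abs_of_nonneg (hf.nonneg _ _)]
    exact (mul_le_of_le_one_left (abs_nonneg _) (hf.le_one _ _)).trans (hz z.2)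

end IsPolicy

namespace IsRandomPolicy

variable {Ω E : Type*} {m mΩ : MeasurableSpace Ω} [mE : MeasurableSpace E] {K : ℕ}
  {f : Ω → E → Fin K → ℝ} {D : Measure E} {P : Measure Ω}

theorem mono (h : m ≤ mΩ) (hf : IsRandomPolicy m f) : IsRandomPolicy mΩ f :=
  ⟨fun b => (hf.meas b).mono (sup_le_sup (MeasurableSpace.comap_mono h) le_rfl) le_rfl, hf.mem⟩

theorem bddMeas_integral [IsProbabilityMeasure D] (hf : IsRandomPolicy m f)
    {φ : E × Fin K → ℝ} (hφ : Measurable φ) (hb : ∃ C, ∀ᵐ x ∂D, ∀ b, |φ (x, b)| ≤ C) :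
    BddMeas m P fun ω => ∫ z, φ z ∂(roundLaw D (f ω)) := by
  constructor
  · have : (fun ω => ∫ z, φ z ∂(roundLaw D (f ω)))
        = fun ω => ∫ x, ∑ b, f ω x b * φ (x, b) ∂D := by
      ext ω; exact (hf.isPolicy ω).integral_roundLaw hφ hb
    rw [this]
    refine (@StronglyMeasurable.integral_prod_right Ω E ℝ m mE D _ _ _
      (fun ω x => ∑ b, f ω x b * φ (x, b)) ?_).measurable
    refine Measurable.stronglyMeasurable ?_
    refine Finset.measurable_fun_sum _ fun b _ => ?_
    exact (hf.meas b).mul ((hφ.comp measurable_prodMk_right).comp (@measurable_snd _ _ m mE))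
  · obtain ⟨C, hC⟩ := hb
    refine ⟨C, Filter.Eventually.of_forall fun ω => ?_⟩
    have := (hf.isPolicy ω).isProbabilityMeasure_roundLaw (D := D)
    have h := norm_integral_le_of_norm_le_const (μ := roundLaw D (f ω)) (f := φ) (C := C) (by
      filter_upwards [(hf.isPolicy ω).ae_roundLaw hC] with z hz using hz z.2)
    simpa using h

/-- Given `m`, the pair `(X, V)` has law `roundLaw D (f ω)`. -/
theorem integral_draw [IsProbabilityMeasure P] [IsProbabilityMeasure D] (hf : IsRandomPolicy m f)
    (hm : m ≤ mΩ) {X : Ω → E} {V : Ω → Fin K} (hX : Measurable X) (hV : Measurable V)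
    (hind : Indep (MeasurableSpace.comap X inferInstance) m P) (hlaw : P.map X = D)
    (hcond : ∀ b, condExp (m ⊔ MeasurableSpace.comap X inferInstance) P
      ({ω | V ω = b}.indicator fun _ => (1 : ℝ)) =ᵐ[P] fun ω => f ω (X ω) b)
    {φ : E × Fin K → ℝ} (hφ : Measurable φ) (hb : ∃ C, ∀ᵐ x ∂D, ∀ b, |φ (x, b)| ≤ C)
    {g : Ω → ℝ} (hg : BddMeas m P g) :
    ∫ ω, g ω * φ (X ω, V ω) ∂P = ∫ ω, g ω * ∫ z, φ z ∂(roundLaw D (f ω)) ∂P := by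
  have hm' : m ⊔ MeasurableSpace.comap X inferInstance ≤ mΩ := sup_le hm hX.comap_le
  have hφb : ∀ b, Measurable fun x => φ (x, b) := fun b => hφ.comp measurable_prodMk_right
  obtain ⟨C, hC⟩ := hb
  have hCX : ∀ᵐ ω ∂P, ∀ b, |φ (X ω, b)| ≤ C := by
    rw [← hlaw] at hC; exact ae_of_ae_map hX.aemeasurable hC
  obtain ⟨hgm, Cg, hCg⟩ := id hg
  have hC0 : ∀ᵐ x ∂D, ∀ᵐ ω ∂P, ∀ b, |g ω * f ω x b * φ (x, b)| ≤ Cg * C := by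
    filter_upwards [hC] with x hx
    filter_upwards [hCg] with ω hω b
    rw [abs_mul, abs_mul, abs_of_nonneg ((hf.isPolicy ω).nonneg x b)]
    refine mul_le_mul ?_ (hx b) (abs_nonneg _) ((abs_nonneg _).trans hω)
    exact (mul_le_of_le_one_right (abs_nonneg _) ((hf.isPolicy ω).le_one x b)).trans hω
  have hmeas : ∀ b, Measurable[m.prod mE]
      fun z : Ω × E => g z.1 * f z.1 z.2 b * φ (z.2, b) := fun b =>
    ((hgm.comp (@measurable_fst _ _ m mE)).mul (hf.meas b)).mul
      ((hφb b).comp (@measurable_snd _ _ m mE))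
  have hmeas' : ∀ b, Measurable fun z : Ω × E => g z.1 * f z.1 z.2 b * φ (z.2, b) := fun b =>
    (hmeas b).mono (sup_le_sup (MeasurableSpace.comap_mono hm) le_rfl) le_rfl
  have hgX : ∀ b, BddMeas (m ⊔ MeasurableSpace.comap X inferInstance) P
      fun ω => g ω * φ (X ω, b) := fun b => by
    refine (hg.mono le_sup_left).mul ⟨?_, C, ?_⟩
    · exact (hφb b).comp ((comap_measurable X).mono le_sup_right le_rfl)
    · filter_upwards [hCX] with ω hω using hω b
  have hVi : ∀ b, BddMeas mΩ P ({ω | V ω = b}.indicator fun _ => (1 : ℝ)) := fun b =>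
    BddMeas.indicator (hV (measurableSet_singleton b))
  have hfX : ∀ b, BddMeas mΩ P fun ω => f ω (X ω) b := fun b => by
    refine ⟨((hf.mono hm).meas b).comp (measurable_id.prodMk hX), 1,
      Filter.Eventually.of_forall fun ω => ?_⟩
    rw [abs_of_nonneg ((hf.isPolicy ω).nonneg _ b)]
    exact (hf.isPolicy ω).le_one _ b
  calc ∫ ω, g ω * φ (X ω, V ω) ∂P
      = ∫ ω, ∑ b, (g ω * φ (X ω, b)) * ({ω | V ω = b}.indicator fun _ => (1 : ℝ)) ω ∂P := by
        refine integral_congr_ae (Filter.Eventually.of_forall fun ω => ?_)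
        simp [Set.indicator_apply]
    _ = ∑ b, ∫ ω, (g ω * φ (X ω, b)) * ({ω | V ω = b}.indicator fun _ => (1 : ℝ)) ω ∂P :=
        integral_finsetSum _ fun b _ => (((hgX b).mono hm').mul (hVi b)).integrable
    _ = ∑ b, ∫ x, ∫ ω, g ω * f ω x b * φ (x, b) ∂P ∂D := by
        refine Finset.sum_congr rfl fun b _ => ?_
        rw [integral_mul_of_condExp hm' (hgX b) (hVi b).integrable (hcond b),
          ← integral_fresh hm hX hind hlaw (hmeas b) ⟨Cg * C, by
            filter_upwards [hC0] with x hx; filter_upwards [hx] with ω hω using hω b⟩]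
        refine integral_congr_ae (Filter.Eventually.of_forall fun ω => ?_)
        ring
    _ = ∑ b, ∫ ω, ∫ x, g ω * f ω x b * φ (x, b) ∂D ∂P := by
        refine Finset.sum_congr rfl fun b _ => ?_
        refine (integral_integral_swap (f := fun ω x => g ω * f ω x b * φ (x, b)) ?_).symm
        exact integrable_prod_of_bound (hmeas' b) ⟨Cg * C, by
            filter_upwards [hC0] with x hx; filter_upwards [hx] with ω hω using hω b⟩
    _ = ∫ ω, ∑ b, ∫ x, g ω * f ω x b * φ (x, b) ∂D ∂P := by
        refine (integral_finsetSum _ fun b _ => ?_).symm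
        exact (integrable_prod_of_bound (hmeas' b) ⟨Cg * C, by
            filter_upwards [hC0] with x hx; filter_upwards [hx] with ω hω using hω b⟩).integral_prod_left
    _ = ∫ ω, g ω * ∫ z, φ z ∂(roundLaw D (f ω)) ∂P := by
        refine integral_congr_ae (Filter.Eventually.of_forall fun ω => ?_)
        simp only
        rw [(hf.isPolicy ω).integral_roundLaw hφ ⟨C, hC⟩, ← integral_const_mul,
          ← integral_finsetSum _ fun b _ => ?_]
        · refine integral_congr_ae (Filter.Eventually.of_forall fun x => ?_)
          simp only [Finset.mul_sum, mul_assoc]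
        · simp only [mul_assoc]
          refine Integrable.const_mul (Integrable.of_bound
            (((hf.isPolicy ω).meas b).mul (hφb b)).aestronglyMeasurable C ?_) _
          filter_upwards [hC] with x hx
          rw [Pi.mul_apply, norm_mul, Real.norm_eq_abs, Real.norm_eq_abs,
            abs_of_nonneg ((hf.isPolicy ω).nonneg _ _)]
          exact (mul_le_of_le_one_left (abs_nonneg _) ((hf.isPolicy ω).le_one _ _)).trans (hx b)

end IsRandomPolicy

end LinBandit

namespace LinBandit

/-! ### Products of conditionally independent random matrices -/

open Matrix

variable {Ω : Type*} {d : ℕ}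

/-- All entries of the random matrix `A` are bounded and `m`-measurable. -/
def MatBdd (m : MeasurableSpace Ω) {mΩ : MeasurableSpace Ω} (P : Measure Ω)
    (A : Ω → Matrix (Fin d) (Fin d) ℝ) : Prop :=
  ∀ i j, BddMeas m P fun ω => A ω i j

/-- All entries of the random vector `z` are bounded and `m`-measurable. -/
def VecBdd (m : MeasurableSpace Ω) {mΩ : MeasurableSpace Ω} (P : Measure Ω)
    (z : Ω → Fin d → ℝ) : Prop :=
  ∀ i, BddMeas m P fun ω => z ω i

section Closure

variable {m m' mΩ : MeasurableSpace Ω} {P : Measure Ω} {A B : Ω → Matrix (Fin d) (Fin d) ℝ}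
  {y z : Ω → Fin d → ℝ}

theorem VecBdd.mono (h : m ≤ m') (hz : VecBdd m P z) : VecBdd m' P z := fun i => (hz i).mono h

theorem MatBdd.mono (h : m ≤ m') (hA : MatBdd m P A) : MatBdd m' P A := fun i j => (hA i j).mono h

theorem MatBdd.const (C : Matrix (Fin d) (Fin d) ℝ) : MatBdd m P fun _ => C := fun _ _ => .const _

theorem VecBdd.const (c : Fin d → ℝ) : VecBdd m P fun _ => c := fun _ => .const _

theorem MatBdd.mul (hA : MatBdd m P A) (hB : MatBdd m P B) : MatBdd m P fun ω => A ω * B ω := by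
  intro i j
  simp only [Matrix.mul_apply]
  exact .sum _ fun k => (hA i k).mul (hB k j)

theorem MatBdd.sub (hA : MatBdd m P A) (hB : MatBdd m P B) : MatBdd m P fun ω => A ω - B ω :=
  fun i j => (hA i j).sub (hB i j)

theorem MatBdd.smul {f : Ω → ℝ} (hf : BddMeas m P f) (hA : MatBdd m P A) :
    MatBdd m P fun ω => f ω • A ω :=
  fun i j => hf.mul (hA i j)

theorem MatBdd.pow (hA : MatBdd m P A) (n : ℕ) : MatBdd m P fun ω => A ω ^ n := by
  induction n with
  | zero => simpa using MatBdd.const 1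
  | succ n ih => simpa only [pow_succ] using ih.mul hA

theorem MatBdd.transpose (hA : MatBdd m P A) : MatBdd m P fun ω => (A ω)ᵀ := fun i j => hA j i

theorem MatBdd.sum {ι : Type*} (s : Finset ι) {F : ι → Ω → Matrix (Fin d) (Fin d) ℝ}
    (hF : ∀ i, MatBdd m P (F i)) : MatBdd m P fun ω => ∑ i ∈ s, F i ω := by
  intro i j
  simp only [Matrix.sum_apply]
  exact .sum _ fun k => hF k i j

theorem MatBdd.mulVec (hA : MatBdd m P A) (hz : VecBdd m P z) :
    VecBdd m P fun ω => A ω *ᵥ z ω := by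
  intro i
  simp only [Matrix.mulVec, dotProduct]
  exact .sum _ fun k => (hA i k).mul (hz k)

theorem VecBdd.dotProduct (hy : VecBdd m P y) (hz : VecBdd m P z) :
    BddMeas m P fun ω => y ω ⬝ᵥ z ω :=
  .sum _ fun k => (hy k).mul (hz k)

end Closure

/-- The linear map on matrices whose coefficients are the second moments
`Q i j k l = 𝔼[N i j * N k l]` of a random matrix `N`, so that `quadMap Q A = 𝔼[N A Nᵀ]`. -/
def quadMap (Q : Fin d → Fin d → Fin d → Fin d → ℝ) (A : Matrix (Fin d) (Fin d) ℝ) :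
    Matrix (Fin d) (Fin d) ℝ :=
  Matrix.of fun i k => ∑ j, ∑ l, A j l * Q i j k l

/-- The random matrices `N k`, `k ≥ 1`, are adapted to `𝓖` and have, given `𝓖 k`, first moments
`R` and second moments `Q` that are already `𝓕`-measurable. -/
structure IsResampling {mΩ : MeasurableSpace Ω} (P : Measure Ω) (𝓕 : MeasurableSpace Ω)
    (𝓖 : ℕ → MeasurableSpace Ω) (N : ℕ → Ω → Matrix (Fin d) (Fin d) ℝ)
    (R : Ω → Matrix (Fin d) (Fin d) ℝ)
    (Q : Ω → Fin d → Fin d → Fin d → Fin d → ℝ) : Prop where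
  past_le : 𝓕 ≤ 𝓖 1
  mono : ∀ j k, j ≤ k → 𝓖 j ≤ 𝓖 k
  le : ∀ k, 𝓖 k ≤ mΩ
  adapted : ∀ k, MatBdd (𝓖 (k + 2)) P (N (k + 1))
  fst_meas : MatBdd 𝓕 P R
  snd_meas : ∀ i j k l, BddMeas 𝓕 P fun ω => Q ω i j k l
  fst_eq : ∀ k i j f, BddMeas (𝓖 (k + 1)) P f →
    ∫ ω, f ω * N (k + 1) ω i j ∂P = ∫ ω, f ω * R ω i j ∂P
  snd_eq : ∀ n i j k l f, BddMeas (𝓖 (n + 1)) P f →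
    ∫ ω, f ω * (N (n + 1) ω i j * N (n + 1) ω k l) ∂P = ∫ ω, f ω * Q ω i j k l ∂P

/-- The product `N 1 * ⋯ * N k`. -/
def matProd (N : ℕ → Ω → Matrix (Fin d) (Fin d) ℝ) : ℕ → Ω → Matrix (Fin d) (Fin d) ℝ
  | 0 => fun _ => 1
  | k + 1 => fun ω => matProd N k ω * N (k + 1) ω

theorem dotProduct_mulVec_eq_sum (x y : Fin d → ℝ) (A : Matrix (Fin d) (Fin d) ℝ) :
    x ⬝ᵥ (A *ᵥ y) = ∑ i, ∑ j, x i * A i j * y j := by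
  simp only [dotProduct, Matrix.mulVec, Finset.mul_sum, mul_assoc]

theorem integral_sum_congr {ι : Type*} {mΩ : MeasurableSpace Ω} {P : Measure Ω} [IsFiniteMeasure P]
    (s : Finset ι) {F G : ι → Ω → ℝ} (hF : ∀ i, BddMeas mΩ P (F i)) (hG : ∀ i, BddMeas mΩ P (G i))
    (h : ∀ i, ∫ ω, F i ω ∂P = ∫ ω, G i ω ∂P) :
    ∫ ω, ∑ i ∈ s, F i ω ∂P = ∫ ω, ∑ i ∈ s, G i ω ∂P := by
  rw [integral_finsetSum _ fun i _ => (hF i).integrable,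
    integral_finsetSum _ fun i _ => (hG i).integrable]
  exact Finset.sum_congr rfl fun i _ => h i

theorem quadMap_bdd {m mΩ : MeasurableSpace Ω} {P : Measure Ω}
    {Q : Ω → Fin d → Fin d → Fin d → Fin d → ℝ} {A : Ω → Matrix (Fin d) (Fin d) ℝ}
    (hQ : ∀ i j k l, BddMeas m P fun ω => Q ω i j k l) (hA : MatBdd m P A) :
    MatBdd m P fun ω => quadMap (Q ω) (A ω) := by
  intro i k
  simp only [quadMap, Matrix.of_apply]
  exact .sum _ fun j => .sum _ fun l => (hA j l).mul (hQ i j k l)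

theorem quadMap_iterate_bdd {m mΩ : MeasurableSpace Ω} {P : Measure Ω}
    {Q : Ω → Fin d → Fin d → Fin d → Fin d → ℝ} {A : Ω → Matrix (Fin d) (Fin d) ℝ}
    (hQ : ∀ i j k l, BddMeas m P fun ω => Q ω i j k l) (hA : MatBdd m P A) (n : ℕ) :
    MatBdd m P fun ω => (quadMap (Q ω))^[n] (A ω) := by
  induction n with
  | zero => simpa using hA
  | succ n ih =>
    simp only [Function.iterate_succ_apply']
    exact quadMap_bdd hQ ih

namespace IsResampling

variable {mΩ : MeasurableSpace Ω} {P : Measure Ω} {𝓕 : MeasurableSpace Ω}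
  {𝓖 : ℕ → MeasurableSpace Ω} {N : ℕ → Ω → Matrix (Fin d) (Fin d) ℝ}
  {R : Ω → Matrix (Fin d) (Fin d) ℝ} {Q : Ω → Fin d → Fin d → Fin d → Fin d → ℝ}

theorem matProd_bdd (h : IsResampling P 𝓕 𝓖 N R Q) (k : ℕ) :
    MatBdd (𝓖 (k + 1)) P (matProd N k) := by
  induction k with
  | zero => exact MatBdd.const 1
  | succ k ih => exact (ih.mono (h.mono _ _ (by omega))).mul (h.adapted k)

theorem integral_bilin [IsProbabilityMeasure P] (h : IsResampling P 𝓕 𝓖 N R Q) (k : ℕ) {y z : Ω → Fin d → ℝ}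
    (hy : VecBdd (𝓖 (k + 1)) P y) (hz : VecBdd (𝓖 (k + 1)) P z) :
    ∫ ω, y ω ⬝ᵥ (N (k + 1) ω *ᵥ z ω) ∂P = ∫ ω, y ω ⬝ᵥ (R ω *ᵥ z ω) ∂P := by
  have hR := h.fst_meas.mono (h.past_le.trans (h.mono 1 (k + 1) (by omega)))
  have hle := h.le (k + 1)
  have hN := (h.adapted k).mono (h.le _)
  simp only [dotProduct_mulVec_eq_sum]
  refine integral_sum_congr _ (fun i => ?_) (fun i => ?_) fun i =>
    integral_sum_congr _ (fun j => ?_) (fun j => ?_) fun j => ?_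
  · exact .sum _ fun j => (((hy i).mono hle).mul (hN i j)).mul ((hz j).mono hle)
  · exact .sum _ fun j => ((((hy i).mul (hR i j)).mul (hz j)).mono hle)
  · exact (((hy i).mono hle).mul (hN i j)).mul ((hz j).mono hle)
  · exact (((hy i).mul (hR i j)).mul (hz j)).mono hle
  · have := h.fst_eq k i j _ ((hy i).mul (hz j))
    simpa only [mul_right_comm] using this

theorem integral_quad [IsProbabilityMeasure P] (h : IsResampling P 𝓕 𝓖 N R Q) (n : ℕ) {y : Ω → Fin d → ℝ}
    {A : Ω → Matrix (Fin d) (Fin d) ℝ}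
    (hy : VecBdd (𝓖 (n + 1)) P y) (hA : MatBdd (𝓖 (n + 1)) P A) :
    ∫ ω, y ω ⬝ᵥ ((N (n + 1) ω * A ω * (N (n + 1) ω)ᵀ) *ᵥ y ω) ∂P
      = ∫ ω, y ω ⬝ᵥ (quadMap (Q ω) (A ω) *ᵥ y ω) ∂P := by
  have hQ : ∀ i j k l, BddMeas (𝓖 (n + 1)) P fun ω => Q ω i j k l := fun i j k l =>
    (h.snd_meas i j k l).mono (h.past_le.trans (h.mono 1 (n + 1) (by omega)))
  have hle := h.le (n + 1)
  have hN := (h.adapted n).mono (h.le _)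
  have e1 : ∀ ω, y ω ⬝ᵥ ((N (n + 1) ω * A ω * (N (n + 1) ω)ᵀ) *ᵥ y ω)
      = ∑ i, ∑ k, ∑ j, ∑ l, (y ω i * y ω k * A ω j l) * (N (n + 1) ω i j * N (n + 1) ω k l) := by
    intro ω
    rw [dotProduct_mulVec_eq_sum]
    refine Finset.sum_congr rfl fun i _ => Finset.sum_congr rfl fun k _ => ?_
    simp only [Matrix.mul_apply, Matrix.transpose_apply, Finset.sum_mul, Finset.mul_sum]
    rw [Finset.sum_comm]
    refine Finset.sum_congr rfl fun j _ => Finset.sum_congr rfl fun l _ => ?_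
    ring
  have e2 : ∀ ω, y ω ⬝ᵥ (quadMap (Q ω) (A ω) *ᵥ y ω)
      = ∑ i, ∑ k, ∑ j, ∑ l, (y ω i * y ω k * A ω j l) * Q ω i j k l := by
    intro ω
    rw [dotProduct_mulVec_eq_sum]
    refine Finset.sum_congr rfl fun i _ => Finset.sum_congr rfl fun k _ => ?_
    simp only [quadMap, Matrix.of_apply, Finset.sum_mul, Finset.mul_sum]
    refine Finset.sum_congr rfl fun j _ => Finset.sum_congr rfl fun l _ => ?_
    ring
  simp only [e1, e2]
  have hf : ∀ i k j l, BddMeas (𝓖 (n + 1)) P fun ω => y ω i * y ω k * A ω j l := fun i k j l =>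
    ((hy i).mul (hy k)).mul (hA j l)
  have hF : ∀ i k j l, BddMeas mΩ P fun ω =>
      (y ω i * y ω k * A ω j l) * (N (n + 1) ω i j * N (n + 1) ω k l) := fun i k j l =>
    ((hf i k j l).mono hle).mul ((hN i j).mul (hN k l))
  have hG : ∀ i k j l, BddMeas mΩ P fun ω =>
      (y ω i * y ω k * A ω j l) * Q ω i j k l := fun i k j l =>
    ((hf i k j l).mul (hQ i j k l)).mono hle
  refine integral_sum_congr _ (fun i => .sum _ fun k => .sum _ fun j => .sum _ fun l => hF i k j l)
    (fun i => .sum _ fun k => .sum _ fun j => .sum _ fun l => hG i k j l) fun i => ?_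
  refine integral_sum_congr _ (fun k => .sum _ fun j => .sum _ fun l => hF i k j l)
    (fun k => .sum _ fun j => .sum _ fun l => hG i k j l) fun k => ?_
  refine integral_sum_congr _ (fun j => .sum _ fun l => hF i k j l)
    (fun j => .sum _ fun l => hG i k j l) fun j => ?_
  exact integral_sum_congr _ (fun l => hF i k j l) (fun l => hG i k j l)
    fun l => h.snd_eq n i j k l _ (hf i k j l)

/-- Integrating out the factors of a product of resampled matrices from the right. -/
theorem integral_matProd_mulVec [IsProbabilityMeasure P] (h : IsResampling P 𝓕 𝓖 N R Q) (x : Fin d → ℝ) (k : ℕ)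
    {z : Ω → Fin d → ℝ} (hz : VecBdd (𝓖 1) P z) :
    ∫ ω, x ⬝ᵥ (matProd N k ω *ᵥ z ω) ∂P = ∫ ω, x ⬝ᵥ (R ω ^ k *ᵥ z ω) ∂P := by
  induction k generalizing z with
  | zero => simp [matProd]
  | succ k ih =>
    have hle : 𝓖 1 ≤ 𝓖 (k + 1) := h.mono _ _ (by omega)
    have hy : VecBdd (𝓖 (k + 1)) P fun ω => (matProd N k ω)ᵀ *ᵥ x :=
      (h.matProd_bdd k).transpose.mulVec (VecBdd.const x)
    have e : ∀ (B : Matrix (Fin d) (Fin d) ℝ) ω, x ⬝ᵥ ((matProd N k ω * B) *ᵥ z ω)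
        = ((matProd N k ω)ᵀ *ᵥ x) ⬝ᵥ (B *ᵥ z ω) := by
      intro B ω
      rw [← Matrix.mulVec_mulVec, Matrix.dotProduct_mulVec, Matrix.mulVec_transpose]
    calc ∫ ω, x ⬝ᵥ (matProd N (k + 1) ω *ᵥ z ω) ∂P
        = ∫ ω, ((matProd N k ω)ᵀ *ᵥ x) ⬝ᵥ (N (k + 1) ω *ᵥ z ω) ∂P := by
          simp only [matProd, e]
      _ = ∫ ω, x ⬝ᵥ (matProd N k ω *ᵥ (R ω *ᵥ z ω)) ∂P := by
          rw [h.integral_bilin k hy (hz.mono hle)]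
          simp only [← e, Matrix.mulVec_mulVec]
      _ = ∫ ω, x ⬝ᵥ (R ω ^ (k + 1) *ᵥ z ω) ∂P := by
          rw [ih ((h.fst_meas.mono h.past_le).mulVec hz)]
          simp only [Matrix.mulVec_mulVec, pow_succ]

theorem integral_matProd_quad [IsProbabilityMeasure P] (h : IsResampling P 𝓕 𝓖 N R Q) (x : Fin d → ℝ) (k : ℕ)
    {A : Ω → Matrix (Fin d) (Fin d) ℝ} (hA : MatBdd (𝓖 1) P A) :
    ∫ ω, x ⬝ᵥ ((matProd N k ω * A ω * (matProd N k ω)ᵀ) *ᵥ x) ∂P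
      = ∫ ω, x ⬝ᵥ ((quadMap (Q ω))^[k] (A ω) *ᵥ x) ∂P := by
  induction k generalizing A with
  | zero => simp [matProd]
  | succ k ih =>
    have hle : 𝓖 1 ≤ 𝓖 (k + 1) := h.mono _ _ (by omega)
    have hy : VecBdd (𝓖 (k + 1)) P fun ω => (matProd N k ω)ᵀ *ᵥ x :=
      (h.matProd_bdd k).transpose.mulVec (VecBdd.const x)
    have e : ∀ (B : Matrix (Fin d) (Fin d) ℝ) ω,
        x ⬝ᵥ ((matProd N k ω * B * (matProd N k ω)ᵀ) *ᵥ x)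
        = ((matProd N k ω)ᵀ *ᵥ x) ⬝ᵥ (B *ᵥ ((matProd N k ω)ᵀ *ᵥ x)) := by
      intro B ω
      rw [← Matrix.mulVec_mulVec, ← Matrix.mulVec_mulVec, Matrix.dotProduct_mulVec,
        Matrix.mulVec_transpose]
    have e' : ∀ ω, matProd N (k + 1) ω * A ω * (matProd N (k + 1) ω)ᵀ
        = matProd N k ω * (N (k + 1) ω * A ω * (N (k + 1) ω)ᵀ) * (matProd N k ω)ᵀ := by
      intro ω
      simp only [matProd, Matrix.transpose_mul, Matrix.mul_assoc]
    simp only [e', e]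
    rw [h.integral_quad k hy (hA.mono hle)]
    simp only [← e]
    rw [ih (quadMap_bdd (fun i j k l => (h.snd_meas i j k l).mono h.past_le) hA)]
    simp only [Function.iterate_succ_apply]

/-- The factors of the longer product beyond the shorter one are independent of the others and average to
powers of the mean `R`, while the common ones act through the averaged congruence `quadMap (Q ω)`. -/
theorem integral_matProd_cross [IsProbabilityMeasure P] (h : IsResampling P 𝓕 𝓖 N R Q) (x : Fin d → ℝ) (k j : ℕ)
    {A : Ω → Matrix (Fin d) (Fin d) ℝ} (hA : MatBdd (𝓖 1) P A) :
    ∫ ω, x ⬝ᵥ ((matProd N k ω * A ω * (matProd N (k + j) ω)ᵀ) *ᵥ x) ∂P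
      = ∫ ω, x ⬝ᵥ ((quadMap (Q ω))^[k] (A ω * (R ω)ᵀ ^ j) *ᵥ x) ∂P := by
  induction j generalizing A with
  | zero => simpa using h.integral_matProd_quad x k hA
  | succ j ih =>
    have hy : VecBdd (𝓖 (k + j + 1)) P fun ω => (matProd N (k + j) ω)ᵀ *ᵥ x :=
      (h.matProd_bdd _).transpose.mulVec (VecBdd.const x)
    have hz : VecBdd (𝓖 (k + j + 1)) P fun ω => (A ω)ᵀ *ᵥ ((matProd N k ω)ᵀ *ᵥ x) :=
      (hA.mono (h.mono _ _ (by omega))).transpose.mulVec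
        (((h.matProd_bdd _).mono (h.mono _ _ (by omega))).transpose.mulVec (VecBdd.const x))
    have e : ∀ (B : Matrix (Fin d) (Fin d) ℝ) ω,
        x ⬝ᵥ ((matProd N k ω * A ω * (matProd N (k + j) ω * B)ᵀ) *ᵥ x)
        = ((matProd N (k + j) ω)ᵀ *ᵥ x) ⬝ᵥ (B *ᵥ ((A ω)ᵀ *ᵥ ((matProd N k ω)ᵀ *ᵥ x))) := by
      intro B ω
      rw [Matrix.dotProduct_mulVec, ← Matrix.mulVec_transpose, dotProduct_comm]
      simp only [Matrix.transpose_mul, Matrix.transpose_transpose]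
      rw [← Matrix.mulVec_mulVec, ← Matrix.mulVec_mulVec, ← Matrix.mulVec_mulVec,
        Matrix.dotProduct_mulVec, ← Matrix.mulVec_transpose]
    calc ∫ ω, x ⬝ᵥ ((matProd N k ω * A ω * (matProd N (k + (j + 1)) ω)ᵀ) *ᵥ x) ∂P
        = ∫ ω, ((matProd N (k + j) ω)ᵀ *ᵥ x) ⬝ᵥ
            (N (k + j + 1) ω *ᵥ ((A ω)ᵀ *ᵥ ((matProd N k ω)ᵀ *ᵥ x))) ∂P := by
          simp only [← e]; rfl
      _ = ∫ ω, x ⬝ᵥ ((matProd N k ω * (A ω * (R ω)ᵀ) * (matProd N (k + j) ω)ᵀ) *ᵥ x) ∂P := by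
          rw [h.integral_bilin (k + j) hy hz]
          simp only [← e, Matrix.transpose_mul, Matrix.mul_assoc]
      _ = _ := by
          rw [ih (hA.mul (h.fst_meas.mono h.past_le).transpose)]
          simp only [Matrix.mul_assoc, pow_succ']

end IsResampling

end LinBandit

namespace LinBandit

/-! ### Moments of the resampling matrices -/

open Matrix

section Symmetric

variable {d : ℕ}

theorem dotProduct_mulVec_comm {R : Matrix (Fin d) (Fin d) ℝ} (hR : Rᵀ = R) (y z : Fin d → ℝ) :
    y ⬝ᵥ (R *ᵥ z) = z ⬝ᵥ (R *ᵥ y) := by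
  rw [Matrix.dotProduct_mulVec, ← Matrix.mulVec_transpose, hR, dotProduct_comm]

theorem dotProduct_self_nonneg' (y : Fin d → ℝ) : 0 ≤ y ⬝ᵥ y :=
  Finset.sum_nonneg fun i _ => mul_self_nonneg (y i)

/-- A symmetric matrix whose quadratic form is bounded by `c` times the Euclidean one has operator
norm at most `c`; polarization at `y ± s R y` with `s = 1 / c`. -/
theorem mulVec_self_le {R : Matrix (Fin d) (Fin d) ℝ} (hR : Rᵀ = R) {c : ℝ} (hc : 0 ≤ c)
    (h : ∀ y, |y ⬝ᵥ (R *ᵥ y)| ≤ c * (y ⬝ᵥ y)) (y : Fin d → ℝ) :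
    (R *ᵥ y) ⬝ᵥ (R *ᵥ y) ≤ c ^ 2 * (y ⬝ᵥ y) := by
  set w := R *ᵥ y with hw
  have key : ∀ s : ℝ, 2 * s * (w ⬝ᵥ w) ≤ c * (y ⬝ᵥ y + s ^ 2 * (w ⬝ᵥ w)) := by
    intro s
    have h1 := (abs_le.1 (h (y + s • w))).2
    have h2 := (abs_le.1 (h (y - s • w))).1
    have hsym := dotProduct_mulVec_comm hR y w
    simp only [Matrix.mulVec_add, Matrix.mulVec_sub, Matrix.mulVec_smul, dotProduct_add,
      add_dotProduct, dotProduct_sub, sub_dotProduct, dotProduct_smul, smul_dotProduct,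
      smul_eq_mul, ← hw, hsym, dotProduct_comm w y] at h1 h2
    nlinarith
  rcases hc.eq_or_lt with rfl | hc
  · have := key 1
    simpa using by linarith
  · have := key (1 / c)
    have e : c * (y ⬝ᵥ y + (1 / c) ^ 2 * (w ⬝ᵥ w)) = c * (y ⬝ᵥ y) + (1 / c) * (w ⬝ᵥ w) := by
      field_simp
    rw [e] at this
    have h3 : (1 / c) * (w ⬝ᵥ w) ≤ c * (y ⬝ᵥ y) := by linarith
    have h4 := mul_le_mul_of_nonneg_left h3 hc.le
    calc w ⬝ᵥ w = c * (1 / c * (w ⬝ᵥ w)) := by field_simp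
      _ ≤ c * (c * (y ⬝ᵥ y)) := h4
      _ = c ^ 2 * (y ⬝ᵥ y) := by ring

theorem abs_dotProduct_pow_mulVec_le {R : Matrix (Fin d) (Fin d) ℝ} (hR : Rᵀ = R) {c : ℝ}
    (hc : 0 ≤ c) (h : ∀ y, |y ⬝ᵥ (R *ᵥ y)| ≤ c * (y ⬝ᵥ y)) (n : ℕ) (x y : Fin d → ℝ) :
    |x ⬝ᵥ (R ^ n *ᵥ y)| ≤ c ^ n * (√(x ⬝ᵥ x) * √(y ⬝ᵥ y)) := by
  have hn : ∀ n : ℕ, (R ^ n *ᵥ y) ⬝ᵥ (R ^ n *ᵥ y) ≤ (c ^ n) ^ 2 * (y ⬝ᵥ y) := by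
    intro n
    induction n with
    | zero => simp
    | succ n ih =>
      have h1 := mulVec_self_le hR hc h (R ^ n *ᵥ y)
      rw [Matrix.mulVec_mulVec, ← pow_succ'] at h1
      calc _ ≤ _ := h1
        _ ≤ c ^ 2 * ((c ^ n) ^ 2 * (y ⬝ᵥ y)) := by gcongr
        _ = _ := by ring
  have hcs : (x ⬝ᵥ (R ^ n *ᵥ y)) ^ 2 ≤ (x ⬝ᵥ x) * ((R ^ n *ᵥ y) ⬝ᵥ (R ^ n *ᵥ y)) := by
    have := Finset.sum_mul_sq_le_sq_mul_sq Finset.univ x (R ^ n *ᵥ y)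
    simpa only [dotProduct, sq] using this
  refine abs_le_of_sq_le_sq ?_ (by positivity)
  rw [mul_pow, mul_pow, Real.sq_sqrt (dotProduct_self_nonneg' x),
    Real.sq_sqrt (dotProduct_self_nonneg' y)]
  calc _ ≤ _ := hcs
    _ ≤ (x ⬝ᵥ x) * ((c ^ n) ^ 2 * (y ⬝ᵥ y)) :=
        mul_le_mul_of_nonneg_left (hn n) (dotProduct_self_nonneg' x)
    _ = _ := by ring

/-- The quadratic form of `A` is nonnegative (`A` need not be symmetric). -/
def QuadNonneg (A : Matrix (Fin d) (Fin d) ℝ) : Prop := ∀ y, 0 ≤ y ⬝ᵥ (A *ᵥ y)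

theorem quadMap_sub (Q : Fin d → Fin d → Fin d → Fin d → ℝ) (A B : Matrix (Fin d) (Fin d) ℝ) :
    quadMap Q (A - B) = quadMap Q A - quadMap Q B := by
  ext i k
  simp [quadMap, sub_mul, Finset.sum_sub_distrib]

theorem quadMap_smul (Q : Fin d → Fin d → Fin d → Fin d → ℝ) (c : ℝ)
    (A : Matrix (Fin d) (Fin d) ℝ) : quadMap Q (c • A) = c • quadMap Q A := by
  ext i k
  simp [quadMap, Finset.mul_sum, mul_assoc]

theorem quadMap_iterate_sub (Q : Fin d → Fin d → Fin d → Fin d → ℝ) (n : ℕ)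
    (A B : Matrix (Fin d) (Fin d) ℝ) :
    (quadMap Q)^[n] (A - B) = (quadMap Q)^[n] A - (quadMap Q)^[n] B := by
  induction n generalizing A B with
  | zero => rfl
  | succ n ih => simp only [Function.iterate_succ_apply, quadMap_sub, ih]

theorem quadMap_iterate_smul (Q : Fin d → Fin d → Fin d → Fin d → ℝ) (n : ℕ) (c : ℝ)
    (A : Matrix (Fin d) (Fin d) ℝ) :
    (quadMap Q)^[n] (c • A) = c • (quadMap Q)^[n] A := by
  induction n generalizing A with
  | zero => rfl
  | succ n ih => simp only [Function.iterate_succ_apply, quadMap_smul, ih]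

theorem quadMap_iterate_sum (Q : Fin d → Fin d → Fin d → Fin d → ℝ) (n : ℕ) {ι : Type*}
    (s : Finset ι) (A : ι → Matrix (Fin d) (Fin d) ℝ) :
    (quadMap Q)^[n] (∑ i ∈ s, A i) = ∑ i ∈ s, (quadMap Q)^[n] (A i) := by
  classical
  induction s using Finset.induction_on with
  | empty => simpa using quadMap_iterate_smul Q n 0 0
  | insert i s hi ih =>
    have := quadMap_iterate_sub Q n (A i) (-(∑ i ∈ s, A i))
    have h2 := quadMap_iterate_smul Q n (-1) (∑ i ∈ s, A i)
    rw [neg_one_smul, neg_one_smul] at h2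
    rw [sub_neg_eq_add, h2, sub_neg_eq_add, ih] at this
    rw [Finset.sum_insert hi, Finset.sum_insert hi, this]

end Symmetric

section Moments

variable {K d : ℕ}

/-- The resampling factor `I - δ 𝟙[b = a] x xᵀ`. -/
def resMat (δ : ℝ) (a : Fin K) (z : Vec d × Fin K) : Matrix (Fin d) (Fin d) ℝ :=
  1 - δ • mgrW a z.1 z.2

/-- `𝔼[𝟙[b = a] x xᵀ]`, where `x` is drawn from `D` and `b` from the policy `f` at `x`. -/
noncomputable def armMoment (D : Measure (Vec d)) (f : Vec d → Fin K → ℝ) (a : Fin K) :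
    Matrix (Fin d) (Fin d) ℝ :=
  Matrix.of fun i j => ∫ z, mgrW a z.1 z.2 i j ∂(roundLaw D f)

/-- The mixed second moments of the entries of the resampling factor. -/
noncomputable def resMoment (D : Measure (Vec d)) (f : Vec d → Fin K → ℝ) (δ : ℝ) (a : Fin K)
    (i j k l : Fin d) : ℝ :=
  ∫ z, resMat δ a z i j * resMat δ a z k l ∂(roundLaw D f)

/-- The indicator of `b = a` as a real number. -/
def armInd (a b : Fin K) : ℝ := if b = a then 1 else 0

theorem armInd_nonneg (a b : Fin K) : 0 ≤ armInd a b := by unfold armInd; split_ifs <;> norm_num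

theorem armInd_le_one (a b : Fin K) : armInd a b ≤ 1 := by unfold armInd; split_ifs <;> norm_num

theorem armInd_mul_self (a b : Fin K) : armInd a b * armInd a b = armInd a b := by
  unfold armInd; split_ifs <;> norm_num

theorem mgrW_apply (a b : Fin K) (x : Vec d) (i j : Fin d) :
    mgrW a x b i j = armInd a b * (x i * x j) := by
  unfold mgrW armInd; split_ifs <;> simp [Matrix.vecMulVec_apply]

theorem mgrW_eq (a b : Fin K) (x : Vec d) :
    mgrW a x b = armInd a b • Matrix.vecMulVec x.ofLp x.ofLp := by
  ext i j; simp [mgrW_apply, Matrix.vecMulVec_apply]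

theorem measurable_armInd (a : Fin K) : Measurable fun z : Vec d × Fin K => armInd a z.2 :=
  (measurable_of_countable (armInd a)).comp measurable_snd

theorem measurable_coord (i : Fin d) : Measurable fun x : Vec d => x i := by fun_prop

theorem measurable_mgrW (a : Fin K) (i j : Fin d) :
    Measurable fun z : Vec d × Fin K => mgrW a z.1 z.2 i j := by
  simp only [mgrW_apply]
  exact (measurable_armInd a).mul (((measurable_coord i).comp measurable_fst).mul
    ((measurable_coord j).comp measurable_fst))

theorem measurable_resMat (δ : ℝ) (a : Fin K) (i j : Fin d) :
    Measurable fun z : Vec d × Fin K => resMat δ a z i j := by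
  simp only [resMat, Matrix.sub_apply, Matrix.smul_apply, smul_eq_mul]
  exact measurable_const.sub ((measurable_mgrW a i j).const_mul _)

theorem abs_coord_le (x : Vec d) (i : Fin d) : |x i| ≤ ‖x‖ := by
  simpa using PiLp.norm_apply_le x i

theorem norm_sq_eq_dotProduct (x : Vec d) : ‖x‖ ^ 2 = x.ofLp ⬝ᵥ x.ofLp := by
  rw [EuclideanSpace.norm_sq_eq]
  simp [dotProduct, sq]

theorem inner_eq_dotProduct (x y : Vec d) : inner ℝ x y = x.ofLp ⬝ᵥ y.ofLp := by
  rw [EuclideanSpace.inner_eq_star_dotProduct, dotProduct_comm]; simp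

theorem abs_mgrW_le {C : ℝ} {x : Vec d} (hx : ‖x‖ ≤ C) (a b : Fin K) (i j : Fin d) :
    |mgrW a x b i j| ≤ C * C := by
  have hi := (abs_coord_le x i).trans hx
  have hj := (abs_coord_le x j).trans hx
  rw [mgrW_apply, abs_mul, abs_mul, abs_of_nonneg (armInd_nonneg a b)]
  exact (mul_le_of_le_one_left (by positivity) (armInd_le_one a b)).trans
    (mul_le_mul hi hj (abs_nonneg _) ((abs_nonneg _).trans hi))

theorem abs_resMat_le {C δ : ℝ} {x : Vec d} (hx : ‖x‖ ≤ C) (a b : Fin K) (i j : Fin d) :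
    |resMat δ a (x, b) i j| ≤ 1 + |δ| * (C * C) := by
  simp only [resMat, Matrix.sub_apply, Matrix.smul_apply, smul_eq_mul]
  refine (abs_sub _ _).trans (add_le_add ?_ ?_)
  · by_cases h : i = j <;> simp [Matrix.one_apply, h]
  · rw [abs_mul]
    exact mul_le_mul_of_nonneg_left (abs_mgrW_le hx a b i j) (abs_nonneg _)

theorem resMat_transpose (δ : ℝ) (a : Fin K) (z : Vec d × Fin K) :
    (resMat δ a z)ᵀ = resMat δ a z := by
  ext i j
  simp [resMat, mgrW_apply, Matrix.one_apply, eq_comm, mul_comm]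

theorem resMat_mulVec (δ : ℝ) (a : Fin K) (z : Vec d × Fin K) (y : Fin d → ℝ) :
    resMat δ a z *ᵥ y = y - (δ * armInd a z.2 * (z.1.ofLp ⬝ᵥ y)) • z.1.ofLp := by
  rw [resMat, mgrW_eq, Matrix.sub_mulVec, Matrix.one_mulVec, Matrix.smul_mulVec,
    Matrix.smul_mulVec, Matrix.vecMulVec_mulVec]
  ext i
  simp; ring

/-- The standing assumptions on a context distribution, a policy and a resampling step size. -/
structure IsMoments (D : Measure (Vec d)) (f : Vec d → Fin K → ℝ) (δ C : ℝ) : Prop where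
  prob : IsProbabilityMeasure D
  pol : IsPolicy f
  bdd : ∀ᵐ x ∂D, ‖x‖ ≤ C
  δ_pos : 0 < δ
  step : δ * C ^ 2 < 2

namespace IsMoments

variable {D : Measure (Vec d)} {f : Vec d → Fin K → ℝ} {δ C : ℝ} {a : Fin K}

theorem ae_le (h : IsMoments D f δ C) : ∀ᵐ z ∂(roundLaw D f), ‖z.1‖ ≤ C :=
  have := h.prob
  h.pol.ae_roundLaw h.bdd

theorem coord_bdd (h : IsMoments D f δ C) (i : Fin d) :
    BddMeas inferInstance (roundLaw D f) fun z : Vec d × Fin K => z.1.ofLp i :=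
  ⟨(measurable_coord i).comp measurable_fst, C, by
    filter_upwards [h.ae_le] with z hz using (abs_coord_le z.1 i).trans hz⟩

theorem armInd_bdd (a : Fin K) :
    BddMeas inferInstance (roundLaw D f) fun z : Vec d × Fin K => armInd a z.2 :=
  ⟨measurable_armInd a, 1, Filter.Eventually.of_forall fun z => by
    rw [abs_of_nonneg (armInd_nonneg a _)]; exact armInd_le_one a _⟩

theorem mgrW_bdd (h : IsMoments D f δ C) (a : Fin K) :
    MatBdd inferInstance (roundLaw D f) fun z : Vec d × Fin K => mgrW a z.1 z.2 := by
  intro i j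
  simp only [mgrW_apply]
  exact (armInd_bdd a).mul ((h.coord_bdd i).mul (h.coord_bdd j))

theorem resMat_bdd (h : IsMoments D f δ C) (a : Fin K) :
    MatBdd inferInstance (roundLaw D f) fun z : Vec d × Fin K => resMat δ a z :=
  (MatBdd.const 1).sub (.smul (.const δ) (h.mgrW_bdd a))

theorem ctx_bdd (h : IsMoments D f δ C) :
    VecBdd inferInstance (roundLaw D f) fun z : Vec d × Fin K => z.1.ofLp := h.coord_bdd

theorem armMoment_transpose : (armMoment D f a)ᵀ = armMoment D f a := by
  ext i j
  simp only [armMoment, Matrix.transpose_apply, Matrix.of_apply, mgrW_apply]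
  simp only [mul_comm]

theorem integral_dotProduct_mulVec (h : IsMoments D f δ C) {A : Vec d × Fin K → Matrix (Fin d) (Fin d) ℝ}
    (hA : MatBdd inferInstance (roundLaw D f) A) (y z : Fin d → ℝ) :
    y ⬝ᵥ ((Matrix.of fun i j => ∫ w, A w i j ∂(roundLaw D f)) *ᵥ z)
      = ∫ w, y ⬝ᵥ (A w *ᵥ z) ∂(roundLaw D f) := by
  have := h.prob
  have := h.pol.isProbabilityMeasure_roundLaw (D := D)
  simp only [dotProduct_mulVec_eq_sum, Matrix.of_apply]
  rw [integral_finsetSum]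
  · refine Finset.sum_congr rfl fun i _ => ?_
    rw [integral_finsetSum]
    · refine Finset.sum_congr rfl fun j _ => ?_
      rw [integral_mul_const, integral_const_mul]
    · exact fun j _ => (((BddMeas.const (y i)).mul (hA i j)).mul (.const (z j))).integrable
  · exact fun i _ => (BddMeas.sum _ fun j =>
      (((BddMeas.const (y i)).mul (hA i j)).mul (.const (z j)))).integrable

theorem dotProduct_armMoment (h : IsMoments D f δ C) (y z : Fin d → ℝ) :
    y ⬝ᵥ (armMoment D f a *ᵥ z)
      = ∫ w, armInd a w.2 * ((w.1.ofLp ⬝ᵥ y) * (w.1.ofLp ⬝ᵥ z)) ∂(roundLaw D f) := by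
  rw [armMoment, h.integral_dotProduct_mulVec (h.mgrW_bdd a)]
  refine integral_congr_ae (Filter.Eventually.of_forall fun w => ?_)
  simp only [mgrW_eq, Matrix.smul_mulVec, Matrix.vecMulVec_mulVec, dotProduct_comm y]
  simp only [smul_dotProduct, smul_eq_mul, MulOpposite.smul_eq_mul_unop, MulOpposite.unop_op]

theorem dotProduct_quadMap (h : IsMoments D f δ C) (A : Matrix (Fin d) (Fin d) ℝ)
    (y : Fin d → ℝ) :
    y ⬝ᵥ (quadMap (resMoment D f δ a) A *ᵥ y)
      = ∫ w, (resMat δ a w *ᵥ y) ⬝ᵥ (A *ᵥ (resMat δ a w *ᵥ y)) ∂(roundLaw D f) := by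
  have := h.prob
  have := h.pol.isProbabilityMeasure_roundLaw (D := D)
  have hN := h.resMat_bdd a
  have e : quadMap (resMoment D f δ a) A
      = Matrix.of fun i k => ∫ w, (resMat δ a w * A * (resMat δ a w)ᵀ) i k ∂(roundLaw D f) := by
    ext i k
    simp only [quadMap, Matrix.of_apply, resMoment, Matrix.mul_apply, Matrix.transpose_apply,
      Finset.sum_mul]
    have hb : ∀ j l, BddMeas inferInstance (roundLaw D f) fun w =>
        resMat δ a w i j * A j l * resMat δ a w k l := fun j l =>
      ((hN i j).mul (.const _)).mul (hN k l)
    rw [integral_finsetSum _ fun l _ => (BddMeas.sum _ fun j => hb j l).integrable,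
      Finset.sum_comm]
    refine Finset.sum_congr rfl fun l _ => ?_
    rw [integral_finsetSum _ fun j _ => (hb j l).integrable]
    refine Finset.sum_congr rfl fun j _ => ?_
    rw [← integral_const_mul]
    refine integral_congr_ae (Filter.Eventually.of_forall fun w => ?_)
    simp only; ring
  rw [e, h.integral_dotProduct_mulVec ((hN.mul (.const A)).mul hN.transpose)]
  refine integral_congr_ae (Filter.Eventually.of_forall fun w => ?_)
  simp only
  rw [← Matrix.mulVec_mulVec, ← Matrix.mulVec_mulVec, Matrix.dotProduct_mulVec,
    ← Matrix.mulVec_transpose, resMat_transpose]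

theorem quadNonneg_quadMap (h : IsMoments D f δ C) {A : Matrix (Fin d) (Fin d) ℝ}
    (hA : QuadNonneg A) : QuadNonneg (quadMap (resMoment D f δ a) A) := by
  intro y
  rw [h.dotProduct_quadMap]
  exact integral_nonneg fun w => hA _

theorem quadNonneg_iterate (h : IsMoments D f δ C) (n : ℕ) {A : Matrix (Fin d) (Fin d) ℝ}
    (hA : QuadNonneg A) : QuadNonneg ((quadMap (resMoment D f δ a))^[n] A) := by
  induction n with
  | zero => exact hA
  | succ n ih => rw [Function.iterate_succ_apply']; exact h.quadNonneg_quadMap ih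

theorem quadNonneg_one : QuadNonneg (1 : Matrix (Fin d) (Fin d) ℝ) := by
  intro y; rw [Matrix.one_mulVec]; exact dotProduct_self_nonneg' y

/-- Each resampling factor `I - δ 1[V = a] X Xᵀ` contracts, with a quantified gain in the direction of the
context; this is where `δ C² < 2` enters. -/
theorem resMat_mulVec_self_le {z : Vec d × Fin K} (hz : ‖z.1‖ ≤ C)
    (y : Fin d → ℝ) :
    (resMat δ a z *ᵥ y) ⬝ᵥ (resMat δ a z *ᵥ y)
      ≤ y ⬝ᵥ y - δ * (2 - δ * C ^ 2) * (armInd a z.2 * ((z.1.ofLp ⬝ᵥ y) * (z.1.ofLp ⬝ᵥ y))) := by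
  have hx : z.1.ofLp ⬝ᵥ z.1.ofLp ≤ C ^ 2 := by
    rw [← norm_sq_eq_dotProduct]; exact pow_le_pow_left₀ (norm_nonneg _) hz 2
  rw [resMat_mulVec]
  simp only [dotProduct_sub, sub_dotProduct, dotProduct_smul, smul_dotProduct, smul_eq_mul,
    dotProduct_comm y]
  have h0 := armInd_nonneg a z.2
  have h1 := armInd_mul_self a z.2
  have hs : 0 ≤ armInd a z.2 * (z.1.ofLp ⬝ᵥ y) ^ 2 * δ ^ 2 := by positivity
  have hs2 := mul_le_mul_of_nonneg_left hx hs
  set i := armInd a z.2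
  set s := z.1.ofLp ⬝ᵥ y
  set X := z.1.ofLp ⬝ᵥ z.1.ofLp
  have e : δ * i * s * (δ * i * s * X) = i * s ^ 2 * δ ^ 2 * X := by
    calc δ * i * s * (δ * i * s * X) = (i * i) * s ^ 2 * δ ^ 2 * X := by ring
      _ = _ := by rw [h1]
  linarith [e]

/-- One resampling step lowers the trace by a multiple of the average of the quadratic form of `A` over the
rounds playing `a`, so that these averages are summable along the iterates. -/
theorem trace_quadMap_le (h : IsMoments D f δ C) {A : Matrix (Fin d) (Fin d) ℝ}
    (hA : QuadNonneg A) :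
    (quadMap (resMoment D f δ a) A).trace ≤ A.trace - δ * (2 - δ * C ^ 2)
      * ∫ w, armInd a w.2 * (w.1.ofLp ⬝ᵥ (A *ᵥ w.1.ofLp)) ∂(roundLaw D f) := by
  have := h.prob
  have := h.pol.isProbabilityMeasure_roundLaw (D := D)
  have hN := h.resMat_bdd a
  have hAb : BddMeas inferInstance (roundLaw D f) fun w : Vec d × Fin K =>
      armInd a w.2 * (w.1.ofLp ⬝ᵥ (A *ᵥ w.1.ofLp)) :=
    (armInd_bdd a).mul (h.ctx_bdd.dotProduct ((MatBdd.const A).mulVec h.ctx_bdd))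
  have hvec : ∀ i : Fin d, VecBdd inferInstance (roundLaw D f)
      fun w => resMat δ a w *ᵥ Pi.single i 1 := fun i => hN.mulVec (.const _)
  have hib : ∀ i : Fin d, BddMeas inferInstance (roundLaw D f) fun w =>
      (resMat δ a w *ᵥ Pi.single i 1) ⬝ᵥ (A *ᵥ (resMat δ a w *ᵥ Pi.single i 1)) := fun i =>
    (hvec i).dotProduct ((MatBdd.const A).mulVec (hvec i))
  have tr : ∀ B : Matrix (Fin d) (Fin d) ℝ,
      B.trace = ∑ i, (Pi.single i 1 : Fin d → ℝ) ⬝ᵥ (B *ᵥ Pi.single i 1) := by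
    intro B; simp [Matrix.trace]
  rw [tr (quadMap _ _)]
  simp only [h.dotProduct_quadMap]
  rw [← integral_finsetSum _ fun i _ => (hib i).integrable, ← integral_const_mul]
  have : A.trace = ∫ _, A.trace ∂(roundLaw D f) := by simp
  rw [this, ← integral_sub (integrable_const _) (hAb.integrable.const_mul _)]
  refine integral_mono_ae (BddMeas.sum _ hib).integrable
    ((integrable_const _).sub (hAb.integrable.const_mul _)) ?_
  filter_upwards [h.ae_le] with w hw
  have hx : w.1.ofLp ⬝ᵥ w.1.ofLp ≤ C ^ 2 := by
    rw [← norm_sq_eq_dotProduct]; exact pow_le_pow_left₀ (norm_nonneg _) hw 2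
  have e : ∑ i, (resMat δ a w *ᵥ Pi.single i 1) ⬝ᵥ (A *ᵥ (resMat δ a w *ᵥ Pi.single i 1))
      = A.trace - 2 * δ * (armInd a w.2 * (w.1.ofLp ⬝ᵥ (A *ᵥ w.1.ofLp)))
        + δ ^ 2 * (w.1.ofLp ⬝ᵥ w.1.ofLp) * (armInd a w.2 * (w.1.ofLp ⬝ᵥ (A *ᵥ w.1.ofLp))) := by
    have h1 : ∀ i, (resMat δ a w *ᵥ Pi.single i 1) ⬝ᵥ (A *ᵥ (resMat δ a w *ᵥ Pi.single i 1))
        = A i i - δ * armInd a w.2 * (w.1.ofLp i * (A *ᵥ w.1.ofLp) i)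
          - δ * armInd a w.2 * ((w.1.ofLp ᵥ* A) i * w.1.ofLp i)
          + (δ ^ 2 * (armInd a w.2 * armInd a w.2) * (w.1.ofLp ⬝ᵥ (A *ᵥ w.1.ofLp)))
            * (w.1.ofLp i * w.1.ofLp i) := by
      intro i
      rw [resMat_mulVec]
      simp only [Matrix.mulVec_sub, Matrix.mulVec_smul, dotProduct_sub, sub_dotProduct,
        dotProduct_smul, smul_dotProduct, smul_eq_mul, single_one_dotProduct, dotProduct_single_one,
        Matrix.mulVec_single_one]
      simp only [Matrix.col_apply, Matrix.dotProduct_mulVec]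
      have : w.1.ofLp ⬝ᵥ A.col i = (w.1.ofLp ᵥ* A) i := rfl
      rw [this]
      ring
    simp only [h1, Finset.sum_add_distrib, Finset.sum_sub_distrib, ← Finset.mul_sum,
      armInd_mul_self]
    have e2 : ∑ i, w.1.ofLp i * (A *ᵥ w.1.ofLp) i = w.1.ofLp ⬝ᵥ (A *ᵥ w.1.ofLp) := rfl
    have e3 : ∑ i, (w.1.ofLp ᵥ* A) i * w.1.ofLp i = w.1.ofLp ⬝ᵥ (A *ᵥ w.1.ofLp) := by
      rw [Matrix.dotProduct_mulVec]; rfl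
    have e4 : ∑ i, w.1.ofLp i * w.1.ofLp i = w.1.ofLp ⬝ᵥ w.1.ofLp := rfl
    have e5 : ∑ i, A i i = A.trace := rfl
    rw [e2, e3, e4, e5]
    ring
  rw [e]
  have hnn : 0 ≤ δ ^ 2 * (armInd a w.2 * (w.1.ofLp ⬝ᵥ (A *ᵥ w.1.ofLp))) :=
    mul_nonneg (sq_nonneg _) (mul_nonneg (armInd_nonneg _ _) (hA _))
  nlinarith [mul_le_mul_of_nonneg_left hx hnn]

/-- Summing `trace_quadMap_le` over the iterates of `I` gives a telescoping sum. -/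
theorem sum_trace_le (h : IsMoments D f δ C) (n : ℕ) :
    δ * (2 - δ * C ^ 2) * ∑ k ∈ Finset.range n, ∫ w, armInd a w.2
      * (w.1.ofLp ⬝ᵥ ((quadMap (resMoment D f δ a))^[k] 1 *ᵥ w.1.ofLp)) ∂(roundLaw D f) ≤ d := by
  have key : ∀ n : ℕ, δ * (2 - δ * C ^ 2) * ∑ k ∈ Finset.range n, ∫ w, armInd a w.2
      * (w.1.ofLp ⬝ᵥ ((quadMap (resMoment D f δ a))^[k] 1 *ᵥ w.1.ofLp)) ∂(roundLaw D f)
      ≤ d - ((quadMap (resMoment D f δ a))^[n] 1).trace := by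
    intro n
    induction n with
    | zero => simp
    | succ n ih =>
      have := h.trace_quadMap_le (a := a) (h.quadNonneg_iterate (a := a) n quadNonneg_one)
      rw [Finset.sum_range_succ, mul_add, Function.iterate_succ_apply']
      linarith
  refine (key n).trans ?_
  have h1 := h.quadNonneg_iterate (a := a) n quadNonneg_one
  have : 0 ≤ ((quadMap (resMoment D f δ a))^[n] 1).trace := by
    refine Finset.sum_nonneg fun i _ => ?_
    simpa using h1 (Pi.single i 1)
  linarith

theorem dotProduct_quadMap_one_le (h : IsMoments D f δ C) (y : Fin d → ℝ) :
    y ⬝ᵥ (quadMap (resMoment D f δ a) 1 *ᵥ y)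
      ≤ y ⬝ᵥ y - δ * (2 - δ * C ^ 2) * (y ⬝ᵥ (armMoment D f a *ᵥ y)) := by
  have := h.prob
  have := h.pol.isProbabilityMeasure_roundLaw (D := D)
  rw [h.dotProduct_quadMap, h.dotProduct_armMoment, ← integral_const_mul]
  have : y ⬝ᵥ y = ∫ _, y ⬝ᵥ y ∂(roundLaw D f) := by simp
  rw [this]
  have hv := (h.resMat_bdd a).mulVec (VecBdd.const y)
  have hb : BddMeas inferInstance (roundLaw D f) fun w : Vec d × Fin K =>
      armInd a w.2 * ((w.1.ofLp ⬝ᵥ y) * (w.1.ofLp ⬝ᵥ y)) :=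
    (armInd_bdd a).mul ((h.ctx_bdd.dotProduct (.const y)).mul (h.ctx_bdd.dotProduct (.const y)))
  rw [← integral_sub (integrable_const _) (hb.integrable.const_mul _)]
  refine integral_mono_ae ?_ ((integrable_const _).sub (hb.integrable.const_mul _)) ?_
  · simp only [Matrix.one_mulVec]
    exact (hv.dotProduct hv).integrable
  · filter_upwards [h.ae_le] with w hw
    simp only [Matrix.one_mulVec]
    exact resMat_mulVec_self_le hw y

/-- If `armMoment` is bounded below, the sums of the iterates of `I` are bounded pointwise. -/
theorem sum_iterate_le (h : IsMoments D f δ C) {η : ℝ}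
    (hη : ∀ y, η * (y ⬝ᵥ y) ≤ δ * (2 - δ * C ^ 2) * (y ⬝ᵥ (armMoment D f a *ᵥ y)))
    (n : ℕ) (y : Fin d → ℝ) :
    η * ∑ k ∈ Finset.range n, y ⬝ᵥ ((quadMap (resMoment D f δ a))^[k] 1 *ᵥ y) ≤ y ⬝ᵥ y := by
  set L := quadMap (resMoment D f δ a) with hL
  have hstep : ∀ k, y ⬝ᵥ (L^[k + 1] 1 *ᵥ y) ≤ y ⬝ᵥ (L^[k] 1 *ᵥ y) - η * (y ⬝ᵥ (L^[k] 1 *ᵥ y)) := by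
    intro k
    have h1 : QuadNonneg ((1 : Matrix (Fin d) (Fin d) ℝ) - η • 1 - L 1) := by
      intro y
      have h1 := h.dotProduct_quadMap_one_le (a := a) y
      have h2 := hη y
      simp only [Matrix.sub_mulVec, dotProduct_sub, Matrix.one_mulVec, Matrix.smul_mulVec,
        dotProduct_smul, smul_eq_mul]
      linarith
    have h2 := h.quadNonneg_iterate (a := a) k h1 y
    rw [quadMap_iterate_sub, quadMap_iterate_sub, quadMap_iterate_smul] at h2
    simp only [Matrix.sub_mulVec, dotProduct_sub, Matrix.smul_mulVec,
        dotProduct_smul, smul_eq_mul, ← hL] at h2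
    rw [Function.iterate_succ_apply]
    linarith
  have key : ∀ n : ℕ, η * ∑ k ∈ Finset.range n, y ⬝ᵥ (L^[k] 1 *ᵥ y)
      ≤ y ⬝ᵥ y - y ⬝ᵥ (L^[n] 1 *ᵥ y) := by
    intro n
    induction n with
    | zero => simp
    | succ n ih =>
      rw [Finset.sum_range_succ, mul_add]
      linarith [hstep n]
  have := h.quadNonneg_iterate (a := a) n quadNonneg_one y
  linarith [key n]

theorem armMoment_nonneg (h : IsMoments D f δ C) (y : Fin d → ℝ) :
    0 ≤ y ⬝ᵥ (armMoment D f a *ᵥ y) := by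
  rw [h.dotProduct_armMoment]
  exact integral_nonneg fun w => mul_nonneg (armInd_nonneg _ _) (mul_self_nonneg _)

theorem armMoment_le (h : IsMoments D f δ C) (y : Fin d → ℝ) :
    y ⬝ᵥ (armMoment D f a *ᵥ y) ≤ C ^ 2 * (y ⬝ᵥ y) := by
  have := h.prob
  have := h.pol.isProbabilityMeasure_roundLaw (D := D)
  rw [h.dotProduct_armMoment]
  have : C ^ 2 * (y ⬝ᵥ y) = ∫ _, C ^ 2 * (y ⬝ᵥ y) ∂(roundLaw D f) := by simp
  rw [this]
  refine integral_mono_ae ((armInd_bdd a).mul ((h.ctx_bdd.dotProduct (.const y)).mul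
    (h.ctx_bdd.dotProduct (.const y)))).integrable (integrable_const _) ?_
  filter_upwards [h.ae_le] with w hw
  have hx : w.1.ofLp ⬝ᵥ w.1.ofLp ≤ C ^ 2 := by
    rw [← norm_sq_eq_dotProduct]; exact pow_le_pow_left₀ (norm_nonneg _) hw 2
  have hcs : (w.1.ofLp ⬝ᵥ y) * (w.1.ofLp ⬝ᵥ y) ≤ (w.1.ofLp ⬝ᵥ w.1.ofLp) * (y ⬝ᵥ y) := by
    have := Finset.sum_mul_sq_le_sq_mul_sq Finset.univ w.1.ofLp y
    simpa only [dotProduct, sq] using this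
  calc armInd a w.2 * ((w.1.ofLp ⬝ᵥ y) * (w.1.ofLp ⬝ᵥ y))
      ≤ (w.1.ofLp ⬝ᵥ y) * (w.1.ofLp ⬝ᵥ y) :=
        mul_le_of_le_one_left (mul_self_nonneg _) (armInd_le_one _ _)
    _ ≤ _ := hcs
    _ ≤ _ := mul_le_mul_of_nonneg_right hx (dotProduct_self_nonneg' y)

/-- If the quadratic form of `armMoment` is at least `s`, then `I - δ armMoment` is a contraction
with factor `max (1 - δ s) (δ C² - 1)`. -/
theorem abs_dotProduct_resMean_le (h : IsMoments D f δ C) {s c : ℝ}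
    (hs : ∀ y, s * (y ⬝ᵥ y) ≤ y ⬝ᵥ (armMoment D f a *ᵥ y)) (hc1 : 1 - δ * s ≤ c)
    (hc2 : δ * C ^ 2 - 1 ≤ c) (y : Fin d → ℝ) :
    |y ⬝ᵥ ((1 - δ • armMoment D f a) *ᵥ y)| ≤ c * (y ⬝ᵥ y) := by
  have h1 := mul_le_mul_of_nonneg_left (hs y) h.δ_pos.le
  have h2 := mul_le_mul_of_nonneg_left (h.armMoment_le (a := a) y) h.δ_pos.le
  have h3 := mul_le_mul_of_nonneg_right hc1 (dotProduct_self_nonneg' y)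
  have h4 := mul_le_mul_of_nonneg_right hc2 (dotProduct_self_nonneg' y)
  simp only [Matrix.sub_mulVec, dotProduct_sub, Matrix.one_mulVec, Matrix.smul_mulVec,
        dotProduct_smul, smul_eq_mul]
  rw [abs_le]
  constructor <;> nlinarith

theorem resMean_transpose : (1 - δ • armMoment D f a)ᵀ = 1 - δ • armMoment D f a := by
  rw [Matrix.transpose_sub, Matrix.transpose_one, Matrix.transpose_smul, armMoment_transpose]

theorem abs_dotProduct_resMean_pow_le (h : IsMoments D f δ C) (n : ℕ) (x y : Fin d → ℝ) :
    |x ⬝ᵥ ((1 - δ • armMoment D f a) ^ n *ᵥ y)| ≤ √(x ⬝ᵥ x) * √(y ⬝ᵥ y) := by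
  have := abs_dotProduct_pow_mulVec_le (c := 1) (resMean_transpose (D := D) (f := f) (a := a)) zero_le_one
    (h.abs_dotProduct_resMean_le (s := 0) (a := a) (by simpa using h.armMoment_nonneg) (by simp)
      (by linarith [h.step])) n x y
  simpa using this

theorem smul_armMoment_mul_geom (n : ℕ) :
    δ • (armMoment D f a * ∑ j ∈ Finset.range n, (1 - δ • armMoment D f a) ^ j)
      = 1 - (1 - δ • armMoment D f a) ^ n := by
  have := mul_neg_geom_sum (1 - δ • armMoment D f a) n
  rw [sub_sub_cancel] at this
  rw [← this, Matrix.smul_mul]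

/-- The geometric sum telescopes against the second moment of arm `a`: their product is
`δ⁻¹ (I - (I - δ S)ⁿ)`, and the powers of `I - δ S` are contractions. -/
theorem quadNonneg_two_div_sub (h : IsMoments D f δ C) (n : ℕ) :
    QuadNonneg ((2 / δ) • (1 : Matrix (Fin d) (Fin d) ℝ)
      - armMoment D f a * ∑ j ∈ Finset.range n, (1 - δ • armMoment D f a) ^ j) := by
  intro y
  have h1 := (abs_le.1 (h.abs_dotProduct_resMean_pow_le (a := a) n y y)).1
  rw [Real.mul_self_sqrt (dotProduct_self_nonneg' y)] at h1
  have h2 := congrArg (fun B => y ⬝ᵥ (B *ᵥ y))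
    (smul_armMoment_mul_geom (D := D) (f := f) (a := a) (δ := δ) n)
  simp only [Matrix.sub_mulVec, dotProduct_sub, Matrix.one_mulVec, Matrix.smul_mulVec,
        dotProduct_smul, smul_eq_mul] at h2 ⊢
  have hδ := h.δ_pos
  have h3 : δ * (2 / δ * (y ⬝ᵥ y) - y ⬝ᵥ ((armMoment D f a *
      ∑ j ∈ Finset.range n, (1 - δ • armMoment D f a) ^ j) *ᵥ y)) ≥ 0 := by
    rw [mul_sub, h2]
    have : δ * (2 / δ * (y ⬝ᵥ y)) = 2 * (y ⬝ᵥ y) := by field_simp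
    linarith
  exact nonneg_of_mul_nonneg_right h3 hδ

end IsMoments

end Moments

end LinBandit

namespace LinBandit

/-! ### Entropy-regularized leaders -/

section FTRL

variable {K : ℕ}

/-- The normalizing constant of the Gibbs distribution of `L` at temperature `β`. -/
noncomputable def partition (L : Fin K → ℝ) (β : ℝ) : ℝ := ∑ a, Real.exp (-L a / β)

/-- The Gibbs distribution of `L` at temperature `β`. -/
noncomputable def softmax (L : Fin K → ℝ) (β : ℝ) (a : Fin K) : ℝ :=
  Real.exp (-L a / β) / partition L β

/-- The free energy `-β log ∑ₐ exp (-L a / β)`, the minimum of the entropy-regularized objective. -/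
noncomputable def freeEnergy (L : Fin K → ℝ) (β : ℝ) : ℝ := -β * Real.log (partition L β)

theorem partition_pos (hK : 0 < K) (L : Fin K → ℝ) (β : ℝ) : 0 < partition L β :=
  Finset.sum_pos (fun _ _ => Real.exp_pos _) ⟨⟨0, hK⟩, Finset.mem_univ _⟩

theorem softmax_pos (hK : 0 < K) (L : Fin K → ℝ) (β : ℝ) (a : Fin K) : 0 < softmax L β a :=
  div_pos (Real.exp_pos _) (partition_pos hK L β)

theorem sum_softmax (hK : 0 < K) (L : Fin K → ℝ) (β : ℝ) : ∑ a, softmax L β a = 1 := by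
  simp only [softmax, ← Finset.sum_div]
  exact div_self (partition_pos hK L β).ne'

theorem softmax_mem (hK : 0 < K) (L : Fin K → ℝ) (β : ℝ) :
    softmax L β ∈ stdSimplex ℝ (Fin K) :=
  ⟨fun a => (softmax_pos hK L β a).le, sum_softmax hK L β⟩

theorem log_softmax (hK : 0 < K) (L : Fin K → ℝ) (β : ℝ) (a : Fin K) :
    Real.log (softmax L β a) = -L a / β - Real.log (partition L β) := by
  rw [softmax, Real.log_div (Real.exp_pos _).ne' (partition_pos hK L β).ne', Real.log_exp]

theorem entropy_eq (p : Fin K → ℝ) : entropy p = -∑ a, p a * Real.log (p a) := by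
  simp [entropy, Real.log_inv]

theorem sub_le_mul_log {x y : ℝ} (hx : 0 ≤ x) (hy : 0 < y) :
    x - y ≤ x * (Real.log x - Real.log y) := by
  rcases hx.eq_or_lt with rfl | hx
  · simpa using hy.le
  · have := Real.log_le_sub_one_of_pos (div_pos hy hx)
    rw [Real.log_div hy.ne' hx.ne'] at this
    have h2 := mul_le_mul_of_nonneg_left this hx.le
    have e : x * (y / x - 1) = y - x := by field_simp
    linarith

theorem eq_of_mul_log_le {x y : ℝ} (hx : 0 ≤ x) (hy : 0 < y)
    (h : x * (Real.log x - Real.log y) ≤ x - y) : x = y := by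
  rcases hx.eq_or_lt with rfl | hx
  · simp at h; linarith
  · by_contra hne
    have := Real.log_lt_sub_one_of_pos (div_pos hy hx)
      (fun h1 => hne ((div_eq_one_iff_eq hx.ne').1 h1).symm)
    rw [Real.log_div hy.ne' hx.ne'] at this
    have h2 := mul_lt_mul_of_pos_left this hx
    have e : x * (y / x - 1) = y - x := by field_simp
    linarith

theorem objective_eq (hK : 0 < K) {L u : Fin K → ℝ} {β : ℝ} (hβ : 0 < β)
    (hu : u ∈ stdSimplex ℝ (Fin K)) :
    ∑ a, L a * u a - β * entropy u = freeEnergy L β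
      + β * ∑ a, u a * (Real.log (u a) - Real.log (softmax L β a)) := by
  have h1 : ∀ a, L a * u a = -(β * (u a * (-L a / β - Real.log (partition L β))))
      - β * Real.log (partition L β) * u a := by
    intro a; field_simp; ring
  rw [entropy_eq]
  simp only [log_softmax hK, mul_sub (u _), Finset.sum_sub_distrib, h1, Finset.sum_neg_distrib,
    ← Finset.mul_sum, ← Finset.sum_mul, hu.2, freeEnergy]
  ring

theorem freeEnergy_le (hK : 0 < K) {L u : Fin K → ℝ} {β : ℝ} (hβ : 0 < β)
    (hu : u ∈ stdSimplex ℝ (Fin K)) : freeEnergy L β ≤ ∑ a, L a * u a - β * entropy u := by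
  rw [objective_eq hK hβ hu]
  have : ∑ a, (u a - softmax L β a)
      ≤ ∑ a, u a * (Real.log (u a) - Real.log (softmax L β a)) :=
    Finset.sum_le_sum fun a _ => sub_le_mul_log (hu.1 a) (softmax_pos hK L β a)
  rw [Finset.sum_sub_distrib, hu.2, sum_softmax hK, sub_self] at this
  linarith [mul_nonneg hβ.le this]

theorem freeEnergy_eq_softmax (hK : 0 < K) (L : Fin K → ℝ) {β : ℝ} (hβ : 0 < β) :
    freeEnergy L β = ∑ a, L a * softmax L β a - β * entropy (softmax L β) := by
  rw [objective_eq hK hβ (softmax_mem hK L β)]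
  simp

/-- The Gibbs distribution is the only minimizer of the entropy-regularized objective. -/
theorem eq_softmax_of_isMinOn (hK : 0 < K) {L u : Fin K → ℝ} {β : ℝ} (hβ : 0 < β)
    (hu : u ∈ stdSimplex ℝ (Fin K))
    (hmin : IsMinOn (fun u => ∑ a, L a * u a + -β * entropy u) (stdSimplex ℝ (Fin K)) u) :
    u = softmax L β := by
  have h1 := hmin (softmax_mem hK L β)
  simp only [Set.mem_ofPred_eq, neg_mul, ← sub_eq_add_neg] at h1
  rw [← freeEnergy_eq_softmax hK L hβ, objective_eq hK hβ hu] at h1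
  have h2 : ∑ a, u a * (Real.log (u a) - Real.log (softmax L β a)) ≤ 0 := by
    by_contra h
    push Not at h
    linarith [mul_pos hβ h]
  have h3 : ∀ a ∈ Finset.univ, 0 ≤ u a * (Real.log (u a) - Real.log (softmax L β a))
      - (u a - softmax L β a) := fun a _ =>
    sub_nonneg.2 (sub_le_mul_log (hu.1 a) (softmax_pos hK L β a))
  have h4 : ∑ a, (u a * (Real.log (u a) - Real.log (softmax L β a))
      - (u a - softmax L β a)) = 0 := by
    refine le_antisymm ?_ (Finset.sum_nonneg h3)
    rw [Finset.sum_sub_distrib, Finset.sum_sub_distrib, hu.2, sum_softmax hK]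
    linarith
  have h5 := (Finset.sum_eq_zero_iff_of_nonneg h3).1 h4
  ext a
  exact eq_of_mul_log_le (hu.1 a) (softmax_pos hK L β a) (by linarith [h5 a (Finset.mem_univ a)])

theorem entropy_nonneg {p : Fin K → ℝ} (hp : p ∈ stdSimplex ℝ (Fin K)) : 0 ≤ entropy p := by
  rw [entropy_eq, neg_nonneg]
  refine Finset.sum_nonpos fun a _ => mul_nonpos_of_nonneg_of_nonpos (hp.1 a)
    (Real.log_nonpos (hp.1 a) ?_)
  rw [← hp.2]
  exact Finset.single_le_sum (fun i _ => hp.1 i) (Finset.mem_univ a)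

theorem freeEnergy_zero (β : ℝ) : freeEnergy (0 : Fin K → ℝ) β = -β * Real.log K := by
  simp [freeEnergy, partition]

theorem entropy_le (hK : 0 < K) {p : Fin K → ℝ} (hp : p ∈ stdSimplex ℝ (Fin K)) :
    entropy p ≤ Real.log K := by
  have := freeEnergy_le (L := 0) hK one_pos hp
  rw [freeEnergy_zero] at this
  simpa using this

theorem exp_neg_le_of_abs_le {z c : ℝ} (h : |z| ≤ c) :
    Real.exp (-z) ≤ 1 - z + Real.exp c * z ^ 2 := by
  have h1 := Complex.norm_exp_sub_sum_le_norm_mul_exp ((-z : ℝ) : ℂ) 2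
  have h2 : Complex.exp ((-z : ℝ) : ℂ) - ∑ m ∈ Finset.range 2, ((-z : ℝ) : ℂ) ^ m / (m.factorial : ℂ)
      = ((Real.exp (-z) - (1 - z) : ℝ) : ℂ) := by
    simp [Finset.sum_range_succ]
    ring
  rw [h2, Complex.norm_real, Complex.norm_real, Real.norm_eq_abs, Real.norm_eq_abs, abs_neg,
    sq_abs] at h1
  have h3 := (abs_le.1 h1).2
  have h4 : z ^ 2 * Real.exp |z| ≤ Real.exp c * z ^ 2 := by
    rw [mul_comm]
    exact mul_le_mul_of_nonneg_right (Real.exp_le_exp.2 h) (sq_nonneg z)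
  linarith

theorem partition_add (hK : 0 < K) (L l : Fin K → ℝ) (β : ℝ) :
    partition (L + l) β = partition L β * ∑ a, softmax L β a * Real.exp (-(l a / β)) := by
  rw [Finset.mul_sum, partition]
  refine Finset.sum_congr rfl fun a _ => ?_
  rw [← mul_assoc, softmax, mul_div_cancel₀ _ (partition_pos hK L β).ne', ← Real.exp_add]
  congr 1
  simp only [Pi.add_apply]
  ring

theorem freeEnergy_add (hK : 0 < K) (L l : Fin K → ℝ) (β : ℝ) :
    freeEnergy (L + l) β = freeEnergy L β
      - β * Real.log (∑ a, softmax L β a * Real.exp (-(l a / β))) := by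
  have : 0 < ∑ a, softmax L β a * Real.exp (-(l a / β)) :=
    Finset.sum_pos (fun a _ => mul_pos (softmax_pos hK L β a) (Real.exp_pos _))
      ⟨⟨0, hK⟩, Finset.mem_univ _⟩
  rw [freeEnergy, partition_add hK, Real.log_mul (partition_pos hK L β).ne' this.ne', freeEnergy]
  ring

/-- Second-order expansion of the free energy, from `exp (-z) ≤ 1 - z + exp c * z ^ 2` for `|z| ≤ c`. The losses
need only be bounded by a multiple of the rate, from either side. -/
theorem freeEnergy_add_ge (hK : 0 < K) {L l : Fin K → ℝ} {β c : ℝ} (hβ : 0 < β)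
    (hl : ∀ a, |l a| ≤ c * β) :
    freeEnergy L β + ∑ a, softmax L β a * l a
        - Real.exp c * ((∑ a, softmax L β a * l a ^ 2) / β)
      ≤ freeEnergy (L + l) β := by
  rw [freeEnergy_add hK]
  have hpos : 0 < ∑ a, softmax L β a * Real.exp (-(l a / β)) :=
    Finset.sum_pos (fun a _ => mul_pos (softmax_pos hK L β a) (Real.exp_pos _))
      ⟨⟨0, hK⟩, Finset.mem_univ _⟩
  have h1 : ∑ a, softmax L β a * Real.exp (-(l a / β))
      ≤ ∑ a, softmax L β a * (1 - l a / β + Real.exp c * (l a / β) ^ 2) := by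
    refine Finset.sum_le_sum fun a _ => mul_le_mul_of_nonneg_left ?_ (softmax_pos hK L β a).le
    refine exp_neg_le_of_abs_le ?_
    rw [abs_div, abs_of_pos hβ, div_le_iff₀ hβ]
    exact hl a
  have h2 : ∑ a, softmax L β a * (1 - l a / β + Real.exp c * (l a / β) ^ 2)
      = 1 - (∑ a, softmax L β a * l a) / β
        + Real.exp c * ((∑ a, softmax L β a * l a ^ 2) / β) / β := by
    have : ∀ a, softmax L β a * (1 - l a / β + Real.exp c * (l a / β) ^ 2)
        = softmax L β a - softmax L β a * l a / β
          + Real.exp c * (softmax L β a * l a ^ 2 / β) / β := by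
      intro a; field_simp
    simp only [this, Finset.sum_add_distrib, Finset.sum_sub_distrib, sum_softmax hK,
      ← Finset.sum_div, ← Finset.mul_sum]
  have h3 := Real.log_le_sub_one_of_pos hpos
  have h4 : Real.log (∑ a, softmax L β a * Real.exp (-(l a / β)))
      ≤ - (∑ a, softmax L β a * l a) / β
        + Real.exp c * ((∑ a, softmax L β a * l a ^ 2) / β) / β := by
    rw [h2] at h1
    have : -(∑ a, softmax L β a * l a) / β = -((∑ a, softmax L β a * l a) / β) := by ring
    rw [this]
    linarith
  have h5 := mul_le_mul_of_nonneg_left h4 hβ.le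
  have h6 : β * (- (∑ a, softmax L β a * l a) / β
        + Real.exp c * ((∑ a, softmax L β a * l a ^ 2) / β) / β)
      = - (∑ a, softmax L β a * l a) + Real.exp c * ((∑ a, softmax L β a * l a ^ 2) / β) := by
    field_simp
  linarith

theorem freeEnergy_add_ge_of_abs_le (hK : 0 < K) {L l : Fin K → ℝ} {β b : ℝ} (hβ : 0 < β)
    (hl : ∀ a, |l a| ≤ b) :
    freeEnergy L β + ∑ a, softmax L β a * l a - 2 * b ≤ freeEnergy (L + l) β := by
  rw [freeEnergy_eq_softmax hK (L + l) hβ]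
  have h1 := freeEnergy_le (L := L) hK hβ (softmax_mem hK (L + l) β)
  have h2 : ∀ p ∈ stdSimplex ℝ (Fin K), |∑ a, p a * l a| ≤ b := by
    intro p hp
    calc |∑ a, p a * l a| ≤ ∑ a, p a * b := by
          refine (Finset.abs_sum_le_sum_abs _ _).trans (Finset.sum_le_sum fun a _ => ?_)
          rw [abs_mul, abs_of_nonneg (hp.1 a)]
          exact mul_le_mul_of_nonneg_left (hl a) (hp.1 a)
      _ = b := by rw [← Finset.sum_mul, hp.2, one_mul]
  have h3 := (abs_le.1 (h2 _ (softmax_mem hK (L + l) β))).1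
  have h4 := (abs_le.1 (h2 _ (softmax_mem hK L β))).2
  simp only [Pi.add_apply, add_mul, Finset.sum_add_distrib]
  simp only [mul_comm (softmax (L + l) β _)] at h3
  linarith

/-- The stability of one step. The resampling count `⌊2β - 1⌋₊` keeps the loss estimates of order
`β` once `β ≥ 1 / 2`; below that they are at most a constant, which is paid for by `1 / β`. -/
theorem freeEnergy_add_ge_of_simCount (hK : 0 < K) {L l : Fin K → ℝ} {β c : ℝ} (hβ : 0 < β)
    (hc : 0 ≤ c) (hl : ∀ a, |l a| ≤ c / 2 * (⌊2 * β - 1⌋₊ + 1)) :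
    freeEnergy L β + ∑ a, softmax L β a * l a
        - (Real.exp c * ((∑ a, softmax L β a * l a ^ 2) / β) + c / β)
      ≤ freeEnergy (L + l) β := by
  rcases le_or_gt 1 (2 * β) with h | h
  · have h1 : ((⌊2 * β - 1⌋₊ : ℕ) : ℝ) ≤ 2 * β - 1 := Nat.floor_le (by linarith)
    have h2 := freeEnergy_add_ge (L := L) hK hβ (c := c) fun a => (hl a).trans (by nlinarith)
    have : 0 ≤ c / β := by positivity
    linarith
  · have h1 : ⌊2 * β - 1⌋₊ = 0 := Nat.floor_eq_zero.2 (by linarith)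
    rw [h1] at hl
    have h2 := freeEnergy_add_ge_of_abs_le (L := L) hK hβ (b := c / 2) fun a => by simpa using hl a
    have h3 : c ≤ c / β := by
      rw [le_div_iff₀ hβ]; nlinarith
    have h4 : 0 ≤ Real.exp c * ((∑ a, softmax L β a * l a ^ 2) / β) := by
      have := Finset.sum_nonneg fun a (_ : a ∈ Finset.univ) =>
        mul_nonneg (softmax_pos hK L β a).le (sq_nonneg (l a))
      positivity
    linarith

/-- Changing the rate costs at most the increment times the entropy of the new minimizer. -/
theorem freeEnergy_rate (hK : 0 < K) (L : Fin K → ℝ) {β β' : ℝ} (hβ : 0 < β) (hβ' : 0 < β') :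
    freeEnergy L β - (β' - β) * entropy (softmax L β') ≤ freeEnergy L β' := by
  rw [freeEnergy_eq_softmax hK L hβ']
  have := freeEnergy_le (L := L) hK hβ (softmax_mem hK L β')
  linarith

/-- The regret of follow-the-regularized-leader with varying rates against a fixed `u`. -/
theorem ftrl_regret_le (hK : 0 < K) {T : ℕ} (hT : 1 ≤ T) {β : ℕ → ℝ} {l : ℕ → Fin K → ℝ}
    {stab : ℕ → ℝ} (hβ : ∀ t ∈ Finset.Icc 1 T, 0 < β t)
    (hstab : ∀ t ∈ Finset.Icc 1 T,
      freeEnergy (fun a => ∑ s ∈ Finset.Ico 1 t, l s a) (β t)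
          + ∑ a, softmax (fun a => ∑ s ∈ Finset.Ico 1 t, l s a) (β t) a * l t a - stab t
        ≤ freeEnergy ((fun a => ∑ s ∈ Finset.Ico 1 t, l s a) + l t) (β t))
    {u : Fin K → ℝ} (hu : u ∈ stdSimplex ℝ (Fin K)) :
    ∑ t ∈ Finset.Icc 1 T, ∑ a, (softmax (fun a => ∑ s ∈ Finset.Ico 1 t, l s a) (β t) a - u a) * l t a
      ≤ β 1 * Real.log K
        + ∑ t ∈ Finset.Ico 1 T, (β (t + 1) - β t)
            * entropy (softmax (fun a => ∑ s ∈ Finset.Ico 1 (t + 1), l s a) (β (t + 1)))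
        + ∑ t ∈ Finset.Icc 1 T, stab t := by
  set L : ℕ → Fin K → ℝ := fun t a => ∑ s ∈ Finset.Ico 1 t, l s a with hL
  replace hstab : ∀ t ∈ Finset.Icc 1 T,
      freeEnergy (L t) (β t) + ∑ a, softmax (L t) (β t) a * l t a - stab t
        ≤ freeEnergy (L t + l t) (β t) := hstab
  have hLs : ∀ t, 1 ≤ t → L (t + 1) = L t + l t := by
    intro t ht
    ext a
    simp [hL, Finset.sum_Ico_succ_top ht]
  have key : ∀ n, 1 ≤ n → n ≤ T →
      -(β 1 * Real.log K) + ∑ t ∈ Finset.Icc 1 n, (∑ a, softmax (L t) (β t) a * l t a - stab t)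
        - ∑ t ∈ Finset.Ico 1 n, (β (t + 1) - β t) * entropy (softmax (L (t + 1)) (β (t + 1)))
      ≤ freeEnergy (L (n + 1)) (β n) := by
    intro n hn
    induction n, hn using Nat.le_induction with
    | base =>
      intro _
      have h1 := hstab 1 (by simpa using hT)
      have h2 : L 1 = 0 := by ext a; simp [hL]
      rw [← hLs 1 le_rfl] at h1
      have h3 := freeEnergy_zero (K := K) (β 1)
      rw [Finset.Icc_self, Finset.sum_singleton, Finset.Ico_self, Finset.sum_empty, h2]
      rw [h2, h3] at h1
      linarith
    | succ n hn ih =>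
      intro hnT
      have h0 := ih (by omega)
      have hm : n + 1 ∈ Finset.Icc 1 T := Finset.mem_Icc.2 ⟨by omega, hnT⟩
      have h1 := hstab (n + 1) hm
      rw [← hLs (n + 1) (by omega)] at h1
      have h2 := freeEnergy_rate hK (L (n + 1)) (hβ n (Finset.mem_Icc.2 ⟨hn, by omega⟩))
        (hβ (n + 1) hm)
      rw [Finset.sum_Icc_succ_top (by omega), Finset.sum_Ico_succ_top hn]
      linarith
  have h1 := key T hT le_rfl
  have hTm : 0 < β T := hβ T (Finset.mem_Icc.2 ⟨hT, le_rfl⟩)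
  have h2 := freeEnergy_le (L := L (T + 1)) hK hTm hu
  have h3 := mul_nonneg hTm.le (entropy_nonneg hu)
  have h4 : ∑ a, L (T + 1) a * u a = ∑ t ∈ Finset.Icc 1 T, ∑ a, u a * l t a := by
    rw [Finset.sum_comm]
    refine Finset.sum_congr rfl fun a _ => ?_
    rw [hL]
    simp only [Finset.sum_mul]
    refine Finset.sum_congr (by ext; simp) fun s _ => mul_comm _ _
  simp only [sub_mul, Finset.sum_sub_distrib] at h1 ⊢
  linarith

end FTRL

/-! ### Growth of the rates -/

theorem sqrt_succ_sub_le (n : ℕ) : √((n : ℝ) + 1) - √n ≤ 1 / √(1 + (n : ℝ)) := by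
  have hpos : 0 < √(1 + (n : ℝ)) := Real.sqrt_pos.2 (by positivity)
  rw [le_div_iff₀ hpos, add_comm (n : ℝ) 1]
  have h1 : √(1 + (n : ℝ)) * √(1 + (n : ℝ)) = 1 + n := Real.mul_self_sqrt (by positivity)
  have h2 : √(n : ℝ) * √n = n := Real.mul_self_sqrt (by positivity)
  have h3 : √(n : ℝ) ≤ √(1 + (n : ℝ)) := Real.sqrt_le_sqrt (by linarith)
  nlinarith [Real.sqrt_nonneg (n : ℝ)]

theorem sum_one_div_sqrt_le (T : ℕ) : ∑ t ∈ Finset.Icc 1 T, 1 / √(t : ℝ) ≤ 2 * √T := by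
  induction T with
  | zero => simp
  | succ n ih =>
    rw [Finset.sum_Icc_succ_top (by omega)]
    have hpos : 0 < √((n + 1 : ℕ) : ℝ) := Real.sqrt_pos.2 (by positivity)
    have : 1 / √((n + 1 : ℕ) : ℝ) ≤ 2 * (√((n + 1 : ℕ) : ℝ) - √n) := by
      rw [div_le_iff₀ hpos]
      have h1 : √((n + 1 : ℕ) : ℝ) * √((n + 1 : ℕ) : ℝ) = n + 1 := by
        rw [Real.mul_self_sqrt (by positivity)]; push_cast; ring
      have h2 : √(n : ℝ) * √n = n := Real.mul_self_sqrt (by positivity)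
      nlinarith [sq_nonneg (√((n + 1 : ℕ) : ℝ) - √n)]
    linarith

theorem div_sqrt_le_sub {S h : ℝ} (hS : 0 ≤ S) (h0 : 0 ≤ h) (h1 : h ≤ 1) :
    h / √(1 + S) ≤ 2 * (√(S + h) - √S) := by
  have hpos : 0 < √(1 + S) := Real.sqrt_pos.2 (by positivity)
  rw [div_le_iff₀ hpos]
  have e1 : √(S + h) * √(S + h) = S + h := Real.mul_self_sqrt (by positivity)
  have e2 : √S * √S = S := Real.mul_self_sqrt hS
  have m1 : √(S + h) ≤ √(1 + S) := Real.sqrt_le_sqrt (by linarith)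
  have m2 : √S ≤ √(1 + S) := Real.sqrt_le_sqrt (by linarith)
  have m3 : √S ≤ √(S + h) := Real.sqrt_le_sqrt (by linarith)
  nlinarith [mul_nonneg (sub_nonneg.2 m3) (sub_nonneg.2 m1),
    mul_nonneg (sub_nonneg.2 m3) (sub_nonneg.2 m2)]

section Rates

variable {T : ℕ} {β h : ℕ → ℝ} {β₁ : ℝ}

theorem rate_ge (hβ₁ : 0 < β₁) (h1 : β 1 = β₁) (hh : ∀ t ∈ Finset.Icc 1 T, h t ≤ 1)
    (hh0 : ∀ t ∈ Finset.Icc 1 T, 0 ≤ h t)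
    (hβ : ∀ t ∈ Finset.Icc 1 T, β (t + 1) = β t + β₁ / √(1 + ∑ s ∈ Finset.Icc 1 t, h s))
    {t : ℕ} (ht : 1 ≤ t) (htT : t ≤ T + 1) : β₁ * √t ≤ β t := by
  induction t, ht using Nat.le_induction with
  | base => simp [h1]
  | succ t ht ih =>
    rw [hβ t (Finset.mem_Icc.2 ⟨ht, by omega⟩)]
    have hsub : ∀ s ∈ Finset.Icc 1 t, s ∈ Finset.Icc 1 T := fun s hs => by
      simp only [Finset.mem_Icc] at hs ⊢; omega
    have hS : ∑ s ∈ Finset.Icc 1 t, h s ≤ t := by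
      calc ∑ s ∈ Finset.Icc 1 t, h s ≤ ∑ s ∈ Finset.Icc 1 t, (1 : ℝ) :=
            Finset.sum_le_sum fun s hs => hh s (hsub s hs)
        _ = t := by simp
    have hS0 : 0 ≤ ∑ s ∈ Finset.Icc 1 t, h s := Finset.sum_nonneg fun s hs => hh0 s (hsub s hs)
    have h2 : β₁ / √(1 + (t : ℝ)) ≤ β₁ / √(1 + ∑ s ∈ Finset.Icc 1 t, h s) := by
      refine div_le_div_of_nonneg_left hβ₁.le (Real.sqrt_pos.2 (by positivity))
        (Real.sqrt_le_sqrt (by linarith))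
    have h3 := mul_le_mul_of_nonneg_left (sqrt_succ_sub_le t) hβ₁.le
    have h4 := ih (by omega)
    push_cast
    have h5 : β₁ * (1 / √(1 + (t : ℝ))) = β₁ / √(1 + (t : ℝ)) := by ring
    linarith

theorem rate_le (hβ₁ : 0 < β₁) (h1 : β 1 = β₁) (hh0 : ∀ t ∈ Finset.Icc 1 T, 0 ≤ h t)
    (hβ : ∀ t ∈ Finset.Icc 1 T, β (t + 1) = β t + β₁ / √(1 + ∑ s ∈ Finset.Icc 1 t, h s))
    {t : ℕ} (ht : 1 ≤ t) (htT : t ≤ T + 1) : β t ≤ t * β₁ := by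
  induction t, ht using Nat.le_induction with
  | base => simp [h1]
  | succ t ht ih =>
    rw [hβ t (Finset.mem_Icc.2 ⟨ht, by omega⟩)]
    have hS0 : 0 ≤ ∑ s ∈ Finset.Icc 1 t, h s := Finset.sum_nonneg fun s hs => hh0 s (by
      simp only [Finset.mem_Icc] at hs ⊢; omega)
    have : β₁ / √(1 + ∑ s ∈ Finset.Icc 1 t, h s) ≤ β₁ :=
      div_le_self hβ₁.le (Real.one_le_sqrt.2 (by linarith))
    have := ih (by omega)
    push_cast
    linarith

/-- Since `h ≤ 1`, the terms are at most `β₁ h (t + 1) / √S (t + 1)` for the partial sums `S` of `h`, which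
telescope against `2 β₁ √S`. -/
theorem sum_rate_diff_le (hβ₁ : 0 < β₁) (hh : ∀ t ∈ Finset.Icc 1 T, h t ≤ 1)
    (hh0 : ∀ t ∈ Finset.Icc 1 T, 0 ≤ h t)
    (hβ : ∀ t ∈ Finset.Icc 1 T, β (t + 1) = β t + β₁ / √(1 + ∑ s ∈ Finset.Icc 1 t, h s)) :
    ∑ t ∈ Finset.Ico 1 T, (β (t + 1) - β t) * h (t + 1) ≤ 2 * β₁ * √T := by
  rcases Nat.eq_zero_or_pos T with rfl | hT
  · simp
  have key : ∀ n, 1 ≤ n → n ≤ T → ∑ t ∈ Finset.Ico 1 n, (β (t + 1) - β t) * h (t + 1)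
      ≤ 2 * β₁ * √(∑ s ∈ Finset.Icc 1 n, h s) := by
    intro n hn
    induction n, hn using Nat.le_induction with
    | base => intro _; simp; positivity
    | succ n hn ih =>
      intro hnT
      have h0 := ih (by omega)
      rw [Finset.sum_Ico_succ_top hn, Finset.sum_Icc_succ_top (by omega),
        hβ n (Finset.mem_Icc.2 ⟨hn, by omega⟩)]
      have hm : n + 1 ∈ Finset.Icc 1 T := Finset.mem_Icc.2 ⟨by omega, hnT⟩
      have hS0 : 0 ≤ ∑ s ∈ Finset.Icc 1 n, h s := Finset.sum_nonneg fun s hs => hh0 s (by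
        simp only [Finset.mem_Icc] at hs ⊢; omega)
      have h2 := mul_le_mul_of_nonneg_left (div_sqrt_le_sub hS0 (hh0 _ hm) (hh _ hm)) hβ₁.le
      have h3 : (β n + β₁ / √(1 + ∑ s ∈ Finset.Icc 1 n, h s) - β n) * h (n + 1)
          = β₁ * (h (n + 1) / √(1 + ∑ s ∈ Finset.Icc 1 n, h s)) := by ring
      rw [h3]
      linarith
  refine (key T hT le_rfl).trans ?_
  gcongr
  calc ∑ s ∈ Finset.Icc 1 T, h s ≤ ∑ s ∈ Finset.Icc 1 T, (1 : ℝ) := Finset.sum_le_sum hh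
    _ = T := by simp

end Rates

end LinBandit

namespace LinBandit

/-! ### Algorithm, rates and measurability of a run -/

open Matrix

theorem IsRandomPolicy.mono' {Ω E : Type*} {m m' : MeasurableSpace Ω} [mE : MeasurableSpace E]
    {K : ℕ} {f : Ω → E → Fin K → ℝ} (h : m ≤ m') (hf : IsRandomPolicy m f) : IsRandomPolicy m' f :=
  ⟨fun b => (hf.meas b).mono (sup_le_sup (MeasurableSpace.comap_mono h) le_rfl) le_rfl, hf.mem⟩

/-- A run in the regime of the theorem: at least two arms and two rounds, positive initial rate
and constants, and step size `δ = 1 / (2 Cl CX)` with `δ CX² < 2`. -/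
structure IsTunedRun {Ω : Type u} {K d : ℕ} {mΩ : MeasurableSpace Ω} (p : Trial Ω K d) (c : Tuning)
    (P : Measure Ω) (ℱ : Filtration ℕ mΩ) (D : Measure (Vec d)) (𝒳 : Set (Vec d))
    (CX CΘ CE Cl : ℝ) : Prop where
  run : p.IsRun c P ℱ D 𝒳 CX CΘ CE Cl
  prob : IsProbabilityMeasure P
  two_le_K : 2 ≤ K
  two_le_T : 2 ≤ c.T
  β₁_pos : 0 < c.β₁
  CX_pos : 0 < CX
  CΘ_pos : 0 < CΘ
  Cl_pos : 0 < Cl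
  δ_eq : c.δ = stepSize CX Cl
  step : c.δ * CX ^ 2 < 2

/-- The vector `𝟙[A_t = a] ℓ_t(a, X_t) X_t` to which the resampled inverse is applied. -/
noncomputable def Trial.lossVec {Ω : Type u} {K d : ℕ} (p : Trial Ω K d) (t : ℕ) (a : Fin K) (ω : Ω) :
    Fin d → ℝ :=
  (armInd a (p.arm t ω) * p.loss t ω a (p.ctx t ω)) • (p.ctx t ω).ofLp

/-- The resampling factor of step `k`. -/
def Trial.factor {Ω : Type u} {K d : ℕ} (p : Trial Ω K d) (δ : ℝ) (t : ℕ) (a : Fin K) (k : ℕ)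
    (ω : Ω) : Matrix (Fin d) (Fin d) ℝ :=
  resMat δ a (p.simCtx t a k ω, p.simArm t a k ω)

section Deterministic

variable {Ω : Type u} {K d : ℕ} (p : Trial Ω K d) (c : Tuning)

theorem mgrV_eq_matProd (t : ℕ) (a : Fin K) (ω : Ω) (k : ℕ) :
    mgrV c.δ a (fun k => p.simCtx t a k ω) (fun k => p.simArm t a k ω) k
      = matProd (p.factor c.δ t a) k ω := by
  induction k with
  | zero => rfl
  | succ k ih => rw [mgrV, matProd, ih]; rfl

theorem invEst_eq (t : ℕ) (ω : Ω) (a : Fin K) :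
    p.invEst c t ω a = c.δ • ∑ k ∈ Finset.range (p.simCount t ω + 1),
      matProd (p.factor c.δ t a) k ω := by
  rw [Trial.invEst, mgrInv, ← smul_add]
  congr 1
  simp only [mgrV_eq_matProd]
  rw [Finset.sum_range_succ', add_comm]
  congr 1
  have : Finset.Icc 1 (p.simCount t ω) = Finset.Ico 1 (p.simCount t ω + 1) := by ext; simp
  rw [this, Finset.sum_Ico_eq_sum_range, Nat.add_sub_cancel]
  simp only [add_comm 1]

theorem lossEst_eq (t : ℕ) (ω : Ω) (a : Fin K) (x : Vec d) :
    p.lossEst c t ω a x = x.ofLp ⬝ᵥ (p.invEst c t ω a *ᵥ p.lossVec t a ω) := by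
  rw [Trial.lossEst, inner_eq_dotProduct, Trial.paramEst, Trial.lossVec]
  by_cases h : p.arm t ω = a
  · simp [h, armInd]
  · simp [h, armInd]

theorem lossEst_eq_sum (t : ℕ) (ω : Ω) (a : Fin K) (x : Vec d) :
    p.lossEst c t ω a x = c.δ * ∑ k ∈ Finset.range (p.simCount t ω + 1),
      x.ofLp ⬝ᵥ (matProd (p.factor c.δ t a) k ω *ᵥ p.lossVec t a ω) := by
  rw [lossEst_eq, invEst_eq, Matrix.smul_mulVec, dotProduct_smul, smul_eq_mul, Matrix.sum_mulVec,
    dotProduct_sum]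

end Deterministic

section Measurability

variable {Ω : Type u} {K d : ℕ} {p : Trial Ω K d}

theorem meas_coord {m : MeasurableSpace Ω} {f : Ω → Vec d} (hf : Measurable[m] f) (i : Fin d) :
    Measurable[m] fun ω => (f ω).ofLp i := (measurable_coord i).comp hf

theorem meas_armInd {m : MeasurableSpace Ω} {f : Ω → Fin K} (hf : Measurable[m] f) (a : Fin K) :
    Measurable[m] fun ω => armInd a (f ω) := (measurable_of_countable (armInd a)).comp hf

theorem meas_factor {t : ℕ} {m : MeasurableSpace Ω} {a : Fin K} {k : ℕ} (δ : ℝ)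
    (hX : Measurable[m] (p.simCtx t a k)) (hV : Measurable[m] (p.simArm t a k)) (i j : Fin d) :
    Measurable[m] fun ω => p.factor δ t a k ω i j :=
  (measurable_resMat δ a i j).comp (hX.prodMk hV)

theorem meas_matProd {t : ℕ} {m : MeasurableSpace Ω} {a : Fin K} (δ : ℝ)
    (hX : ∀ k ≥ 1, Measurable[m] (p.simCtx t a k)) (hV : ∀ k ≥ 1, Measurable[m] (p.simArm t a k))
    (k : ℕ) (i j : Fin d) : Measurable[m] fun ω => matProd (p.factor δ t a) k ω i j := by
  induction k generalizing i j with
  | zero => exact measurable_const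
  | succ k ih =>
    simp only [matProd, Matrix.mul_apply]
    exact Finset.measurable_fun_sum _ fun l _ =>
      (ih i l).mul (meas_factor δ (hX _ (by omega)) (hV _ (by omega)) l j)

theorem meas_simCount {t : ℕ} {m : MeasurableSpace Ω} (hr : Measurable[m] (p.rate t)) :
    Measurable[m] (p.simCount t) :=
  Nat.measurable_floor.comp ((hr.const_mul 2).sub measurable_const)

theorem meas_entropy {α : Type*} {m : MeasurableSpace α} {f : α → Fin K → ℝ}
    (hf : ∀ a, Measurable[m] fun z => f z a) : Measurable[m] fun z => entropy (f z) := by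
  simp only [entropy_eq]
  exact (Finset.measurable_fun_sum _ fun a _ =>
    (hf a).mul (Real.measurable_log.comp (hf a))).neg

end Measurability

namespace IsTunedRun

variable {Ω : Type u} {K d : ℕ} {mΩ : MeasurableSpace Ω} {p : Trial Ω K d} {c : Tuning}
    {P : Measure Ω} {ℱ : Filtration ℕ mΩ} {D : Measure (Vec d)} {𝒳 : Set (Vec d)}
    {CX CΘ CE Cl : ℝ}

theorem δ_pos (h : IsTunedRun p c P ℱ D 𝒳 CX CΘ CE Cl) : 0 < c.δ := by
  have := h.CX_pos
  have := h.Cl_pos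
  rw [h.δ_eq, stepSize]; positivity

theorem K_pos (h : IsTunedRun p c P ℱ D 𝒳 CX CΘ CE Cl) : 0 < K := by have := h.two_le_K; omega

theorem log_K_pos (h : IsTunedRun p c P ℱ D 𝒳 CX CΘ CE Cl) : 0 < Real.log K :=
  Real.log_pos (by exact_mod_cast h.two_le_K)

theorem log_T_pos (h : IsTunedRun p c P ℱ D 𝒳 CX CΘ CE Cl) : 0 < Real.log c.T :=
  Real.log_pos (by exact_mod_cast h.two_le_T)

theorem lam_pos (h : IsTunedRun p c P ℱ D 𝒳 CX CΘ CE Cl) : 0 < c.lam := h.run.contextLaw.lam_pos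

theorem prob_ctx (h : IsTunedRun p c P ℱ D 𝒳 CX CΘ CE Cl) : IsProbabilityMeasure D :=
  h.run.contextLaw.prob

theorem q_mem (h : IsTunedRun p c P ℱ D 𝒳 CX CΘ CE Cl) {t : ℕ} (ht : t ∈ Finset.Icc 1 c.T)
    (ω : Ω) (x : Vec d) : p.q t ω x ∈ stdSimplex ℝ (Fin K) := by
  rw [Finset.mem_Icc] at ht
  rcases ht.1.eq_or_lt with rfl | h1
  · have hK : (K : ℝ) ≠ 0 := by exact_mod_cast h.K_pos.ne'
    refine ⟨fun a => ?_, ?_⟩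
    · rw [h.run.algorithm.q_one]; positivity
    · simp [h.run.algorithm.q_one, hK]
  · exact h.run.algorithm.q_mem t (Finset.mem_Icc.2 ⟨h1, ht.2⟩) ω x

/-- The recursion of the rates in terms of the normalized entropies `H(q_s(X_s)) / log K`. -/
theorem rate_rec (h : IsTunedRun p c P ℱ D 𝒳 CX CΘ CE Cl) (ω : Ω) :
    ∀ t ∈ Finset.Icc 1 c.T, p.rate (t + 1) ω = p.rate t ω + c.β₁ /
      √(1 + ∑ s ∈ Finset.Icc 1 t, (Real.log K)⁻¹ * entropy (p.q s ω (p.ctx s ω))) := by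
  intro t ht
  rw [h.run.algorithm.rate_succ t ht ω, Finset.mul_sum]

theorem normEntropy_nonneg (h : IsTunedRun p c P ℱ D 𝒳 CX CΘ CE Cl) (ω : Ω) :
    ∀ t ∈ Finset.Icc 1 c.T, 0 ≤ (Real.log K)⁻¹ * entropy (p.q t ω (p.ctx t ω)) := fun _ ht =>
  mul_nonneg (inv_nonneg.2 h.log_K_pos.le) (entropy_nonneg (h.q_mem ht _ _))

theorem normEntropy_le_one (h : IsTunedRun p c P ℱ D 𝒳 CX CΘ CE Cl) (ω : Ω) :
    ∀ t ∈ Finset.Icc 1 c.T, (Real.log K)⁻¹ * entropy (p.q t ω (p.ctx t ω)) ≤ 1 := fun t ht => by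
  rw [inv_mul_le_iff₀ h.log_K_pos, mul_one]
  exact entropy_le h.K_pos (h.q_mem ht _ _)

theorem le_rate (h : IsTunedRun p c P ℱ D 𝒳 CX CΘ CE Cl) {t : ℕ} (ht : 1 ≤ t)
    (htT : t ≤ c.T + 1) (ω : Ω) : c.β₁ * √t ≤ p.rate t ω :=
  rate_ge (β := fun t => p.rate t ω)
    (h := fun s => (Real.log K)⁻¹ * entropy (p.q s ω (p.ctx s ω))) h.β₁_pos
    (h.run.algorithm.rate_one ω) (h.normEntropy_le_one ω) (h.normEntropy_nonneg ω) (h.rate_rec ω)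
    ht htT

theorem rate_le (h : IsTunedRun p c P ℱ D 𝒳 CX CΘ CE Cl) {t : ℕ} (ht : 1 ≤ t)
    (htT : t ≤ c.T + 1) (ω : Ω) : p.rate t ω ≤ t * c.β₁ :=
  LinBandit.rate_le (β := fun t => p.rate t ω)
    (h := fun s => (Real.log K)⁻¹ * entropy (p.q s ω (p.ctx s ω))) h.β₁_pos
    (h.run.algorithm.rate_one ω) (h.normEntropy_nonneg ω) (h.rate_rec ω) ht htT

theorem rate_pos (h : IsTunedRun p c P ℱ D 𝒳 CX CΘ CE Cl) {t : ℕ} (ht : 1 ≤ t)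
    (htT : t ≤ c.T + 1) (ω : Ω) : 0 < p.rate t ω :=
  (mul_pos h.β₁_pos (Real.sqrt_pos.2 (by exact_mod_cast ht))).trans_le (h.le_rate ht htT ω)

theorem one_div_rate_le (h : IsTunedRun p c P ℱ D 𝒳 CX CΘ CE Cl) {t : ℕ}
    (ht : t ∈ Finset.Icc 1 c.T) (ω : Ω) : 1 / p.rate t ω ≤ 1 / c.β₁ * (1 / √t) := by
  rw [Finset.mem_Icc] at ht
  have h1 := h.le_rate ht.1 (by omega) ω
  rw [one_div_mul_one_div]
  exact one_div_le_one_div_of_le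
    (mul_pos h.β₁_pos (Real.sqrt_pos.2 (by exact_mod_cast ht.1))) h1

theorem q_eq_softmax (h : IsTunedRun p c P ℱ D 𝒳 CX CΘ CE Cl) {t : ℕ}
    (ht : t ∈ Finset.Icc 1 c.T) (ω : Ω) (x : Vec d) :
    p.q t ω x = softmax (fun a => ∑ s ∈ Finset.Ico 1 t, p.lossEst c s ω a x) (p.rate t ω) := by
  have hm := h.q_mem ht ω x
  rw [Finset.mem_Icc] at ht
  rcases ht.1.eq_or_lt with rfl | h1
  · ext a
    rw [h.run.algorithm.q_one]
    simp [softmax, partition]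
  · refine eq_softmax_of_isMinOn h.K_pos (h.rate_pos ht.1 (by omega) ω) hm ?_
    have := h.run.algorithm.q_min t (Finset.mem_Icc.2 ⟨h1, ht.2⟩) ω x
    have e : p.ftrlObjective c t ω x = fun u => ∑ a, (∑ s ∈ Finset.Ico 1 t, p.lossEst c s ω a x)
        * u a + -(p.rate t ω) * entropy u := by
      ext u
      rw [Trial.ftrlObjective, Finset.sum_comm]
      simp only [Finset.sum_mul]
    rwa [e] at this

theorem explore_mem (h : IsTunedRun p c P ℱ D 𝒳 CX CΘ CE Cl) {t : ℕ}
    (ht : t ∈ Finset.Icc 1 c.T) (ω : Ω) : 0 < p.explore c t ω ∧ p.explore c t ω ≤ 1 := by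
  rw [Finset.mem_Icc] at ht
  have h1 := h.rate_pos ht.1 (by omega) ω
  have h2 := h.δ_pos
  have h3 := h.lam_pos
  have h4 := h.log_T_pos
  have h5 : (0 : ℝ) < K := by exact_mod_cast h.K_pos
  exact ⟨lt_min one_pos (by positivity), min_le_left _ _⟩

theorem policy_mem (h : IsTunedRun p c P ℱ D 𝒳 CX CΘ CE Cl) {t : ℕ}
    (ht : t ∈ Finset.Icc 1 c.T) (ω : Ω) (x : Vec d) :
    p.policy c t ω x ∈ stdSimplex ℝ (Fin K) := by
  have hq := h.q_mem ht ω x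
  have he := h.explore_mem ht ω
  have hK : (0 : ℝ) < K := by exact_mod_cast h.K_pos
  refine ⟨fun a => ?_, ?_⟩
  · exact add_nonneg (mul_nonneg (by linarith) (hq.1 a)) (div_nonneg he.1.le hK.le)
  · simp only [Trial.policy, Finset.sum_add_distrib, ← Finset.mul_sum, hq.2]
    simp; field_simp; ring

theorem explore_div_le_policy (h : IsTunedRun p c P ℱ D 𝒳 CX CΘ CE Cl) {t : ℕ}
    (ht : t ∈ Finset.Icc 1 c.T) (ω : Ω) (x : Vec d) (a : Fin K) :
    p.explore c t ω / K ≤ p.policy c t ω x a := by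
  have hq := h.q_mem ht ω x
  have he := h.explore_mem ht ω
  exact le_add_of_nonneg_left (mul_nonneg (by linarith) (hq.1 a))

theorem q_le (h : IsTunedRun p c P ℱ D 𝒳 CX CΘ CE Cl) {t : ℕ}
    (ht : t ∈ Finset.Icc 1 c.T) (ω : Ω) (x : Vec d) (a : Fin K) :
    p.q t ω x a ≤ p.policy c t ω x a + p.explore c t ω * p.q t ω x a := by
  have he := h.explore_mem ht ω
  have : 0 ≤ p.explore c t ω / K := div_nonneg he.1.le (by positivity)
  rw [Trial.policy]
  linarith

/-! ### Measurability -/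

theorem meas_param (h : IsTunedRun p c P ℱ D 𝒳 CX CΘ CE Cl) {t : ℕ}
    (ht : t ∈ Finset.Icc 1 c.T) (a : Fin K) (i : Fin d) :
    Measurable[ℱ (t - 1)] fun ω => (p.param t ω a).ofLp i :=
  meas_coord (h.run.protocol.meas_param t ht a) i

theorem meas_loss (h : IsTunedRun p c P ℱ D 𝒳 CX CΘ CE Cl) {t : ℕ} {m : MeasurableSpace Ω}
    (ht : t ∈ Finset.Icc 1 c.T) (hm : ℱ (t - 1) ≤ m) (hctx : Measurable[m] (p.ctx t))
    (hnoise : Measurable[m] (p.noise t)) (a : Fin K) :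
    Measurable[m] fun ω => p.loss t ω a (p.ctx t ω) := by
  simp only [Trial.loss, inner_eq_dotProduct, dotProduct]
  refine Measurable.add (Finset.measurable_fun_sum _ fun i _ => ?_)
    ((measurable_pi_apply a).comp hnoise)
  exact (meas_coord hctx i).mul ((h.meas_param ht a i).mono hm le_rfl)

theorem meas_lossVec (h : IsTunedRun p c P ℱ D 𝒳 CX CΘ CE Cl) {t : ℕ} {m : MeasurableSpace Ω}
    (ht : t ∈ Finset.Icc 1 c.T) (hm : ℱ (t - 1) ≤ m) (hctx : Measurable[m] (p.ctx t))
    (hnoise : Measurable[m] (p.noise t)) (harm : Measurable[m] (p.arm t)) (a : Fin K) (i : Fin d) :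
    Measurable[m] fun ω => p.lossVec t a ω i := by
  simp only [Trial.lossVec, Pi.smul_apply, smul_eq_mul]
  exact ((meas_armInd harm a).mul (h.meas_loss ht hm hctx hnoise a)).mul (meas_coord hctx i)

theorem meas_lossEst_of_rate (h : IsTunedRun p c P ℱ D 𝒳 CX CΘ CE Cl) {t : ℕ}
    (ht : t ∈ Finset.Icc 1 c.T) (hr : Measurable[ℱ (t - 1)] (p.rate t)) (a : Fin K) :
    Measurable[(ℱ t).prod inferInstance] fun z : Ω × Vec d => p.lossEst c t z.1 a z.2 := by
  have hle : ℱ (t - 1) ≤ ℱ t := ℱ.mono (by omega)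
  have hpr := h.run.protocol
  have hsum : ∀ i j, Measurable[ℱ t] fun ω =>
      ∑ k ∈ Finset.range (p.simCount t ω + 1), matProd (p.factor c.δ t a) k ω i j := by
    intro i j
    have h1 : @Measurable (Ω × ℕ) ℝ ((ℱ t).prod ⊤) _ fun z =>
        ∑ k ∈ Finset.range (z.2 + 1), matProd (p.factor c.δ t a) k z.1 i j :=
      @measurable_from_prod_countable_left _ _ _ (ℱ t) ⊤ _ _ _ _ fun n =>
        Finset.measurable_fun_sum (Finset.range (n + 1)) fun k _ => meas_matProd c.δ
          (hpr.meas_simCtx t ht a) (hpr.meas_simArm t ht a) k i j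
    exact h1.comp (@Measurable.prodMk _ (ℱ t) _ _ (ℱ t) ⊤ _ _ measurable_id
      ((meas_simCount hr).mono hle le_rfl))
  have hz := h.meas_lossVec ht hle (hpr.meas_ctx t ht) (hpr.meas_noise t ht) (hpr.meas_arm t ht) a
  have e : ∀ z : Ω × Vec d, p.lossEst c t z.1 a z.2 = ∑ i, z.2.ofLp i * (∑ j,
      (c.δ * ∑ k ∈ Finset.range (p.simCount t z.1 + 1), matProd (p.factor c.δ t a) k z.1 i j)
        * p.lossVec t a z.1 j) := by
    intro z
    rw [lossEst_eq, invEst_eq]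
    simp only [dotProduct, Matrix.mulVec, Matrix.smul_apply, Matrix.sum_apply, smul_eq_mul]
  simp only [e]
  refine Finset.measurable_fun_sum _ fun i _ => ?_
  refine Measurable.mul ((measurable_coord i).comp (@measurable_snd _ _ (ℱ t) _)) ?_
  have hv : Measurable[ℱ t] fun ω => ∑ j,
      (c.δ * ∑ k ∈ Finset.range (p.simCount t ω + 1), matProd (p.factor c.δ t a) k ω i j)
        * p.lossVec t a ω j :=
    Finset.measurable_fun_sum _ fun j _ => ((hsum i j).const_mul _).mul (hz j)
  exact hv.comp (@measurable_fst _ _ (ℱ t) _)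

theorem meas_q_of_rate (h : IsTunedRun p c P ℱ D 𝒳 CX CΘ CE Cl) {t : ℕ}
    (ht : t ∈ Finset.Icc 1 c.T)
    (hr : ∀ s ∈ Finset.Icc 1 t, Measurable[ℱ (s - 1)] (p.rate s)) (a : Fin K) :
    Measurable[(ℱ (t - 1)).prod inferInstance] fun z : Ω × Vec d => p.q t z.1 z.2 a := by
  have ht' := Finset.mem_Icc.1 ht
  simp only [h.q_eq_softmax ht, softmax, partition]
  have hexp : ∀ a, Measurable[(ℱ (t - 1)).prod inferInstance] fun z : Ω × Vec d =>
      Real.exp (-(∑ s ∈ Finset.Ico 1 t, p.lossEst c s z.1 a z.2) / p.rate t z.1) := by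
    intro a
    refine Real.measurable_exp.comp (Measurable.div (Measurable.neg ?_) ?_)
    · refine Finset.measurable_fun_sum _ fun s hs => ?_
      rw [Finset.mem_Ico] at hs
      refine (h.meas_lossEst_of_rate (Finset.mem_Icc.2 ⟨hs.1, by omega⟩)
        (hr s (Finset.mem_Icc.2 ⟨hs.1, by omega⟩)) a).mono ?_ le_rfl
      exact sup_le_sup (MeasurableSpace.comap_mono (ℱ.mono (by omega))) le_rfl
    · exact (hr t (Finset.mem_Icc.2 ⟨ht'.1, le_rfl⟩)).comp (@measurable_fst _ _ (ℱ (t - 1)) _)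
  exact (hexp a).div (Finset.measurable_fun_sum _ fun b _ => hexp b)

theorem meas_rate (h : IsTunedRun p c P ℱ D 𝒳 CX CΘ CE Cl) {t : ℕ} (ht : 1 ≤ t)
    (htT : t ≤ c.T + 1) : Measurable[ℱ (t - 1)] (p.rate t) := by
  induction t using Nat.strong_induction_on with
  | _ t ih =>
    rcases ht.eq_or_lt with rfl | h1
    · have : p.rate 1 = fun _ => c.β₁ := funext h.run.algorithm.rate_one
      rw [this]
      exact measurable_const
    · obtain ⟨t, rfl⟩ : ∃ s, t = s + 1 := ⟨t - 1, by omega⟩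
      have htm : t ∈ Finset.Icc 1 c.T := Finset.mem_Icc.2 ⟨by omega, by omega⟩
      have e : p.rate (t + 1) = fun ω => p.rate t ω + c.β₁ / √(1 + (Real.log K)⁻¹ *
          ∑ s ∈ Finset.Icc 1 t, entropy (p.q s ω (p.ctx s ω))) :=
        funext (h.run.algorithm.rate_succ t htm)
      rw [e, Nat.add_sub_cancel]
      refine ((ih t (by omega) (by omega) (by omega)).mono (ℱ.mono (by omega)) le_rfl).add ?_
      refine measurable_const.div (Real.continuous_sqrt.measurable.comp (measurable_const.add
        (Measurable.const_mul (Finset.measurable_fun_sum _ fun s hs => ?_) _)))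
      rw [Finset.mem_Icc] at hs
      have hsm : s ∈ Finset.Icc 1 c.T := Finset.mem_Icc.2 ⟨hs.1, by omega⟩
      refine meas_entropy fun a => ?_
      have hq := h.meas_q_of_rate hsm (fun r hr => by
        rw [Finset.mem_Icc] at hr
        exact ih r (by omega) hr.1 (by omega)) a
      refine (hq.comp (@Measurable.prodMk _ (ℱ s) _ _ (ℱ (s - 1)) _ _ _
        (measurable_id'' (ℱ.mono (by omega))) (h.run.protocol.meas_ctx s hsm))).mono
          (ℱ.mono hs.2) le_rfl

theorem meas_q (h : IsTunedRun p c P ℱ D 𝒳 CX CΘ CE Cl) {t : ℕ}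
    (ht : t ∈ Finset.Icc 1 c.T) (a : Fin K) :
    Measurable[(ℱ (t - 1)).prod inferInstance] fun z : Ω × Vec d => p.q t z.1 z.2 a := by
  refine h.meas_q_of_rate ht (fun s hs => ?_) a
  rw [Finset.mem_Icc] at hs ht
  exact h.meas_rate hs.1 (by omega)

theorem meas_lossEst (h : IsTunedRun p c P ℱ D 𝒳 CX CΘ CE Cl) {t : ℕ}
    (ht : t ∈ Finset.Icc 1 c.T) (a : Fin K) :
    Measurable[(ℱ t).prod inferInstance] fun z : Ω × Vec d => p.lossEst c t z.1 a z.2 :=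
  h.meas_lossEst_of_rate ht (by
    rw [Finset.mem_Icc] at ht; exact h.meas_rate ht.1 (by omega)) a

theorem meas_explore (h : IsTunedRun p c P ℱ D 𝒳 CX CΘ CE Cl) {t : ℕ}
    (ht : t ∈ Finset.Icc 1 c.T) : Measurable[ℱ (t - 1)] (p.explore c t) := by
  rw [Finset.mem_Icc] at ht
  have hr := h.meas_rate ht.1 (by omega)
  exact measurable_const.min ((measurable_const.div (hr.const_mul _)).mul_const _)

theorem randomPolicy (h : IsTunedRun p c P ℱ D 𝒳 CX CΘ CE Cl) {t : ℕ}
    (ht : t ∈ Finset.Icc 1 c.T) : IsRandomPolicy (ℱ (t - 1)) (p.policy c t) := by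
  refine ⟨fun b => ?_, h.policy_mem ht⟩
  have he : Measurable[(ℱ (t - 1)).prod inferInstance] fun z : Ω × Vec d => p.explore c t z.1 :=
    (h.meas_explore ht).comp (@measurable_fst _ _ (ℱ (t - 1)) _)
  exact ((measurable_const.sub he).mul (h.meas_q ht b)).add (he.div_const _)

end IsTunedRun

end LinBandit

namespace LinBandit

/-! ### The context distribution -/

open Matrix

namespace IsContextLaw

variable {d : ℕ} {D : Measure (Vec d)} {𝒳 : Set (Vec d)} {CX lam : ℝ}

theorem ae_norm_le (h : IsContextLaw D 𝒳 CX lam) : ∀ᵐ x ∂D, ‖x‖ ≤ CX := by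
  filter_upwards [h.supported] with x hx using h.bounded x hx

theorem dim_pos (h : IsContextLaw D 𝒳 CX lam) : 0 < d := by
  obtain ⟨v, hv⟩ := Module.End.HasEigenvalue.exists_hasEigenvector h.lam_least.1
  rcases Nat.eq_zero_or_pos d with rfl | hd
  · exact absurd (Subsingleton.elim v 0) hv.2
  · exact hd

theorem coord_bdd (h : IsContextLaw D 𝒳 CX lam) (i : Fin d) :
    BddMeas inferInstance D fun x : Vec d => x.ofLp i :=
  ⟨measurable_coord i, CX, by
    filter_upwards [h.ae_norm_le] with x hx using (abs_coord_le x i).trans hx⟩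

theorem dotProduct_secondMoment (h : IsContextLaw D 𝒳 CX lam) (y : Fin d → ℝ) :
    y ⬝ᵥ (secondMoment D *ᵥ y) = ∫ x, (x.ofLp ⬝ᵥ y) * (x.ofLp ⬝ᵥ y) ∂D := by
  have := h.prob
  have hb : ∀ i j, BddMeas inferInstance D fun x : Vec d => y i * (x.ofLp i * x.ofLp j) * y j :=
    fun i j => ((BddMeas.const _).mul ((h.coord_bdd i).mul (h.coord_bdd j))).mul (.const _)
  have e : ∀ x : Vec d, (x.ofLp ⬝ᵥ y) * (x.ofLp ⬝ᵥ y)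
      = ∑ i, ∑ j, y i * (x.ofLp i * x.ofLp j) * y j := by
    intro x
    rw [dotProduct, Finset.sum_mul_sum]
    exact Finset.sum_congr rfl fun i _ => Finset.sum_congr rfl fun j _ => by ring
  simp only [e]
  rw [integral_finsetSum _ fun i _ => (BddMeas.sum _ (hb i)).integrable, dotProduct_mulVec_eq_sum]
  refine Finset.sum_congr rfl fun i _ => ?_
  rw [integral_finsetSum _ fun j _ => (hb i j).integrable]
  refine Finset.sum_congr rfl fun j _ => ?_
  rw [integral_mul_const, integral_const_mul]
  rfl

theorem lam_le (h : IsContextLaw D 𝒳 CX lam) (y : Fin d → ℝ) :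
    lam * (y ⬝ᵥ y) ≤ y ⬝ᵥ (secondMoment D *ᵥ y) := by
  have hH : (secondMoment D - lam • (1 : Matrix (Fin d) (Fin d) ℝ)).IsHermitian := by
    refine h.posDef.1.sub ?_
    rw [Matrix.IsHermitian, Matrix.conjTranspose_smul, Matrix.conjTranspose_one]
    simp
  have hps : (secondMoment D - lam • (1 : Matrix (Fin d) (Fin d) ℝ)).PosSemidef := by
    rw [hH.posSemidef_iff_eigenvalues_nonneg]
    intro i
    have hv := hH.mulVec_eigenvectorBasis i
    set v : Fin d → ℝ := (hH.eigenvectorBasis i).ofLp with hvdef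
    set μ := hH.eigenvalues i
    have hne : v ≠ 0 := by
      intro h0
      have := hH.eigenvectorBasis.orthonormal.ne_zero i
      exact this (by ext j; simpa using congrFun h0 j)
    have hv2 : secondMoment D *ᵥ v = (μ + lam) • v := by
      rw [Matrix.sub_mulVec, Matrix.smul_mulVec, Matrix.one_mulVec] at hv
      rw [add_smul, ← hv, sub_add_cancel]
    have := h.lam_least.2 (show μ + lam ∈ _ from
      Module.End.hasEigenvalue_of_hasEigenvector (x := v)
        ⟨Module.End.mem_eigenspace_iff.2 (by rw [Matrix.toLin'_apply, hv2]), hne⟩)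
    simpa using this
  have := hps.dotProduct_mulVec_nonneg y
  simp only [Matrix.sub_mulVec, Matrix.smul_mulVec, Matrix.one_mulVec, dotProduct_sub,
    dotProduct_smul, smul_eq_mul, star_trivial] at this
  linarith

theorem lam_le_sq (h : IsContextLaw D 𝒳 CX lam) : lam ≤ CX ^ 2 := by
  have := h.prob
  have h1 := h.lam_le (Pi.single ⟨0, h.dim_pos⟩ 1)
  rw [h.dotProduct_secondMoment] at h1
  simp only [dotProduct_single_one, Pi.single_eq_same, mul_one] at h1
  refine h1.trans ?_
  have hb := (h.coord_bdd ⟨0, h.dim_pos⟩).mul (h.coord_bdd ⟨0, h.dim_pos⟩)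
  calc ∫ x : Vec d, x.ofLp ⟨0, h.dim_pos⟩ * x.ofLp ⟨0, h.dim_pos⟩ ∂D ≤ ∫ _ : Vec d, CX ^ 2 ∂D := by
        refine integral_mono_ae hb.integrable (integrable_const _) ?_
        filter_upwards [h.ae_norm_le] with x hx
        have := (abs_coord_le x ⟨0, h.dim_pos⟩).trans hx
        simpa [← sq] using sq_le_sq' (abs_le.1 this).1 (abs_le.1 this).2
    _ = CX ^ 2 := by simp

end IsContextLaw

/-! ### Almost sure bounds and the resampling structure of a run -/

namespace IsTunedRun

variable {Ω : Type u} {K d : ℕ} {mΩ : MeasurableSpace Ω} {p : Trial Ω K d} {c : Tuning}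
    {P : Measure Ω} {ℱ : Filtration ℕ mΩ} {D : Measure (Vec d)} {𝒳 : Set (Vec d)}
    {CX CΘ CE Cl : ℝ}

theorem ctx_measurable (h : IsTunedRun p c P ℱ D 𝒳 CX CΘ CE Cl) {t : ℕ}
    (ht : t ∈ Finset.Icc 1 c.T) : Measurable (p.ctx t) :=
  (h.run.protocol.meas_ctx t ht).mono (ℱ.le t) le_rfl

theorem simCtx_measurable (h : IsTunedRun p c P ℱ D 𝒳 CX CΘ CE Cl) {t : ℕ}
    (ht : t ∈ Finset.Icc 1 c.T) (a : Fin K) {k : ℕ} (hk : 1 ≤ k) :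
    Measurable (p.simCtx t a k) :=
  (h.run.protocol.meas_simCtx t ht a k hk).mono (ℱ.le t) le_rfl

theorem simArm_measurable (h : IsTunedRun p c P ℱ D 𝒳 CX CΘ CE Cl) {t : ℕ}
    (ht : t ∈ Finset.Icc 1 c.T) (a : Fin K) {k : ℕ} (hk : 1 ≤ k) :
    Measurable (p.simArm t a k) :=
  (h.run.protocol.meas_simArm t ht a k hk).mono (ℱ.le t) le_rfl

theorem ae_ctx_mem (h : IsTunedRun p c P ℱ D 𝒳 CX CΘ CE Cl) {t : ℕ}
    (ht : t ∈ Finset.Icc 1 c.T) : ∀ᵐ ω ∂P, p.ctx t ω ∈ 𝒳 := by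
  have := h.run.contextLaw.supported
  rw [← h.run.protocol.ctx_law t ht] at this
  exact ae_of_ae_map (h.ctx_measurable ht).aemeasurable this

theorem ae_norm_ctx_le (h : IsTunedRun p c P ℱ D 𝒳 CX CΘ CE Cl) {t : ℕ}
    (ht : t ∈ Finset.Icc 1 c.T) : ∀ᵐ ω ∂P, ‖p.ctx t ω‖ ≤ CX := by
  filter_upwards [h.ae_ctx_mem ht] with ω hω using h.run.contextLaw.bounded _ hω

theorem ae_norm_simCtx_le (h : IsTunedRun p c P ℱ D 𝒳 CX CΘ CE Cl) {t : ℕ}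
    (ht : t ∈ Finset.Icc 1 c.T) (a : Fin K) {k : ℕ} (hk : 1 ≤ k) :
    ∀ᵐ ω ∂P, ‖p.simCtx t a k ω‖ ≤ CX := by
  have := h.run.contextLaw.ae_norm_le
  rw [← h.run.protocol.simCtx_law t ht a k hk] at this
  exact ae_of_ae_map (h.simCtx_measurable ht a hk).aemeasurable this

theorem ae_loss_le (h : IsTunedRun p c P ℱ D 𝒳 CX CΘ CE Cl) {t : ℕ}
    (ht : t ∈ Finset.Icc 1 c.T) : ∀ᵐ ω ∂P, ∀ a, |p.loss t ω a (p.ctx t ω)| ≤ Cl := by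
  filter_upwards [h.run.bounded, h.ae_ctx_mem ht] with ω hω hx a using (hω t ht a).2.2 _ hx

theorem isMoments (h : IsTunedRun p c P ℱ D 𝒳 CX CΘ CE Cl) {t : ℕ}
    (ht : t ∈ Finset.Icc 1 c.T) (ω : Ω) : IsMoments D (p.policy c t ω) c.δ CX :=
  ⟨h.prob_ctx, (h.randomPolicy ht).isPolicy ω, h.run.contextLaw.ae_norm_le, h.δ_pos, h.step⟩

/-- The exploration makes the second moment of every arm at least `γ_t λ_min / K`. -/
theorem armMoment_ge (h : IsTunedRun p c P ℱ D 𝒳 CX CΘ CE Cl) {t : ℕ}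
    (ht : t ∈ Finset.Icc 1 c.T) (ω : Ω) (a : Fin K) (y : Fin d → ℝ) :
    p.explore c t ω / K * c.lam * (y ⬝ᵥ y) ≤ y ⬝ᵥ (armMoment D (p.policy c t ω) a *ᵥ y) := by
  have hM := h.isMoments ht ω
  have := h.prob_ctx
  have hC := h.run.contextLaw
  have hγ : 0 ≤ p.explore c t ω / K := div_nonneg (h.explore_mem ht ω).1.le (by positivity)
  have hyb : BddMeas inferInstance D fun x : Vec d => (x.ofLp ⬝ᵥ y) * (x.ofLp ⬝ᵥ y) := by
    have : BddMeas inferInstance D fun x : Vec d => x.ofLp ⬝ᵥ y :=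
      VecBdd.dotProduct (fun i => hC.coord_bdd i) (.const y)
    exact this.mul this
  have hφ : Measurable fun w : Vec d × Fin K =>
      armInd a w.2 * ((w.1.ofLp ⬝ᵥ y) * (w.1.ofLp ⬝ᵥ y)) :=
    (measurable_armInd a).mul (hyb.1.comp measurable_fst)
  obtain ⟨C, hC'⟩ := hyb.2
  rw [hM.dotProduct_armMoment, hM.pol.integral_roundLaw hφ ⟨C, by
    filter_upwards [hC'] with x hx b
    rw [abs_mul, abs_of_nonneg (armInd_nonneg _ _)]
    exact (mul_le_of_le_one_left (abs_nonneg _) (armInd_le_one _ _)).trans hx⟩]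
  have e : ∀ x : Vec d, ∑ b, p.policy c t ω x b * (armInd a b * ((x.ofLp ⬝ᵥ y) * (x.ofLp ⬝ᵥ y)))
      = p.policy c t ω x a * ((x.ofLp ⬝ᵥ y) * (x.ofLp ⬝ᵥ y)) := by
    intro x; simp [armInd]
  simp only [e]
  calc p.explore c t ω / K * c.lam * (y ⬝ᵥ y)
      ≤ p.explore c t ω / K * (y ⬝ᵥ (secondMoment D *ᵥ y)) := by
        rw [mul_assoc]; exact mul_le_mul_of_nonneg_left (hC.lam_le y) hγ
    _ = ∫ x : Vec d, p.explore c t ω / K * ((x.ofLp ⬝ᵥ y) * (x.ofLp ⬝ᵥ y)) ∂D := by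
        rw [hC.dotProduct_secondMoment, integral_const_mul]
    _ ≤ _ := by
        refine integral_mono_ae (hyb.integrable.const_mul _) ?_
          (Filter.Eventually.of_forall fun x => ?_)
        · have : BddMeas inferInstance D fun x : Vec d => p.policy c t ω x a :=
            ⟨hM.pol.meas a, 1, Filter.Eventually.of_forall fun x => by
              rw [abs_of_nonneg (hM.pol.nonneg x a)]; exact hM.pol.le_one x a⟩
          exact (this.mul hyb).integrable
        · exact mul_le_mul_of_nonneg_right (h.explore_div_le_policy ht ω x a) (mul_self_nonneg _)

theorem beforeSim_mono {t : ℕ} {a : Fin K} {j k : ℕ} (hjk : j ≤ k) :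
    p.beforeSim ℱ t a j ≤ p.beforeSim ℱ t a k := by
  refine sup_le_sup le_rfl (biSup_mono fun i hi => ?_)
  rw [Finset.mem_Ico] at hi ⊢
  omega

theorem past_le_beforeSim {t : ℕ} {a : Fin K} {k : ℕ} : ℱ (t - 1) ≤ p.beforeSim ℱ t a k :=
  le_sup_of_le_left (le_sup_of_le_left (le_sup_of_le_left le_sup_left))

theorem beforeSim_le (h : IsTunedRun p c P ℱ D 𝒳 CX CΘ CE Cl) {t : ℕ}
    (ht : t ∈ Finset.Icc 1 c.T) (a : Fin K) (k : ℕ) : p.beforeSim ℱ t a k ≤ mΩ := by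
  have hpr := h.run.protocol
  refine sup_le (sup_le (sup_le (sup_le (ℱ.le _) (h.ctx_measurable ht).comap_le) ?_) ?_) ?_
  · exact ((hpr.meas_arm t ht).mono (ℱ.le t) le_rfl).comap_le
  · exact ((hpr.meas_noise t ht).mono (ℱ.le t) le_rfl).comap_le
  · refine iSup₂_le fun j hj => ?_
    rw [Finset.mem_Ico] at hj
    exact sup_le (h.simCtx_measurable ht a hj.1).comap_le (h.simArm_measurable ht a hj.1).comap_le

theorem simCtx_meas_beforeSim {t : ℕ} {a : Fin K} {k : ℕ} :
    Measurable[p.beforeSim ℱ t a (k + 2)] (p.simCtx t a (k + 1)) := by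
  refine (comap_measurable _).mono ?_ le_rfl
  refine le_sup_of_le_right ?_
  exact le_trans le_sup_left (le_biSup (fun j =>
    (MeasurableSpace.comap (p.simCtx t a j) inferInstance ⊔
      MeasurableSpace.comap (p.simArm t a j) inferInstance))
    (Finset.mem_Ico.2 ⟨by omega, by omega⟩ : k + 1 ∈ Finset.Ico 1 (k + 2)))

theorem simArm_meas_beforeSim {t : ℕ} {a : Fin K} {k : ℕ} :
    Measurable[p.beforeSim ℱ t a (k + 2)] (p.simArm t a (k + 1)) := by
  refine (comap_measurable _).mono ?_ le_rfl
  refine le_sup_of_le_right ?_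
  exact le_trans le_sup_right (le_biSup (fun j =>
    (MeasurableSpace.comap (p.simCtx t a j) inferInstance ⊔
      MeasurableSpace.comap (p.simArm t a j) inferInstance))
    (Finset.mem_Ico.2 ⟨by omega, by omega⟩ : k + 1 ∈ Finset.Ico 1 (k + 2)))

theorem integral_draw_arm (h : IsTunedRun p c P ℱ D 𝒳 CX CΘ CE Cl) {t : ℕ}
    (ht : t ∈ Finset.Icc 1 c.T) {φ : Vec d × Fin K → ℝ} (hφ : Measurable φ)
    (hb : ∃ C, ∀ᵐ x ∂D, ∀ b, |φ (x, b)| ≤ C) {g : Ω → ℝ} (hg : BddMeas (ℱ (t - 1)) P g) :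
    ∫ ω, g ω * φ (p.ctx t ω, p.arm t ω) ∂P
      = ∫ ω, g ω * ∫ z, φ z ∂(roundLaw D (p.policy c t ω)) ∂P := by
  have := h.prob
  have := h.prob_ctx
  have hpr := h.run.protocol
  exact (h.randomPolicy ht).integral_draw (ℱ.le _) (h.ctx_measurable ht)
    ((hpr.meas_arm t ht).mono (ℱ.le t) le_rfl) (hpr.ctx_indep t ht) (hpr.ctx_law t ht)
    (hpr.arm_law t ht) hφ hb hg

theorem integral_draw_sim (h : IsTunedRun p c P ℱ D 𝒳 CX CΘ CE Cl) {t : ℕ}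
    (ht : t ∈ Finset.Icc 1 c.T) (a : Fin K) {k : ℕ} (hk : 1 ≤ k)
    {φ : Vec d × Fin K → ℝ} (hφ : Measurable φ)
    (hb : ∃ C, ∀ᵐ x ∂D, ∀ b, |φ (x, b)| ≤ C) {g : Ω → ℝ}
    (hg : BddMeas (p.beforeSim ℱ t a k) P g) :
    ∫ ω, g ω * φ (p.simCtx t a k ω, p.simArm t a k ω) ∂P
      = ∫ ω, g ω * ∫ z, φ z ∂(roundLaw D (p.policy c t ω)) ∂P := by
  have := h.prob
  have := h.prob_ctx
  have hpr := h.run.protocol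
  exact ((h.randomPolicy ht).mono' past_le_beforeSim).integral_draw (h.beforeSim_le ht a k)
    (h.simCtx_measurable ht a hk) (h.simArm_measurable ht a hk) (hpr.simCtx_indep t ht a k hk)
    (hpr.simCtx_law t ht a k hk) (hpr.simArm_law t ht a k hk) hφ hb hg

theorem resMat_ae_le (h : IsTunedRun p c P ℱ D 𝒳 CX CΘ CE Cl) (a : Fin K) (i j : Fin d) :
    ∃ C, ∀ᵐ x ∂D, ∀ b : Fin K, |resMat c.δ a (x, b) i j| ≤ C :=
  ⟨_, by filter_upwards [h.run.contextLaw.ae_norm_le] with x hx b using abs_resMat_le hx a b i j⟩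

theorem resMat_mul_ae_le (h : IsTunedRun p c P ℱ D 𝒳 CX CΘ CE Cl) (a : Fin K) (i j k l : Fin d) :
    ∃ C, ∀ᵐ x ∂D, ∀ b : Fin K, |resMat c.δ a (x, b) i j * resMat c.δ a (x, b) k l| ≤ C := by
  obtain ⟨C, hC⟩ := h.resMat_ae_le a i j
  obtain ⟨C', hC'⟩ := h.resMat_ae_le a k l
  refine ⟨C * C', ?_⟩
  filter_upwards [hC, hC'] with x hx hx' b
  rw [abs_mul]
  exact mul_le_mul (hx b) (hx' b) (abs_nonneg _) ((abs_nonneg _).trans (hx b))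

theorem mgrW_ae_le (h : IsTunedRun p c P ℱ D 𝒳 CX CΘ CE Cl) (a : Fin K) (i j : Fin d) :
    ∃ C, ∀ᵐ x ∂D, ∀ b : Fin K, |mgrW a x b i j| ≤ C :=
  ⟨_, by filter_upwards [h.run.contextLaw.ae_norm_le] with x hx b using abs_mgrW_le hx a b i j⟩

theorem armMoment_bdd (h : IsTunedRun p c P ℱ D 𝒳 CX CΘ CE Cl) {t : ℕ}
    (ht : t ∈ Finset.Icc 1 c.T) (a : Fin K) :
    MatBdd (ℱ (t - 1)) P fun ω => armMoment D (p.policy c t ω) a := fun i j =>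
  have := h.prob_ctx
  (h.randomPolicy ht).bddMeas_integral (measurable_mgrW a i j) (h.mgrW_ae_le a i j)

theorem integral_resMat (h : IsTunedRun p c P ℱ D 𝒳 CX CΘ CE Cl) {t : ℕ}
    (ht : t ∈ Finset.Icc 1 c.T) (ω : Ω) (a : Fin K) (i j : Fin d) :
    ∫ z, resMat c.δ a z i j ∂(roundLaw D (p.policy c t ω))
      = (1 - c.δ • armMoment D (p.policy c t ω) a) i j := by
  have hM := h.isMoments ht ω
  have := h.prob_ctx
  have := hM.pol.isProbabilityMeasure_roundLaw (D := D)
  simp only [resMat, Matrix.sub_apply, Matrix.smul_apply, smul_eq_mul, armMoment, Matrix.of_apply]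
  rw [integral_sub (integrable_const _) ((hM.mgrW_bdd a i j).integrable.const_mul _),
    integral_const_mul]
  simp

/-- In each round and for each arm, the resampling factors are conditionally independent with the
moments determined by the policy of the round. -/
theorem isResampling (h : IsTunedRun p c P ℱ D 𝒳 CX CΘ CE Cl) {t : ℕ}
    (ht : t ∈ Finset.Icc 1 c.T) (a : Fin K) :
    IsResampling P (ℱ (t - 1)) (p.beforeSim ℱ t a) (p.factor c.δ t a)
      (fun ω => 1 - c.δ • armMoment D (p.policy c t ω) a)
      (fun ω => resMoment D (p.policy c t ω) c.δ a) where
  past_le := past_le_beforeSim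
  mono _ _ hjk := beforeSim_mono hjk
  le := h.beforeSim_le ht a
  adapted k i j := by
    refine ⟨meas_factor c.δ simCtx_meas_beforeSim simArm_meas_beforeSim i j,
      1 + |c.δ| * (CX * CX), ?_⟩
    filter_upwards [h.ae_norm_simCtx_le ht a (k := k + 1) (by omega)] with ω hω
    exact abs_resMat_le hω a _ i j
  fst_meas := (MatBdd.const 1).sub (.smul (.const _) (h.armMoment_bdd ht a))
  snd_meas i j k l :=
    have := h.prob_ctx
    (h.randomPolicy ht).bddMeas_integral
      ((measurable_resMat c.δ a i j).mul (measurable_resMat c.δ a k l))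
      (h.resMat_mul_ae_le a i j k l)
  fst_eq k i j f hf := by
    have := h.integral_draw_sim ht a (k := k + 1) (by omega) (measurable_resMat c.δ a i j)
      (h.resMat_ae_le a i j) hf
    simp only [h.integral_resMat ht] at this
    exact this
  snd_eq n i j k l f hf :=
    h.integral_draw_sim ht a (k := n + 1) (by omega)
      ((measurable_resMat c.δ a i j).mul (measurable_resMat c.δ a k l))
      (h.resMat_mul_ae_le a i j k l) hf

theorem ctx_meas_beforeSim {t : ℕ} {a : Fin K} {k : ℕ} :
    Measurable[p.beforeSim ℱ t a k] (p.ctx t) :=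
  (comap_measurable _).mono
    (le_sup_of_le_left (le_sup_of_le_left (le_sup_of_le_left le_sup_right))) le_rfl

theorem arm_meas_beforeSim {t : ℕ} {a : Fin K} {k : ℕ} :
    Measurable[p.beforeSim ℱ t a k] (p.arm t) :=
  (comap_measurable _).mono (le_sup_of_le_left (le_sup_of_le_left le_sup_right)) le_rfl

theorem noise_meas_beforeSim {t : ℕ} {a : Fin K} {k : ℕ} :
    Measurable[p.beforeSim ℱ t a k] (p.noise t) :=
  (comap_measurable _).mono (le_sup_of_le_left le_sup_right) le_rfl

theorem lossVec_bdd (h : IsTunedRun p c P ℱ D 𝒳 CX CΘ CE Cl) {t : ℕ}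
    (ht : t ∈ Finset.Icc 1 c.T) (a : Fin K) (k : ℕ) :
    VecBdd (p.beforeSim ℱ t a k) P (p.lossVec t a) := by
  intro i
  refine ⟨h.meas_lossVec ht past_le_beforeSim ctx_meas_beforeSim noise_meas_beforeSim
    arm_meas_beforeSim a i, Cl * CX, ?_⟩
  filter_upwards [h.ae_loss_le ht, h.ae_norm_ctx_le ht] with ω h1 h2
  simp only [Trial.lossVec, Pi.smul_apply, smul_eq_mul]
  rw [abs_mul, abs_mul, abs_of_nonneg (armInd_nonneg _ _)]
  refine mul_le_mul ?_ ((abs_coord_le _ i).trans h2) (abs_nonneg _) h.Cl_pos.le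
  exact (mul_le_of_le_one_left (abs_nonneg _) (armInd_le_one _ _)).trans (h1 a)

end IsTunedRun

end LinBandit

namespace LinBandit

/-! ### Second moments of sums of products -/

open Matrix

section Equivalence

variable {Ω : Type*} {d : ℕ} {mΩ : MeasurableSpace Ω} {P : Measure Ω}
  {𝓕 : MeasurableSpace Ω} {A A' B : Ω → Matrix (Fin d) (Fin d) ℝ}

/-- `A` and `A'` have the same conditional expectation given `𝓕`, tested entrywise against bounded
`𝓕`-measurable functions. -/
def MatEqv (P : Measure Ω) (𝓕 : MeasurableSpace Ω) (A A' : Ω → Matrix (Fin d) (Fin d) ℝ) : Prop :=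
  ∀ i j f, BddMeas 𝓕 P f → ∫ ω, f ω * A ω i j ∂P = ∫ ω, f ω * A' ω i j ∂P

theorem MatEqv.mul_right [IsFiniteMeasure P] (h : MatEqv P 𝓕 A A') (h𝓕 : 𝓕 ≤ mΩ)
    (hA : MatBdd mΩ P A) (hA' : MatBdd mΩ P A') (hB : MatBdd 𝓕 P B) :
    MatEqv P 𝓕 (fun ω => A ω * B ω) fun ω => A' ω * B ω := by
  intro i j f hf
  simp only [Matrix.mul_apply, Finset.mul_sum]
  refine integral_sum_congr _
    (fun k => (hf.mono h𝓕).mul ((hA i k).mul ((hB k j).mono h𝓕)))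
    (fun k => (hf.mono h𝓕).mul ((hA' i k).mul ((hB k j).mono h𝓕))) fun k => ?_
  have := h i k _ (hf.mul (hB k j))
  simpa only [mul_assoc, mul_comm (B _ k j)] using this

theorem MatEqv.quadMap [IsFiniteMeasure P] {Q : Ω → Fin d → Fin d → Fin d → Fin d → ℝ}
    (h : MatEqv P 𝓕 A A') (h𝓕 : 𝓕 ≤ mΩ) (hA : MatBdd mΩ P A) (hA' : MatBdd mΩ P A')
    (hQ : ∀ i j k l, BddMeas 𝓕 P fun ω => Q ω i j k l) :
    MatEqv P 𝓕 (fun ω => quadMap (Q ω) (A ω)) fun ω => quadMap (Q ω) (A' ω) := by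
  intro i k f hf
  simp only [LinBandit.quadMap, Matrix.of_apply, Finset.mul_sum]
  have hb : ∀ {A : Ω → Matrix (Fin d) (Fin d) ℝ}, MatBdd mΩ P A → ∀ j l,
      BddMeas mΩ P fun ω => f ω * (A ω j l * Q ω i j k l) := fun hA j l =>
    (hf.mono h𝓕).mul ((hA j l).mul ((hQ i j k l).mono h𝓕))
  refine integral_sum_congr _ (fun j => .sum _ fun l => hb hA j l)
    (fun j => .sum _ fun l => hb hA' j l) fun j => ?_
  refine integral_sum_congr _ (fun l => hb hA j l) (fun l => hb hA' j l) fun l => ?_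
  have := h j l _ (hf.mul (hQ i j k l))
  simpa only [mul_assoc, mul_comm (Q _ i j k l)] using this

theorem MatEqv.quadMap_iterate [IsFiniteMeasure P] {Q : Ω → Fin d → Fin d → Fin d → Fin d → ℝ}
    (h : MatEqv P 𝓕 A A') (h𝓕 : 𝓕 ≤ mΩ) (hA : MatBdd mΩ P A) (hA' : MatBdd mΩ P A')
    (hQ : ∀ i j k l, BddMeas 𝓕 P fun ω => Q ω i j k l) (n : ℕ) :
    MatEqv P 𝓕 (fun ω => (LinBandit.quadMap (Q ω))^[n] (A ω))
      fun ω => (LinBandit.quadMap (Q ω))^[n] (A' ω) := by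
  have hQ' : ∀ i j k l, BddMeas mΩ P fun ω => Q ω i j k l := fun i j k l => (hQ i j k l).mono h𝓕
  induction n with
  | zero => exact h
  | succ n ih =>
    simp only [Function.iterate_succ_apply']
    exact ih.quadMap h𝓕 (quadMap_iterate_bdd hQ' hA n) (quadMap_iterate_bdd hQ' hA' n) hQ

theorem MatEqv.integral_quadForm [IsFiniteMeasure P] (h : MatEqv P 𝓕 A A')
    (hA : MatBdd mΩ P A) (hA' : MatBdd mΩ P A') (x : Fin d → ℝ) :
    ∫ ω, x ⬝ᵥ (A ω *ᵥ x) ∂P = ∫ ω, x ⬝ᵥ (A' ω *ᵥ x) ∂P := by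
  simp only [dotProduct_mulVec_eq_sum]
  have hb : ∀ {A : Ω → Matrix (Fin d) (Fin d) ℝ}, MatBdd mΩ P A → ∀ i j,
      BddMeas mΩ P fun ω => x i * A ω i j * x j := fun hA i j =>
    ((BddMeas.const _).mul (hA i j)).mul (.const _)
  refine integral_sum_congr _ (fun i => .sum _ fun j => hb hA i j)
    (fun i => .sum _ fun j => hb hA' i j) fun i => ?_
  refine integral_sum_congr _ (fun j => hb hA i j) (fun j => hb hA' i j) fun j => ?_
  have := h i j _ (.const (x i * x j))
  simpa only [mul_right_comm] using this

end Equivalence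

theorem sum_sum_range_eq (c : ℕ → ℕ → ℝ) (hc : ∀ k l, c k l = c l k) (n : ℕ) :
    ∑ k ∈ Finset.range n, ∑ l ∈ Finset.range n, c k l
      = ∑ k ∈ Finset.range n, (2 * ∑ l ∈ Finset.Ico k n, c k l - c k k) := by
  induction n with
  | zero => simp
  | succ n ih =>
    rw [Finset.sum_range_succ, Finset.sum_range_succ (fun k => 2 * _ - _)]
    simp only [Finset.sum_range_succ (fun l => c _ l), Finset.sum_add_distrib]
    rw [ih]
    have h1 : ∑ k ∈ Finset.range n, (2 * ∑ l ∈ Finset.Ico k (n + 1), c k l - c k k)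
        = ∑ k ∈ Finset.range n, (2 * ∑ l ∈ Finset.Ico k n, c k l - c k k)
          + 2 * ∑ k ∈ Finset.range n, c k n := by
      rw [Finset.mul_sum, ← Finset.sum_add_distrib]
      refine Finset.sum_congr rfl fun k hk => ?_
      rw [Finset.sum_Ico_succ_top (Finset.mem_range.1 hk).le]
      ring
    rw [h1]
    simp only [hc n, Nat.Ico_succ_singleton, Finset.sum_singleton]
    ring

namespace IsResampling

variable {Ω : Type*} {d : ℕ} {mΩ : MeasurableSpace Ω} {P : Measure Ω} {𝓕 : MeasurableSpace Ω}
  {𝓖 : ℕ → MeasurableSpace Ω} {N : ℕ → Ω → Matrix (Fin d) (Fin d) ℝ}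
  {R : Ω → Matrix (Fin d) (Fin d) ℝ} {Q : Ω → Fin d → Fin d → Fin d → Fin d → ℝ}

theorem integral_matProd_cross_of_eqv [IsProbabilityMeasure P] (h : IsResampling P 𝓕 𝓖 N R Q)
    (x : Fin d → ℝ) (k j : ℕ) {A A' : Ω → Matrix (Fin d) (Fin d) ℝ} (hA : MatBdd (𝓖 1) P A)
    (hA' : MatBdd 𝓕 P A') (heq : MatEqv P 𝓕 A A') :
    ∫ ω, x ⬝ᵥ ((matProd N k ω * A ω * (matProd N (k + j) ω)ᵀ) *ᵥ x) ∂P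
      = ∫ ω, x ⬝ᵥ ((quadMap (Q ω))^[k] (A' ω * (R ω)ᵀ ^ j) *ᵥ x) ∂P := by
  rw [h.integral_matProd_cross x k j hA]
  have h𝓕 : 𝓕 ≤ mΩ := h.past_le.trans (h.le 1)
  have hR := h.fst_meas.transpose.pow j
  have hAm := hA.mono (h.le 1)
  have hAm' := hA'.mono h𝓕
  have hRm := hR.mono h𝓕
  have hQ' : ∀ i j k l, BddMeas mΩ P fun ω => Q ω i j k l := fun i j k l =>
    (h.snd_meas i j k l).mono h𝓕
  exact ((heq.mul_right h𝓕 hAm hAm' hR).quadMap_iterate h𝓕 (hAm.mul hRm) (hAm'.mul hRm)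
    h.snd_meas k).integral_quadForm (quadMap_iterate_bdd hQ' (hAm.mul hRm) k)
      (quadMap_iterate_bdd hQ' (hAm'.mul hRm) k) x

/-- The second moment of `∑ₖ N 1 ⋯ N k`: integrating out the last factors of the longer product in
each cross term leaves iterates of `quadMap` applied to geometric sums in `R`. -/
theorem integral_sum_matProd_le [IsProbabilityMeasure P] (h : IsResampling P 𝓕 𝓖 N R Q)
    (x : Fin d → ℝ) (n : ℕ) {A A' : Ω → Matrix (Fin d) (Fin d) ℝ} (hA : MatBdd (𝓖 1) P A)
    (hA' : MatBdd 𝓕 P A') (heq : MatEqv P 𝓕 A A') (hsym : ∀ ω, (A ω)ᵀ = A ω)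
    (hpos : ∀ ω, QuadNonneg (A ω)) :
    ∫ ω, x ⬝ᵥ (((∑ k ∈ Finset.range n, matProd N k ω) * A ω
        * (∑ k ∈ Finset.range n, matProd N k ω)ᵀ) *ᵥ x) ∂P
      ≤ 2 * ∑ k ∈ Finset.range n, ∫ ω, x ⬝ᵥ ((quadMap (Q ω))^[k]
          (A' ω * ∑ j ∈ Finset.range (n - k), (R ω)ᵀ ^ j) *ᵥ x) ∂P := by
  have h𝓕 : 𝓕 ≤ mΩ := h.past_le.trans (h.le 1)
  have hQ' : ∀ i j k l, BddMeas mΩ P fun ω => Q ω i j k l := fun i j k l =>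
    (h.snd_meas i j k l).mono h𝓕
  have hV : ∀ k, MatBdd mΩ P (matProd N k) := fun k => (h.matProd_bdd k).mono (h.le _)
  have hAm := hA.mono (h.le 1)
  set c : ℕ → ℕ → ℝ := fun k l =>
    ∫ ω, x ⬝ᵥ ((matProd N k ω * A ω * (matProd N l ω)ᵀ) *ᵥ x) ∂P with hc
  have hterm : ∀ k l, BddMeas mΩ P fun ω =>
      x ⬝ᵥ ((matProd N k ω * A ω * (matProd N l ω)ᵀ) *ᵥ x) := fun k l =>
    (VecBdd.const x).dotProduct ((((hV k).mul hAm).mul (hV l).transpose).mulVec (.const x))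
  have hcs : ∀ k l, c k l = c l k := by
    intro k l
    refine integral_congr_ae (Filter.Eventually.of_forall fun ω => ?_)
    simp only
    rw [Matrix.dotProduct_mulVec, ← Matrix.mulVec_transpose, dotProduct_comm]
    simp only [Matrix.transpose_mul, Matrix.transpose_transpose, hsym, Matrix.mul_assoc]
  have hc0 : ∀ k, 0 ≤ c k k := by
    intro k
    refine integral_nonneg fun ω => ?_
    rw [← Matrix.mulVec_mulVec, ← Matrix.mulVec_mulVec, Matrix.dotProduct_mulVec,
      ← Matrix.mulVec_transpose]
    exact hpos ω _
  have e1 : ∫ ω, x ⬝ᵥ (((∑ k ∈ Finset.range n, matProd N k ω) * A ω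
        * (∑ k ∈ Finset.range n, matProd N k ω)ᵀ) *ᵥ x) ∂P
      = ∑ k ∈ Finset.range n, ∑ l ∈ Finset.range n, c k l := by
    simp only [Matrix.transpose_sum, Finset.sum_mul, Finset.mul_sum, Matrix.sum_mulVec,
      dotProduct_sum]
    rw [integral_finsetSum _ fun k _ => (BddMeas.sum _ fun l => hterm _ _).integrable]
    rw [Finset.sum_comm]
    refine Finset.sum_congr rfl fun l _ => ?_
    exact integral_finsetSum _ fun k _ => (hterm _ _).integrable
  rw [e1, sum_sum_range_eq c hcs, Finset.mul_sum]
  refine Finset.sum_le_sum fun k hk => ?_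
  have hk' := Finset.mem_range.1 hk
  have e2 : ∑ l ∈ Finset.Ico k n, c k l = ∫ ω, x ⬝ᵥ ((quadMap (Q ω))^[k]
          (A' ω * ∑ j ∈ Finset.range (n - k), (R ω)ᵀ ^ j) *ᵥ x) ∂P := by
    rw [Finset.sum_Ico_eq_sum_range]
    simp only [Finset.mul_sum, quadMap_iterate_sum, Matrix.sum_mulVec, dotProduct_sum]
    rw [integral_finsetSum]
    · exact Finset.sum_congr rfl fun j _ => h.integral_matProd_cross_of_eqv x k j hA hA' heq
    · intro j _
      exact ((VecBdd.const x).dotProduct ((quadMap_iterate_bdd hQ' ((hA'.mul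
        (h.fst_meas.transpose.pow j)).mono h𝓕) k).mulVec (.const x))).integrable
  rw [e2]
  linarith [hc0 k]

end IsResampling

/-! ### Moments of the loss estimates -/

namespace IsTunedRun

variable {Ω : Type u} {K d : ℕ} {mΩ : MeasurableSpace Ω} {p : Trial Ω K d} {c : Tuning}
    {P : Measure Ω} {ℱ : Filtration ℕ mΩ} {D : Measure (Vec d)} {𝒳 : Set (Vec d)}
    {CX CΘ CE Cl : ℝ}

theorem param_bdd (h : IsTunedRun p c P ℱ D 𝒳 CX CΘ CE Cl) {t : ℕ}
    (ht : t ∈ Finset.Icc 1 c.T) (a : Fin K) :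
    VecBdd (ℱ (t - 1)) P fun ω => (p.param t ω a).ofLp := fun i =>
  ⟨h.meas_param ht a i, CΘ, by
    filter_upwards [h.run.bounded] with ω hω using (abs_coord_le _ i).trans (hω t ht a).1⟩

theorem noise_bdd (h : IsTunedRun p c P ℱ D 𝒳 CX CΘ CE Cl) {t : ℕ}
    (ht : t ∈ Finset.Icc 1 c.T) (a : Fin K) : BddMeas mΩ P fun ω => p.noise t ω a :=
  ⟨(measurable_pi_apply a).comp ((h.run.protocol.meas_noise t ht).mono (ℱ.le t) le_rfl), CE, by
    filter_upwards [h.run.bounded] with ω hω using (hω t ht a).2.1⟩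

theorem afterArm_le (h : IsTunedRun p c P ℱ D 𝒳 CX CΘ CE Cl) {t : ℕ}
    (ht : t ∈ Finset.Icc 1 c.T) : p.afterArm ℱ t ≤ mΩ :=
  sup_le (sup_le (ℱ.le _) (h.ctx_measurable ht).comap_le)
    ((h.run.protocol.meas_arm t ht).mono (ℱ.le t) le_rfl).comap_le

theorem integral_mul_noise (h : IsTunedRun p c P ℱ D 𝒳 CX CΘ CE Cl) {t : ℕ}
    (ht : t ∈ Finset.Icc 1 c.T) (a : Fin K) {f : Ω → ℝ} (hf : BddMeas (p.afterArm ℱ t) P f) :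
    ∫ ω, f ω * p.noise t ω a ∂P = 0 := by
  have := h.prob
  rw [integral_mul_of_condExp (h.afterArm_le ht) hf (h.noise_bdd ht a).integrable
    (h.run.protocol.noise_centred t ht a)]
  simp

theorem past_le_afterArm {t : ℕ} : ℱ (t - 1) ≤ p.afterArm ℱ t :=
  le_sup_of_le_left le_sup_left

theorem armInd_bdd_afterArm {t : ℕ} (a : Fin K) :
    BddMeas (p.afterArm ℱ t) P fun ω => armInd a (p.arm t ω) :=
  ⟨meas_armInd ((comap_measurable _).mono le_sup_right le_rfl) a, 1,
    Filter.Eventually.of_forall fun _ => by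
      rw [abs_of_nonneg (armInd_nonneg _ _)]; exact armInd_le_one _ _⟩

theorem ctx_bdd_afterArm (h : IsTunedRun p c P ℱ D 𝒳 CX CΘ CE Cl) {t : ℕ}
    (ht : t ∈ Finset.Icc 1 c.T) :
    VecBdd (p.afterArm ℱ t) P fun ω => (p.ctx t ω).ofLp := fun i =>
  ⟨meas_coord ((comap_measurable _).mono (le_sup_of_le_left le_sup_right) le_rfl) i, CX, by
    filter_upwards [h.ae_norm_ctx_le ht] with ω hω using (abs_coord_le _ i).trans hω⟩

theorem mgrW_ctx_eqv (h : IsTunedRun p c P ℱ D 𝒳 CX CΘ CE Cl) {t : ℕ}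
    (ht : t ∈ Finset.Icc 1 c.T) (a : Fin K) :
    MatEqv P (ℱ (t - 1)) (fun ω => mgrW a (p.ctx t ω) (p.arm t ω))
      fun ω => armMoment D (p.policy c t ω) a := fun i j _ hf =>
  h.integral_draw_arm ht (measurable_mgrW a i j) (h.mgrW_ae_le a i j) hf

theorem mgrW_ctx_bdd (h : IsTunedRun p c P ℱ D 𝒳 CX CΘ CE Cl) {t : ℕ}
    (ht : t ∈ Finset.Icc 1 c.T) (a : Fin K) :
    MatBdd (p.afterArm ℱ t) P fun ω => mgrW a (p.ctx t ω) (p.arm t ω) := by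
  intro i j
  simp only [mgrW_apply]
  exact (armInd_bdd_afterArm a).mul ((h.ctx_bdd_afterArm ht i).mul (h.ctx_bdd_afterArm ht j))

/-- The conditional mean of `𝟙[A_t = a] ℓ_t(a, X_t) X_t` is the arm's second moment applied to
the parameter. -/
theorem integral_dotProduct_lossVec (h : IsTunedRun p c P ℱ D 𝒳 CX CΘ CE Cl) {t : ℕ}
    (ht : t ∈ Finset.Icc 1 c.T) (a : Fin K) {f : Ω → Fin d → ℝ} (hf : VecBdd (ℱ (t - 1)) P f) :
    ∫ ω, f ω ⬝ᵥ p.lossVec t a ω ∂P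
      = ∫ ω, f ω ⬝ᵥ (armMoment D (p.policy c t ω) a *ᵥ (p.param t ω a).ofLp) ∂P := by
  have := h.prob
  have hθ := h.param_bdd ht a
  have hpast : ℱ (t - 1) ≤ mΩ := ℱ.le _
  have hW := (h.mgrW_ctx_bdd ht a).mono (h.afterArm_le ht)
  have hfn : BddMeas (p.afterArm ℱ t) P
      fun ω => armInd a (p.arm t ω) * (f ω ⬝ᵥ (p.ctx t ω).ofLp) :=
    (armInd_bdd_afterArm a).mul ((hf.mono past_le_afterArm).dotProduct (h.ctx_bdd_afterArm ht))
  have e : ∀ ω, f ω ⬝ᵥ p.lossVec t a ω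
      = (∑ i, ∑ j, f ω i * (p.param t ω a).ofLp j * mgrW a (p.ctx t ω) (p.arm t ω) i j)
        + armInd a (p.arm t ω) * (f ω ⬝ᵥ (p.ctx t ω).ofLp) * p.noise t ω a := by
    intro ω
    have h1 : ∑ i, ∑ j, f ω i * (p.param t ω a).ofLp j * mgrW a (p.ctx t ω) (p.arm t ω) i j
        = armInd a (p.arm t ω) * ((f ω ⬝ᵥ (p.ctx t ω).ofLp)
          * ((p.ctx t ω).ofLp ⬝ᵥ (p.param t ω a).ofLp)) := by
      simp only [dotProduct, Finset.sum_mul_sum]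
      simp only [Finset.mul_sum]
      refine Finset.sum_congr rfl fun i _ => Finset.sum_congr rfl fun j _ => ?_
      rw [mgrW_apply]; ring
    rw [h1, Trial.lossVec, dotProduct_smul, smul_eq_mul, Trial.loss, inner_eq_dotProduct]
    ring
  have hb : ∀ i j, BddMeas mΩ P fun ω =>
      f ω i * (p.param t ω a).ofLp j * mgrW a (p.ctx t ω) (p.arm t ω) i j := fun i j =>
    (((hf i).mul (hθ j)).mono hpast).mul (hW i j)
  have hb' : ∀ i j, BddMeas mΩ P fun ω =>
      f ω i * (p.param t ω a).ofLp j * armMoment D (p.policy c t ω) a i j := fun i j =>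
    (((hf i).mul (hθ j)).mul (h.armMoment_bdd ht a i j)).mono hpast
  simp only [e]
  rw [integral_add (BddMeas.sum _ fun i => .sum _ fun j => hb i j).integrable
    ((hfn.mono (h.afterArm_le ht)).mul (h.noise_bdd ht a)).integrable,
    h.integral_mul_noise ht a hfn, add_zero]
  simp only [dotProduct_mulVec_eq_sum]
  have e2 : ∀ ω i j, f ω i * armMoment D (p.policy c t ω) a i j * (p.param t ω a).ofLp j
      = f ω i * (p.param t ω a).ofLp j * armMoment D (p.policy c t ω) a i j := by
    intros; ring
  simp only [e2]
  refine integral_sum_congr _ (fun i => .sum _ fun j => hb i j) (fun i => .sum _ fun j => hb' i j)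
    fun i => integral_sum_congr _ (fun j => hb i j) (fun j => hb' i j) fun j => ?_
  exact h.mgrW_ctx_eqv ht a i j _ ((hf i).mul (hθ j))

/-- A deterministic bound on the number of resampling steps. -/
theorem simCount_le (h : IsTunedRun p c P ℱ D 𝒳 CX CΘ CE Cl) {t : ℕ}
    (ht : t ∈ Finset.Icc 1 c.T) (ω : Ω) : p.simCount t ω ≤ ⌊2 * (c.T * c.β₁)⌋₊ := by
  have ht' := Finset.mem_Icc.1 ht
  refine Nat.floor_le_floor ?_
  have h1 := h.rate_le ht'.1 (by omega) ω
  have h2 : (t : ℝ) * c.β₁ ≤ c.T * c.β₁ :=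
    mul_le_mul_of_nonneg_right (by exact_mod_cast ht'.2) h.β₁_pos.le
  linarith

theorem simCount_measurable (h : IsTunedRun p c P ℱ D 𝒳 CX CΘ CE Cl) {t : ℕ}
    (ht : t ∈ Finset.Icc 1 c.T) : Measurable[ℱ (t - 1)] (p.simCount t) := by
  rw [Finset.mem_Icc] at ht
  exact meas_simCount (h.meas_rate ht.1 (by omega))

theorem simCount_ind_bdd (h : IsTunedRun p c P ℱ D 𝒳 CX CΘ CE Cl) {t : ℕ}
    (ht : t ∈ Finset.Icc 1 c.T) (f : ℕ → ℝ) (hf : ∀ n, |f n| ≤ 1) :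
    BddMeas (ℱ (t - 1)) P fun ω => f (p.simCount t ω) :=
  ⟨(measurable_of_countable f).comp (h.simCount_measurable ht), 1,
    Filter.Eventually.of_forall fun _ => hf _⟩

/-- The mean of the loss estimate, with its bias `-⟨x, (I - δ S)^(M + 1) θ⟩`. -/
theorem integral_mul_lossEst (h : IsTunedRun p c P ℱ D 𝒳 CX CΘ CE Cl) {t : ℕ}
    (ht : t ∈ Finset.Icc 1 c.T) (a : Fin K) (x : Vec d) {w : Ω → ℝ}
    (hw : BddMeas (ℱ (t - 1)) P w) :
    ∫ ω, w ω * p.lossEst c t ω a x ∂P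
      = ∫ ω, w ω * (x.ofLp ⬝ᵥ (p.param t ω a).ofLp - x.ofLp ⬝ᵥ
          ((1 - c.δ • armMoment D (p.policy c t ω) a) ^ (p.simCount t ω + 1)
            *ᵥ (p.param t ω a).ofLp)) ∂P := by
  have := h.prob
  set n := ⌊2 * (c.T * c.β₁)⌋₊ + 1 with hn
  set ind : ℕ → ℕ → ℝ := fun k m => if k < m + 1 then 1 else 0 with hind
  have hindb : ∀ k, BddMeas (ℱ (t - 1)) P fun ω => ind k (p.simCount t ω) := fun k =>
    h.simCount_ind_bdd ht (ind k) fun m => by simp only [hind]; split_ifs <;> simp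
  have hres := h.isResampling ht a
  have hpast : ℱ (t - 1) ≤ mΩ := ℱ.le _
  have hsub : ∀ (ω : Ω) (F : ℕ → ℝ), ∑ k ∈ Finset.range (p.simCount t ω + 1), F k
      = ∑ k ∈ Finset.range n, ind k (p.simCount t ω) * F k := by
    intro ω F
    have hle := h.simCount_le ht ω
    have h1 : Finset.range (p.simCount t ω + 1) ⊆ Finset.range n := by
      intro k hk; rw [Finset.mem_range] at hk ⊢; omega
    rw [← Finset.sum_subset h1 fun k _ hk => by
      rw [Finset.mem_range] at hk; simp only [hind, if_neg hk, zero_mul]]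
    refine Finset.sum_congr rfl fun k hk => ?_
    simp only [hind, if_pos (Finset.mem_range.1 hk), one_mul]
  have hz := h.lossVec_bdd ht a 1
  have hzs : ∀ k, VecBdd (p.beforeSim ℱ t a 1) P
      fun ω => (w ω * ind k (p.simCount t ω)) • p.lossVec t a ω := fun k i =>
    ((hw.mul (hindb k)).mono past_le_beforeSim).mul (hz i)
  have hS := h.armMoment_bdd ht a
  have hR := hres.fst_meas
  have e1 : ∀ ω, w ω * p.lossEst c t ω a x = ∑ k ∈ Finset.range n, c.δ *
      (x.ofLp ⬝ᵥ (matProd (p.factor c.δ t a) k ω *ᵥ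
        ((w ω * ind k (p.simCount t ω)) • p.lossVec t a ω))) := by
    intro ω
    rw [lossEst_eq_sum, hsub, Finset.mul_sum, Finset.mul_sum]
    refine Finset.sum_congr rfl fun k _ => ?_
    rw [Matrix.mulVec_smul, dotProduct_smul, smul_eq_mul]
    ring
  have e2 : ∀ ω, w ω * (x.ofLp ⬝ᵥ (p.param t ω a).ofLp - x.ofLp ⬝ᵥ
          ((1 - c.δ • armMoment D (p.policy c t ω) a) ^ (p.simCount t ω + 1)
            *ᵥ (p.param t ω a).ofLp))
      = ∑ k ∈ Finset.range n, c.δ * (((w ω * ind k (p.simCount t ω)) •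
        (((1 - c.δ • armMoment D (p.policy c t ω) a) ^ k)ᵀ *ᵥ x.ofLp)) ⬝ᵥ
          (armMoment D (p.policy c t ω) a *ᵥ (p.param t ω a).ofLp)) := by
    intro ω
    set S := armMoment D (p.policy c t ω) a
    have hgeom := geom_sum_mul_neg (1 - c.δ • S) (p.simCount t ω + 1)
    rw [sub_sub_cancel] at hgeom
    have h1 : x.ofLp ⬝ᵥ (p.param t ω a).ofLp - x.ofLp ⬝ᵥ
          ((1 - c.δ • S) ^ (p.simCount t ω + 1) *ᵥ (p.param t ω a).ofLp)
        = x.ofLp ⬝ᵥ ((1 - (1 - c.δ • S) ^ (p.simCount t ω + 1)) *ᵥ (p.param t ω a).ofLp) := by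
      rw [Matrix.sub_mulVec, Matrix.one_mulVec, dotProduct_sub]
    rw [h1, ← hgeom, Finset.sum_mul, Matrix.sum_mulVec, dotProduct_sum, hsub, Finset.mul_sum]
    refine Finset.sum_congr rfl fun k _ => ?_
    rw [Matrix.mul_smul, Matrix.smul_mulVec, dotProduct_smul, smul_dotProduct, smul_eq_mul,
      smul_eq_mul, ← Matrix.mulVec_mulVec, Matrix.dotProduct_mulVec, ← Matrix.mulVec_transpose]
    ring
  simp only [e1, e2]
  have hVk : ∀ k, MatBdd mΩ P (matProd (p.factor c.δ t a) k) := fun k =>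
    (hres.matProd_bdd k).mono (hres.le _)
  have hfk : ∀ k, VecBdd (ℱ (t - 1)) P fun ω => (w ω * ind k (p.simCount t ω)) •
        (((1 - c.δ • armMoment D (p.policy c t ω) a) ^ k)ᵀ *ᵥ x.ofLp) := fun k i =>
    (hw.mul (hindb k)).mul ((hR.pow k).transpose.mulVec (VecBdd.const _) i)
  refine integral_sum_congr _ (fun k => (BddMeas.const _).mul ((VecBdd.const _).dotProduct
      ((hVk k).mulVec ((hzs k).mono (h.beforeSim_le ht a 1)))))
    (fun k => (BddMeas.const _).mul (((hfk k).dotProduct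
      (hS.mulVec (h.param_bdd ht a))).mono hpast)) fun k => ?_
  rw [integral_const_mul, integral_const_mul, hres.integral_matProd_mulVec _ k (hzs k),
    ← h.integral_dotProduct_lossVec ht a (hfk k)]
  congr 1
  refine integral_congr_ae (Filter.Eventually.of_forall fun ω => ?_)
  simp only
  rw [Matrix.mulVec_smul, dotProduct_smul, smul_dotProduct, Matrix.dotProduct_mulVec,
    ← Matrix.mulVec_transpose]

theorem dotProduct_mgrW_quad (A B : Matrix (Fin d) (Fin d) ℝ) (x : Fin d → ℝ) (a b : Fin K)
    (X : Vec d) :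
    x ⬝ᵥ ((A * mgrW a X b * Bᵀ) *ᵥ x)
      = armInd a b * ((x ⬝ᵥ (A *ᵥ X.ofLp)) * (x ⬝ᵥ (B *ᵥ X.ofLp))) := by
  rw [mgrW_eq, Matrix.mul_smul, Matrix.smul_mul, Matrix.smul_mulVec, dotProduct_smul, smul_eq_mul]
  congr 1
  rw [← Matrix.mulVec_mulVec, ← Matrix.mulVec_mulVec, Matrix.vecMulVec_mulVec,
    Matrix.dotProduct_mulVec, Matrix.dotProduct_mulVec x B, ← Matrix.mulVec_transpose B,
    dotProduct_comm (Bᵀ *ᵥ x)]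
  simp only [dotProduct_smul, MulOpposite.smul_eq_mul_unop, MulOpposite.unop_op,
    Matrix.dotProduct_mulVec]

/-- The second moment of the loss estimate. -/
theorem integral_mul_lossEst_sq_le (h : IsTunedRun p c P ℱ D 𝒳 CX CΘ CE Cl) {t : ℕ}
    (ht : t ∈ Finset.Icc 1 c.T) (a : Fin K) (x : Vec d) {w : Ω → ℝ}
    (hw : BddMeas (ℱ (t - 1)) P w) (hw0 : ∀ ω, 0 ≤ w ω) :
    ∫ ω, w ω * p.lossEst c t ω a x ^ 2 ∂P
      ≤ 4 * Cl ^ 2 * c.δ * ∫ ω, w ω * ∑ k ∈ Finset.range (p.simCount t ω + 1),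
        x.ofLp ⬝ᵥ ((quadMap (resMoment D (p.policy c t ω) c.δ a))^[k] 1 *ᵥ x.ofLp) ∂P := by
  have := h.prob
  set n := ⌊2 * (c.T * c.β₁)⌋₊ + 1 with hn
  set ind : ℕ → ℕ → ℝ := fun m m' => if m' = m then 1 else 0 with hind
  have hindb : ∀ m, BddMeas (ℱ (t - 1)) P fun ω => ind m (p.simCount t ω) := fun m =>
    h.simCount_ind_bdd ht (ind m) fun m => by simp only [hind]; split_ifs <;> simp
  have hind0 : ∀ m m', 0 ≤ ind m m' := fun m m' => by simp only [hind]; split_ifs <;> simp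
  have hres := h.isResampling ht a
  have hpast : ℱ (t - 1) ≤ mΩ := ℱ.le _
  have hδ := h.δ_pos
  have hsplit : ∀ (ω : Ω) (F : ℕ → ℝ), F (p.simCount t ω)
      = ∑ m ∈ Finset.range n, ind m (p.simCount t ω) * F m := by
    intro ω F
    rw [Finset.sum_eq_single (p.simCount t ω)]
    · simp [hind]
    · intro m _ hm; simp [hind, hm.symm]
    · intro hm; rw [Finset.mem_range] at hm
      have := h.simCount_le ht ω
      omega
  have hVk : ∀ k, MatBdd mΩ P (matProd (p.factor c.δ t a) k) := fun k =>
    (hres.matProd_bdd k).mono (hres.le _)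
  have hW := h.mgrW_ctx_bdd ht a
  have hwm : ∀ m, BddMeas (ℱ (t - 1)) P fun ω => w ω * ind m (p.simCount t ω) := fun m =>
    hw.mul (hindb m)
  have hQ := hres.snd_meas
  have hLk : ∀ k, BddMeas (ℱ (t - 1)) P fun ω =>
      x.ofLp ⬝ᵥ ((quadMap (resMoment D (p.policy c t ω) c.δ a))^[k] 1 *ᵥ x.ofLp) := fun k =>
    (VecBdd.const _).dotProduct ((quadMap_iterate_bdd hQ (MatBdd.const 1) k).mulVec (.const _))
  -- the quadratic form of the truncated sum of products, for a fixed number of factors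
  set B : ℕ → Ω → Matrix (Fin d) (Fin d) ℝ := fun m ω =>
    ∑ k ∈ Finset.range (m + 1), matProd (p.factor c.δ t a) k ω with hB
  have hBb : ∀ m, MatBdd mΩ P (B m) := fun m => MatBdd.sum _ hVk
  have hAb : ∀ m, MatBdd (p.beforeSim ℱ t a 1) P fun ω =>
      (w ω * ind m (p.simCount t ω)) • mgrW a (p.ctx t ω) (p.arm t ω) := fun m =>
    .smul ((hwm m).mono past_le_beforeSim) (hW.mono (le_sup_of_le_left le_sup_left))
  have hquad : ∀ m, BddMeas mΩ P fun ω => x.ofLp ⬝ᵥ ((B m ω *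
      ((w ω * ind m (p.simCount t ω)) • mgrW a (p.ctx t ω) (p.arm t ω)) * (B m ω)ᵀ) *ᵥ x.ofLp) :=
    fun m => (VecBdd.const _).dotProduct ((((hBb m).mul ((hAb m).mono (h.beforeSim_le ht a 1))).mul
      (hBb m).transpose).mulVec (.const _))
  have hquad_eq : ∀ m ω, x.ofLp ⬝ᵥ ((B m ω *
      ((w ω * ind m (p.simCount t ω)) • mgrW a (p.ctx t ω) (p.arm t ω)) * (B m ω)ᵀ) *ᵥ x.ofLp)
      = w ω * (ind m (p.simCount t ω) * (armInd a (p.arm t ω) *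
        (x.ofLp ⬝ᵥ (B m ω *ᵥ (p.ctx t ω).ofLp)) ^ 2)) := by
    intro m ω
    rw [Matrix.mul_smul, Matrix.smul_mul, Matrix.smul_mulVec, dotProduct_smul, smul_eq_mul,
      dotProduct_mgrW_quad]
    ring
  have hmain : ∀ m, ∫ ω, x.ofLp ⬝ᵥ ((B m ω *
      ((w ω * ind m (p.simCount t ω)) • mgrW a (p.ctx t ω) (p.arm t ω)) * (B m ω)ᵀ) *ᵥ x.ofLp) ∂P
      ≤ 4 / c.δ * ∫ ω, w ω * (ind m (p.simCount t ω) * ∑ k ∈ Finset.range (m + 1),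
        x.ofLp ⬝ᵥ ((quadMap (resMoment D (p.policy c t ω) c.δ a))^[k] 1 *ᵥ x.ofLp)) ∂P := by
    intro m
    have hA' : MatBdd (ℱ (t - 1)) P fun ω =>
        (w ω * ind m (p.simCount t ω)) • armMoment D (p.policy c t ω) a :=
      .smul (hwm m) (h.armMoment_bdd ht a)
    refine (hres.integral_sum_matProd_le x.ofLp (m + 1) (hAb m) hA' ?_ ?_ ?_).trans ?_
    · intro i j f hf
      have := h.mgrW_ctx_eqv ht a i j _ (hf.mul (hwm m))
      simpa only [Matrix.smul_apply, smul_eq_mul, mul_assoc] using this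
    · intro ω
      rw [Matrix.transpose_smul]
      congr 1
      ext i j
      simp only [Matrix.transpose_apply, mgrW_apply]
      ring
    · intro ω y
      rw [Matrix.smul_mulVec, dotProduct_smul, smul_eq_mul]
      have := dotProduct_mgrW_quad 1 1 y a (p.arm t ω) (p.ctx t ω)
      rw [Matrix.transpose_one, Matrix.mul_one, Matrix.one_mul] at this
      rw [this]
      exact mul_nonneg (mul_nonneg (hw0 ω) (hind0 _ _))
        (mul_nonneg (armInd_nonneg _ _) (mul_self_nonneg _))
    · simp only [Finset.mul_sum (s := Finset.range (m + 1))]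
      rw [integral_finsetSum _ fun k _ => (((hw.mul ((hindb m).mul (hLk k))).mono hpast)).integrable,
        Finset.mul_sum]
      refine Finset.sum_le_sum fun k _ => ?_
      rw [← integral_const_mul, ← integral_const_mul]
      have hR := hres.fst_meas
      have hGb : MatBdd (ℱ (t - 1)) P fun ω => ((w ω * ind m (p.simCount t ω)) •
          armMoment D (p.policy c t ω) a) * ∑ j ∈ Finset.range (m + 1 - k),
            ((1 - c.δ • armMoment D (p.policy c t ω) a)ᵀ) ^ j :=
        hA'.mul (MatBdd.sum _ fun j => hR.transpose.pow j)
      refine integral_mono_ae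
        ((BddMeas.const _).mul ((VecBdd.const _).dotProduct ((quadMap_iterate_bdd
          (fun i j k l => (hQ i j k l).mono hpast) (hGb.mono hpast) k).mulVec (.const _)))).integrable
        ((BddMeas.const _).mul ((hw.mul ((hindb m).mul (hLk k))).mono hpast)).integrable
        (Filter.Eventually.of_forall fun ω => ?_)
      simp only
      have hM := h.isMoments ht ω
      have hq := hM.quadNonneg_iterate (a := a) k
        (hM.quadNonneg_two_div_sub (a := a) (m + 1 - k)) x.ofLp
      rw [quadMap_iterate_sub, quadMap_iterate_smul] at hq
      simp only [Matrix.sub_mulVec, dotProduct_sub, Matrix.smul_mulVec, dotProduct_smul,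
        smul_eq_mul] at hq
      rw [IsMoments.resMean_transpose, Matrix.smul_mul, quadMap_iterate_smul, Matrix.smul_mulVec,
        dotProduct_smul, smul_eq_mul]
      have hw' : 0 ≤ w ω * ind m (p.simCount t ω) := mul_nonneg (hw0 ω) (hind0 _ _)
      have := mul_nonneg hw' hq
      have e : 4 / c.δ = 2 * (2 / c.δ) := by ring
      rw [e]
      nlinarith
  have hsum_b : BddMeas mΩ P fun ω => ∑ m ∈ Finset.range n, x.ofLp ⬝ᵥ ((B m ω *
      ((w ω * ind m (p.simCount t ω)) • mgrW a (p.ctx t ω) (p.arm t ω)) * (B m ω)ᵀ) *ᵥ x.ofLp) :=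
    .sum _ hquad
  calc ∫ ω, w ω * p.lossEst c t ω a x ^ 2 ∂P
      ≤ ∫ ω, (Cl ^ 2 * c.δ ^ 2) * ∑ m ∈ Finset.range n, x.ofLp ⬝ᵥ ((B m ω *
          ((w ω * ind m (p.simCount t ω)) • mgrW a (p.ctx t ω) (p.arm t ω))
            * (B m ω)ᵀ) *ᵥ x.ofLp) ∂P := by
        refine integral_mono_of_nonneg (Filter.Eventually.of_forall fun ω =>
          mul_nonneg (hw0 ω) (sq_nonneg _)) (hsum_b.integrable.const_mul _) ?_
        filter_upwards [h.ae_loss_le ht] with ω hω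
        simp only [hquad_eq]
        rw [← Finset.mul_sum, ← hsplit ω fun m => armInd a (p.arm t ω) *
          (x.ofLp ⬝ᵥ (B m ω *ᵥ (p.ctx t ω).ofLp)) ^ 2, lossEst_eq, invEst_eq, Trial.lossVec]
        simp only [Matrix.smul_mulVec, Matrix.mulVec_smul, dotProduct_smul, smul_eq_mul]
        set s := x.ofLp ⬝ᵥ (B (p.simCount t ω) ω *ᵥ (p.ctx t ω).ofLp) with hs
        have hl : (p.loss t ω a (p.ctx t ω)) ^ 2 ≤ Cl ^ 2 := sq_le_sq' (abs_le.1 (hω a)).1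
          (abs_le.1 (hω a)).2
        have h3 := armInd_mul_self a (p.arm t ω)
        have h4 : 0 ≤ w ω * (c.δ ^ 2 * armInd a (p.arm t ω) * s ^ 2) :=
          mul_nonneg (hw0 ω) (mul_nonneg (mul_nonneg (sq_nonneg _) (armInd_nonneg _ _))
            (sq_nonneg _))
        calc w ω * (armInd a (p.arm t ω) * p.loss t ω a (p.ctx t ω) * (c.δ * s)) ^ 2
            = w ω * (c.δ ^ 2 * (armInd a (p.arm t ω) * armInd a (p.arm t ω)) * s ^ 2)
              * p.loss t ω a (p.ctx t ω) ^ 2 := by ring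
          _ = w ω * (c.δ ^ 2 * armInd a (p.arm t ω) * s ^ 2)
              * p.loss t ω a (p.ctx t ω) ^ 2 := by rw [h3]
          _ ≤ w ω * (c.δ ^ 2 * armInd a (p.arm t ω) * s ^ 2) * Cl ^ 2 :=
              mul_le_mul_of_nonneg_left hl h4
          _ = Cl ^ 2 * c.δ ^ 2 * (w ω * (armInd a (p.arm t ω) * s ^ 2)) := by ring
    _ = (Cl ^ 2 * c.δ ^ 2) * ∑ m ∈ Finset.range n, ∫ ω, x.ofLp ⬝ᵥ ((B m ω *
          ((w ω * ind m (p.simCount t ω)) • mgrW a (p.ctx t ω) (p.arm t ω))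
            * (B m ω)ᵀ) *ᵥ x.ofLp) ∂P := by
        rw [integral_const_mul, integral_finsetSum _ fun m _ => (hquad m).integrable]
    _ ≤ (Cl ^ 2 * c.δ ^ 2) * ∑ m ∈ Finset.range n, (4 / c.δ * ∫ ω, w ω * (ind m (p.simCount t ω)
          * ∑ k ∈ Finset.range (m + 1), x.ofLp ⬝ᵥ
            ((quadMap (resMoment D (p.policy c t ω) c.δ a))^[k] 1 *ᵥ x.ofLp)) ∂P) :=
        mul_le_mul_of_nonneg_left (Finset.sum_le_sum fun m _ => hmain m) (by positivity)
    _ = _ := by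
        rw [← Finset.mul_sum, ← integral_finsetSum _ fun m _ =>
          ((hw.mul ((hindb m).mul (.sum _ hLk))).mono hpast).integrable, ← mul_assoc]
        have e : Cl ^ 2 * c.δ ^ 2 * (4 / c.δ) = 4 * Cl ^ 2 * c.δ := by field_simp
        rw [e]
        congr 1
        refine integral_congr_ae (Filter.Eventually.of_forall fun ω => ?_)
        simp only
        rw [← Finset.mul_sum, ← hsplit ω fun m => ∑ k ∈ Finset.range (m + 1), x.ofLp ⬝ᵥ
            ((quadMap (resMoment D (p.policy c t ω) c.δ a))^[k] 1 *ᵥ x.ofLp)]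

end IsTunedRun

end LinBandit

namespace LinBandit

/-! ### Pathwise bounds -/

open Matrix

theorem pow_le_one_div {r : ℝ} (h0 : 0 ≤ r) (h1 : r < 1) {n : ℕ} {b : ℝ} (hb : 0 < b)
    (hbn : b ≤ n) : r ^ n ≤ 1 / ((1 - r) * b) := by
  have key : ∀ n : ℕ, n * (1 - r) * r ^ n ≤ 1 - r ^ n := by
    intro n
    induction n with
    | zero => simp
    | succ n ih =>
      have h2 := mul_le_mul_of_nonneg_left ih h0
      have h3 : r ^ (n + 1) ≤ 1 := pow_le_one₀ h0 h1.le
      have h4 : r ^ (n + 1) * (1 - r) ≤ 1 * (1 - r) :=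
        mul_le_mul_of_nonneg_right h3 (by linarith)
      have e : r ^ (n + 1) = r * r ^ n := pow_succ' r n
      push_cast
      have : ((n : ℝ) + 1) * (1 - r) * r ^ (n + 1)
          = r * (n * (1 - r) * r ^ n) + r ^ (n + 1) * (1 - r) := by rw [e]; ring
      rw [this]
      nlinarith
  have hr : 0 < 1 - r := by linarith
  rw [le_div_iff₀ (by positivity)]
  have h2 := key n
  have h3 : 0 ≤ r ^ n := pow_nonneg h0 n
  calc r ^ n * ((1 - r) * b) ≤ r ^ n * ((1 - r) * n) := by gcongr
    _ = n * (1 - r) * r ^ n := by ring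
    _ ≤ 1 := by linarith

/-- A bound for the relative bias of the loss estimates in round `t`: the exploration rate pays for
the rounds of pure exploration, `e / T` for the small eigenvalues of `δ S`, and the last term
for those close to `2`. -/
noncomputable def Trial.biasBound {Ω : Type u} {K d : ℕ} (p : Trial Ω K d) (c : Tuning) (CX : ℝ)
    (t : ℕ) (ω : Ω) : ℝ :=
  p.explore c t ω + Real.exp 1 / c.T + 1 / ((1 - max 0 (c.δ * CX ^ 2 - 1)) * p.rate t ω)

namespace IsTunedRun

variable {Ω : Type u} {K d : ℕ} {mΩ : MeasurableSpace Ω} {p : Trial Ω K d} {c : Tuning}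
    {P : Measure Ω} {ℱ : Filtration ℕ mΩ} {D : Measure (Vec d)} {𝒳 : Set (Vec d)}
    {CX CΘ CE Cl : ℝ}

theorem one_sub_max_pos (h : IsTunedRun p c P ℱ D 𝒳 CX CΘ CE Cl) :
    0 < 1 - max 0 (c.δ * CX ^ 2 - 1) := by
  have := h.step
  have : max 0 (c.δ * CX ^ 2 - 1) < 1 := max_lt one_pos (by linarith)
  linarith

theorem explore_le (h : IsTunedRun p c P ℱ D 𝒳 CX CΘ CE Cl) {t : ℕ}
    (ht : t ∈ Finset.Icc 1 c.T) (ω : Ω) :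
    p.explore c t ω ≤ K * Real.log c.T / (2 * c.δ * c.lam * c.β₁) * (1 / √t) := by
  have h1 := h.one_div_rate_le ht ω
  have h2 := h.δ_pos
  have h3 := h.lam_pos
  have h4 := h.log_T_pos
  refine (min_le_right _ _).trans ?_
  have e1 : K / (2 * c.δ * c.lam * p.rate t ω) * Real.log c.T
      = K * Real.log c.T / (2 * c.δ * c.lam) * (1 / p.rate t ω) := by
    rw [div_mul_div_comm, mul_one, div_mul_eq_mul_div]
  have e2 : K * Real.log c.T / (2 * c.δ * c.lam * c.β₁) * (1 / √t)
      = K * Real.log c.T / (2 * c.δ * c.lam) * (1 / c.β₁ * (1 / √t)) := by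
    rw [← mul_assoc, div_mul_div_comm _ _ 1 c.β₁, mul_one]
  rw [e1, e2]
  exact mul_le_mul_of_nonneg_left h1 (by positivity)

theorem biasBound_nonneg (h : IsTunedRun p c P ℱ D 𝒳 CX CΘ CE Cl) {t : ℕ}
    (ht : t ∈ Finset.Icc 1 c.T) (ω : Ω) : 0 ≤ p.biasBound c CX t ω := by
  have h1 := (h.explore_mem ht ω).1
  have h2 := h.one_sub_max_pos
  rw [Finset.mem_Icc] at ht
  have h3 := h.rate_pos ht.1 (by omega) ω
  unfold Trial.biasBound
  positivity

theorem abs_bias_le (h : IsTunedRun p c P ℱ D 𝒳 CX CΘ CE Cl) {t : ℕ}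
    (ht : t ∈ Finset.Icc 1 c.T) (ω : Ω) (a : Fin K) {x θ : Vec d} (hx : ‖x‖ ≤ CX)
    (hθ : ‖θ‖ ≤ CΘ) :
    |x.ofLp ⬝ᵥ ((1 - c.δ • armMoment D (p.policy c t ω) a) ^ (p.simCount t ω + 1) *ᵥ θ.ofLp)|
      ≤ CX * CΘ * p.biasBound c CX t ω := by
  have ht' := Finset.mem_Icc.1 ht
  have hM := h.isMoments ht ω
  have hβ := h.rate_pos ht'.1 (by omega) ω
  have hγ := h.explore_mem ht ω
  have hlog := h.log_T_pos
  have hδ := h.δ_pos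
  have hlam := h.lam_pos
  have hr := h.one_sub_max_pos
  have hCX := h.CX_pos
  have hK2 : (2 : ℝ) ≤ K := by exact_mod_cast h.two_le_K
  have hT0 : (0 : ℝ) < c.T := by have := h.two_le_T; positivity
  set r := max 0 (c.δ * CX ^ 2 - 1) with hrdef
  set β := p.rate t ω with hβdef
  have hxx : √(x.ofLp ⬝ᵥ x.ofLp) ≤ CX := by
    rw [← norm_sq_eq_dotProduct, Real.sqrt_sq (norm_nonneg _)]; exact hx
  have hθθ : √(θ.ofLp ⬝ᵥ θ.ofLp) ≤ CΘ := by
    rw [← norm_sq_eq_dotProduct, Real.sqrt_sq (norm_nonneg _)]; exact hθ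
  have hprod : √(x.ofLp ⬝ᵥ x.ofLp) * √(θ.ofLp ⬝ᵥ θ.ofLp) ≤ CX * CΘ :=
    mul_le_mul hxx hθθ (Real.sqrt_nonneg _) hCX.le
  have hprod0 : 0 ≤ √(x.ofLp ⬝ᵥ x.ofLp) * √(θ.ofLp ⬝ᵥ θ.ofLp) := by positivity
  have h3 : 0 < 1 / ((1 - r) * β) := by positivity
  have h4 : 0 < Real.exp 1 / c.T := by positivity
  have hbb : p.biasBound c CX t ω = p.explore c t ω + Real.exp 1 / c.T + 1 / ((1 - r) * β) := rfl
  rcases hγ.2.eq_or_lt with h1 | h1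
  · calc _ ≤ √(x.ofLp ⬝ᵥ x.ofLp) * √(θ.ofLp ⬝ᵥ θ.ofLp) :=
          hM.abs_dotProduct_resMean_pow_le _ _ _
      _ ≤ CX * CΘ * 1 := by rw [mul_one]; exact hprod
      _ ≤ _ := mul_le_mul_of_nonneg_left (by rw [hbb, h1]; linarith) (hprod0.trans hprod)
  · have hγeq : p.explore c t ω = K / (2 * c.δ * c.lam * β) * Real.log c.T := by
      unfold Trial.explore at h1 ⊢
      rcases min_choice 1 (K / (2 * c.δ * c.lam * p.rate t ω) * Real.log c.T) with h2 | h2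
      · rw [h2] at h1; exact absurd h1 (lt_irrefl _)
      · exact h2
    have hlogβ : Real.log c.T ≤ 2 * β := by
      rw [hγeq, div_mul_eq_mul_div, div_lt_one (by positivity)] at h1
      have h5 : c.δ * c.lam ≤ 2 := by
        have := mul_le_mul_of_nonneg_left h.run.contextLaw.lam_le_sq hδ.le
        linarith [h.step]
      have h6 := mul_le_mul_of_nonneg_right h5 hβ.le
      have h7 := mul_le_mul_of_nonneg_right hK2 hlog.le
      linarith
    set s := p.explore c t ω / K * c.lam with hs
    have hδs : c.δ * s = Real.log c.T / (2 * β) := by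
      rw [hs, hγeq]; field_simp
    set n := p.simCount t ω + 1 with hn
    have hn1 : 2 * β - 1 ≤ n := by
      have := Nat.lt_floor_add_one (2 * β - 1)
      rw [hn, Trial.simCount]; push_cast; exact this.le
    have hn2 : (1 : ℝ) ≤ n := by rw [hn]; push_cast; linarith [Nat.cast_nonneg (α := ℝ) (p.simCount t ω)]
    have hnβ : β ≤ n := by rcases le_total β 1 with h5 | h5 <;> linarith
    set e := Real.exp (-(c.δ * s)) with he
    have hc := abs_dotProduct_pow_mulVec_le (c := max e r)
      (IsMoments.resMean_transpose (D := D) (f := p.policy c t ω) (a := a) (δ := c.δ))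
      (le_max_of_le_left (Real.exp_pos _).le)
      (hM.abs_dotProduct_resMean_le (s := s) (a := a) (h.armMoment_ge ht ω a)
        (le_max_of_le_left (by have := Real.add_one_le_exp (-(c.δ * s)); linarith))
        (le_max_of_le_right (le_max_right _ _))) n x.ofLp θ.ofLp
    have hpow : (max e r) ^ n ≤ Real.exp 1 / c.T + 1 / ((1 - r) * β) := by
      have h5 : e ^ n ≤ Real.exp 1 / c.T := by
        rw [he, ← Real.exp_nat_mul]
        have : Real.exp 1 / c.T = Real.exp (1 - Real.log c.T) := by
          rw [Real.exp_sub, Real.exp_log hT0]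
        rw [this, Real.exp_le_exp, hδs]
        have h6 : (2 * β - 1) * (Real.log c.T / (2 * β)) ≤ n * (Real.log c.T / (2 * β)) :=
          mul_le_mul_of_nonneg_right hn1 (by positivity)
        have h7 : (2 * β - 1) * (Real.log c.T / (2 * β))
            = Real.log c.T - Real.log c.T / (2 * β) := by field_simp
        have h8 : Real.log c.T / (2 * β) ≤ 1 := (div_le_one (by positivity)).2 hlogβ
        linarith
      have h6 : r ^ n ≤ 1 / ((1 - r) * β) :=
        pow_le_one_div (le_max_left _ _) (by linarith) hβ hnβ
      rcases le_total e r with h7 | h7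
      · rw [max_eq_right h7]; linarith
      · rw [max_eq_left h7]; linarith
    calc _ ≤ _ := hc
      _ ≤ p.biasBound c CX t ω * (CX * CΘ) := by
          refine mul_le_mul ?_ hprod hprod0 (h.biasBound_nonneg ht ω)
          rw [hbb]; linarith [hγ.1]
      _ = _ := mul_comm _ _

/-- Products of resampling factors are contractions, which bounds the loss estimates. -/
theorem ae_abs_lossEst_le (h : IsTunedRun p c P ℱ D 𝒳 CX CΘ CE Cl) {t : ℕ}
    (ht : t ∈ Finset.Icc 1 c.T) :
    ∀ᵐ ω ∂P, ∀ a (x : Vec d), ‖x‖ ≤ CX →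
      |p.lossEst c t ω a x| ≤ CX / 2 * (p.simCount t ω + 1) := by
  have hsim : ∀ᵐ ω ∂P, ∀ a, ∀ k : ℕ, ‖p.simCtx t a (k + 1) ω‖ ≤ CX := by
    rw [ae_all_iff]
    intro a
    rw [ae_all_iff]
    exact fun k => h.ae_norm_simCtx_le ht a (by omega)
  filter_upwards [hsim, h.ae_loss_le ht, h.ae_norm_ctx_le ht] with ω h1 h2 h3 a x hx
  have hδ := h.δ_pos
  have hκ : 0 ≤ c.δ * (2 - c.δ * CX ^ 2) := mul_nonneg hδ.le (by linarith [h.step])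
  have hVk : ∀ (k : ℕ) (z : Fin d → ℝ), (matProd (p.factor c.δ t a) k ω *ᵥ z) ⬝ᵥ
      (matProd (p.factor c.δ t a) k ω *ᵥ z) ≤ z ⬝ᵥ z := by
    intro k
    induction k with
    | zero => intro z; simp [matProd]
    | succ k ih =>
      intro z
      have h4 := IsMoments.resMat_mulVec_self_le (δ := c.δ) (a := a)
        (z := (p.simCtx t a (k + 1) ω, p.simArm t a (k + 1) ω)) (h1 a k) z
      simp only [matProd]
      rw [← Matrix.mulVec_mulVec]
      refine (ih _).trans (h4.trans (sub_le_self _ ?_))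
      exact mul_nonneg hκ (mul_nonneg (armInd_nonneg _ _) (mul_self_nonneg _))
  have hz : p.lossVec t a ω ⬝ᵥ p.lossVec t a ω ≤ (Cl * CX) ^ 2 := by
    have e : p.lossVec t a ω ⬝ᵥ p.lossVec t a ω
        = (armInd a (p.arm t ω)) * (p.loss t ω a (p.ctx t ω)) ^ 2 * ‖p.ctx t ω‖ ^ 2 := by
      rw [Trial.lossVec, norm_sq_eq_dotProduct, smul_dotProduct, dotProduct_smul, smul_eq_mul,
        smul_eq_mul]
      conv_rhs => rw [← armInd_mul_self]
      ring
    have h5 : (p.loss t ω a (p.ctx t ω)) ^ 2 ≤ Cl ^ 2 :=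
      sq_le_sq' (abs_le.1 (h2 a)).1 (abs_le.1 (h2 a)).2
    have h6 : ‖p.ctx t ω‖ ^ 2 ≤ CX ^ 2 := pow_le_pow_left₀ (norm_nonneg _) h3 2
    rw [e, mul_pow]
    refine mul_le_mul ?_ h6 (sq_nonneg _) (sq_nonneg _)
    exact (mul_le_of_le_one_left (sq_nonneg _) (armInd_le_one _ _)).trans h5
  have hterm : ∀ k, |x.ofLp ⬝ᵥ (matProd (p.factor c.δ t a) k ω *ᵥ p.lossVec t a ω)|
      ≤ CX * (Cl * CX) := by
    intro k
    refine abs_le_of_sq_le_sq ?_ (by have := h.CX_pos; have := h.Cl_pos; positivity)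
    have hcs := Finset.sum_mul_sq_le_sq_mul_sq Finset.univ x.ofLp
      (matProd (p.factor c.δ t a) k ω *ᵥ p.lossVec t a ω)
    have hxx : x.ofLp ⬝ᵥ x.ofLp ≤ CX ^ 2 := by
      rw [← norm_sq_eq_dotProduct]; exact pow_le_pow_left₀ (norm_nonneg _) hx 2
    simp only [sq (x.ofLp _), sq ((matProd (p.factor c.δ t a) k ω *ᵥ p.lossVec t a ω) _)] at hcs
    refine hcs.trans ?_
    rw [mul_pow]
    exact mul_le_mul hxx ((hVk k _).trans hz) (dotProduct_self_nonneg' _) (sq_nonneg _)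
  rw [lossEst_eq_sum, abs_mul, abs_of_pos hδ]
  have hδeq : c.δ * (Cl * CX) = 1 / 2 := by
    have := h.CX_pos
    have := h.Cl_pos
    rw [h.δ_eq, stepSize]; field_simp
  calc c.δ * |∑ k ∈ Finset.range (p.simCount t ω + 1),
        x.ofLp ⬝ᵥ (matProd (p.factor c.δ t a) k ω *ᵥ p.lossVec t a ω)|
      ≤ c.δ * ∑ k ∈ Finset.range (p.simCount t ω + 1), CX * (Cl * CX) :=
        mul_le_mul_of_nonneg_left ((Finset.abs_sum_le_sum_abs _ _).trans
          (Finset.sum_le_sum fun k _ => hterm k)) hδ.le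
    _ = (c.δ * (Cl * CX)) * CX * (p.simCount t ω + 1) := by
        rw [Finset.sum_const, Finset.card_range, nsmul_eq_mul]; push_cast; ring
    _ = _ := by rw [hδeq]; ring

/-- The pathwise regret bound for the loss estimates at a fixed context. -/
theorem ae_ftrl_le (h : IsTunedRun p c P ℱ D 𝒳 CX CΘ CE Cl) :
    ∀ᵐ ω ∂P, ∀ (x : Vec d), ‖x‖ ≤ CX → ∀ u ∈ stdSimplex ℝ (Fin K),
      ∑ t ∈ Finset.Icc 1 c.T, ∑ a, (p.q t ω x a - u a) * p.lossEst c t ω a x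
      ≤ c.β₁ * Real.log K
        + ∑ t ∈ Finset.Ico 1 c.T, (p.rate (t + 1) ω - p.rate t ω) * entropy (p.q (t + 1) ω x)
        + ∑ t ∈ Finset.Icc 1 c.T, (Real.exp CX *
            ((∑ a, p.q t ω x a * p.lossEst c t ω a x ^ 2) / p.rate t ω) + CX / p.rate t ω) := by
  have hall : ∀ᵐ ω ∂P, ∀ t ∈ Finset.Icc 1 c.T, ∀ a (x : Vec d), ‖x‖ ≤ CX →
      |p.lossEst c t ω a x| ≤ CX / 2 * (p.simCount t ω + 1) := by
    rw [ae_all_iff]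
    intro t
    by_cases ht : t ∈ Finset.Icc 1 c.T
    · filter_upwards [h.ae_abs_lossEst_le ht] with ω hω _ using hω
    · exact Filter.Eventually.of_forall fun ω ht' => absurd ht' ht
  filter_upwards [hall] with ω hω x hx u hu
  have hT := h.two_le_T
  have hpos : ∀ t ∈ Finset.Icc 1 c.T, 0 < p.rate t ω := fun t ht => by
    rw [Finset.mem_Icc] at ht; exact h.rate_pos ht.1 (by omega) ω
  set q' : ℕ → Fin K → ℝ := fun t =>
    softmax (fun a => ∑ s ∈ Finset.Ico 1 t, p.lossEst c s ω a x) (p.rate t ω) with hq'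
  have hqq : ∀ t ∈ Finset.Icc 1 c.T, p.q t ω x = q' t := fun t ht => h.q_eq_softmax ht ω x
  have key := ftrl_regret_le (T := c.T) (β := fun t => p.rate t ω)
    (l := fun t a => p.lossEst c t ω a x)
    (stab := fun t => Real.exp CX * ((∑ a, q' t a * p.lossEst c t ω a x ^ 2) / p.rate t ω)
      + CX / p.rate t ω) h.K_pos (by omega) hpos ?_ hu
  · rw [h.run.algorithm.rate_one ω] at key
    calc _ = ∑ t ∈ Finset.Icc 1 c.T, ∑ a, (q' t a - u a) * p.lossEst c t ω a x :=
          Finset.sum_congr rfl fun t ht => by rw [hqq t ht]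
      _ ≤ _ := key
      _ = _ := by
          congr 1
          · congr 1
            refine Finset.sum_congr rfl fun t ht => ?_
            rw [hqq (t + 1) (by simp only [Finset.mem_Ico, Finset.mem_Icc] at ht ⊢; omega)]
          · exact Finset.sum_congr rfl fun t ht => by rw [hqq t ht]
  · intro t ht
    have := freeEnergy_add_ge_of_simCount (L := fun a => ∑ s ∈ Finset.Ico 1 t, p.lossEst c s ω a x)
      h.K_pos (hpos t ht) h.CX_pos.le (fun a => hω t ht a x hx)
    linarith

end IsTunedRun

end LinBandit

namespace LinBandit

/-! ### Averaging over an independent context -/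

open Matrix

namespace BddMeas

variable {α E : Type*} {m m' mα : MeasurableSpace α} {mE : MeasurableSpace E} {μ : Measure α}
  {D : Measure E}

theorem abs {f : α → ℝ} (hf : BddMeas m μ f) : BddMeas m μ fun ω => |f ω| :=
  ⟨continuous_abs.measurable.comp hf.1, hf.2.imp fun _ hC => by simpa using hC⟩

theorem comp_fst [SFinite D] {f : α → ℝ} (hf : BddMeas m μ f) :
    BddMeas (m.prod mE) (μ.prod D) fun z => f z.1 :=
  ⟨hf.1.comp (@measurable_fst _ _ m mE),
    hf.2.imp fun _ hC => Measure.quasiMeasurePreserving_fst.ae hC⟩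

theorem comp_snd [SFinite μ] [SFinite D] {f : E → ℝ} (hf : BddMeas mE D f) :
    BddMeas (m.prod mE) (μ.prod D) fun z => f z.2 :=
  ⟨hf.1.comp (@measurable_snd _ _ m mE),
    hf.2.imp fun _ hC => Measure.quasiMeasurePreserving_snd.ae hC⟩

theorem mono_prod (h : m ≤ m') {F : α × E → ℝ}
    (hF : BddMeas (m.prod mE) (μ.prod D) F) : BddMeas (m'.prod mE) (μ.prod D) F :=
  hF.mono (sup_le_sup (MeasurableSpace.comap_mono h) le_rfl)

theorem ae_ae_le [SFinite μ] [SFinite D] (hm : m ≤ mα) {F : α × E → ℝ}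
    (hF : BddMeas (m.prod mE) (μ.prod D) F) : ∃ C, ∀ᵐ x ∂D, ∀ᵐ ω ∂μ, |F (ω, x)| ≤ C := by
  obtain ⟨hFm, C, hC⟩ := hF.mono_prod hm
  refine ⟨C, (Measure.ae_ae_comm (p := fun ω x => |F (ω, x)| ≤ C) ?_).1
    (Measure.ae_ae_of_ae_prod hC)⟩
  exact measurableSet_le hFm.abs measurable_const

theorem ae_slice [SFinite μ] [SFinite D] (hm : m ≤ mα) {F : α × E → ℝ}
    (hF : BddMeas (m.prod mE) (μ.prod D) F) : ∀ᵐ x ∂D, BddMeas m μ fun ω => F (ω, x) := by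
  obtain ⟨C, hC⟩ := hF.ae_ae_le hm
  filter_upwards [hC] with x hx
  exact ⟨hF.1.comp (@measurable_prodMk_right _ _ m mE x), C, hx⟩

/-- A bounded measurable choice among bounded measurable functions. -/
theorem select {F : ℕ → α → ℝ} (hF : ∀ n, BddMeas m μ (F n)) {M : α → ℕ} (hM : Measurable[m] M)
    {N : ℕ} (hN : ∀ ω, M ω < N) : BddMeas m μ fun ω => F (M ω) ω := by
  have e : (fun ω => F (M ω) ω)
      = fun ω => ∑ n ∈ Finset.range N, (M ⁻¹' {n}).indicator (fun _ => (1 : ℝ)) ω * F n ω := by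
    ext ω
    rw [Finset.sum_eq_single (M ω)]
    · simp
    · intro n _ hn
      simp [hn.symm]
    · intro hn
      exact absurd (Finset.mem_range.2 (hN ω)) hn
  rw [e]
  exact .sum _ fun n => (BddMeas.indicator (hM (measurableSet_singleton n))).mul (hF n)

end BddMeas

namespace IsTunedRun

variable {Ω : Type u} {K d : ℕ} {mΩ : MeasurableSpace Ω} {p : Trial Ω K d} {c : Tuning}
    {P : Measure Ω} {ℱ : Filtration ℕ mΩ} {D : Measure (Vec d)} {𝒳 : Set (Vec d)}
    {CX CΘ CE Cl : ℝ}

theorem rate_bdd (h : IsTunedRun p c P ℱ D 𝒳 CX CΘ CE Cl) {t : ℕ} (ht : 1 ≤ t)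
    (htT : t ≤ c.T + 1) : BddMeas (ℱ (t - 1)) P (p.rate t) :=
  ⟨h.meas_rate ht htT, t * c.β₁, Filter.Eventually.of_forall fun ω => by
    rw [abs_of_pos (h.rate_pos ht htT ω)]; exact h.rate_le ht htT ω⟩

theorem one_div_rate_bdd (h : IsTunedRun p c P ℱ D 𝒳 CX CΘ CE Cl) {t : ℕ}
    (ht : t ∈ Finset.Icc 1 c.T) : BddMeas (ℱ (t - 1)) P fun ω => 1 / p.rate t ω := by
  have ht' := Finset.mem_Icc.1 ht
  refine ⟨measurable_const.div (h.meas_rate ht'.1 (by omega)), 1 / c.β₁ * (1 / √t),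
    Filter.Eventually.of_forall fun ω => ?_⟩
  rw [abs_of_pos (one_div_pos.2 (h.rate_pos ht'.1 (by omega) ω))]
  exact h.one_div_rate_le ht ω

theorem explore_bdd (h : IsTunedRun p c P ℱ D 𝒳 CX CΘ CE Cl) {t : ℕ}
    (ht : t ∈ Finset.Icc 1 c.T) : BddMeas (ℱ (t - 1)) P (p.explore c t) :=
  ⟨h.meas_explore ht, 1, Filter.Eventually.of_forall fun ω => by
    rw [abs_of_pos (h.explore_mem ht ω).1]; exact (h.explore_mem ht ω).2⟩

theorem biasBound_bdd (h : IsTunedRun p c P ℱ D 𝒳 CX CΘ CE Cl) {t : ℕ}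
    (ht : t ∈ Finset.Icc 1 c.T) : BddMeas (ℱ (t - 1)) P (p.biasBound c CX t) := by
  have e : p.biasBound c CX t = fun ω => p.explore c t ω + Real.exp 1 / c.T
      + 1 / (1 - max 0 (c.δ * CX ^ 2 - 1)) * (1 / p.rate t ω) := by
    ext ω; rw [Trial.biasBound, one_div_mul_one_div]
  rw [e]
  exact ((h.explore_bdd ht).add (.const _)).add ((BddMeas.const _).mul (h.one_div_rate_bdd ht))

theorem q_le_one (h : IsTunedRun p c P ℱ D 𝒳 CX CΘ CE Cl) {t : ℕ}
    (ht : t ∈ Finset.Icc 1 c.T) (ω : Ω) (x : Vec d) (a : Fin K) : p.q t ω x a ≤ 1 := by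
  have hq := h.q_mem ht ω x
  rw [← hq.2]
  exact Finset.single_le_sum (fun i _ => hq.1 i) (Finset.mem_univ a)

theorem q_bdd (h : IsTunedRun p c P ℱ D 𝒳 CX CΘ CE Cl) {t : ℕ}
    (ht : t ∈ Finset.Icc 1 c.T) (a : Fin K) :
    BddMeas ((ℱ (t - 1)).prod inferInstance) (P.prod D) fun z => p.q t z.1 z.2 a :=
  ⟨h.meas_q ht a, 1, Filter.Eventually.of_forall fun z => by
    rw [abs_of_nonneg ((h.q_mem ht z.1 z.2).1 a)]; exact h.q_le_one ht _ _ a⟩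

theorem policy_bdd (h : IsTunedRun p c P ℱ D 𝒳 CX CΘ CE Cl) {t : ℕ}
    (ht : t ∈ Finset.Icc 1 c.T) (a : Fin K) :
    BddMeas ((ℱ (t - 1)).prod inferInstance) (P.prod D) fun z => p.policy c t z.1 z.2 a :=
  ⟨(h.randomPolicy ht).meas a, 1, Filter.Eventually.of_forall fun z => by
    have hp := (h.randomPolicy ht).isPolicy z.1
    rw [abs_of_nonneg (hp.nonneg z.2 a)]; exact hp.le_one z.2 a⟩

theorem entropy_bdd (h : IsTunedRun p c P ℱ D 𝒳 CX CΘ CE Cl) {t : ℕ}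
    (ht : t ∈ Finset.Icc 1 c.T) :
    BddMeas ((ℱ (t - 1)).prod inferInstance) (P.prod D) fun z => entropy (p.q t z.1 z.2) :=
  ⟨meas_entropy (h.meas_q ht), Real.log K, Filter.Eventually.of_forall fun z => by
    rw [abs_of_nonneg (entropy_nonneg (h.q_mem ht _ _))]
    exact entropy_le h.K_pos (h.q_mem ht _ _)⟩

theorem ae_prod_norm_le (h : IsTunedRun p c P ℱ D 𝒳 CX CΘ CE Cl) :
    ∀ᵐ z ∂(P.prod D), ‖z.2‖ ≤ CX :=
  have := h.prob_ctx
  Measure.quasiMeasurePreserving_snd.ae h.run.contextLaw.ae_norm_le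

theorem lossEst_bdd (h : IsTunedRun p c P ℱ D 𝒳 CX CΘ CE Cl) {t : ℕ}
    (ht : t ∈ Finset.Icc 1 c.T) (a : Fin K) :
    BddMeas (mΩ.prod inferInstance) (P.prod D) fun z => p.lossEst c t z.1 a z.2 := by
  have := h.prob_ctx
  have := h.prob
  refine ⟨(h.meas_lossEst ht a).mono
    (sup_le_sup (MeasurableSpace.comap_mono (ℱ.le _)) le_rfl) le_rfl,
    CX / 2 * (⌊2 * (c.T * c.β₁)⌋₊ + 1), ?_⟩
  have h1 : ∀ᵐ z ∂(P.prod D), ∀ a (x : Vec d), ‖x‖ ≤ CX →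
      |p.lossEst c t z.1 a x| ≤ CX / 2 * (p.simCount t z.1 + 1) :=
    Measure.quasiMeasurePreserving_fst.ae (h.ae_abs_lossEst_le ht)
  filter_upwards [h1, h.ae_prod_norm_le] with z hz hx
  refine (hz a _ hx).trans (mul_le_mul_of_nonneg_left ?_ (by have := h.CX_pos; positivity))
  have : (p.simCount t z.1 : ℝ) ≤ ⌊2 * (c.T * c.β₁)⌋₊ := by exact_mod_cast h.simCount_le ht z.1
  linarith

theorem ctx_coord_bdd (h : IsTunedRun p c P ℱ D 𝒳 CX CΘ CE Cl) (t : ℕ) :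
    VecBdd ((ℱ t).prod inferInstance) (P.prod D) fun z : Ω × Vec d => z.2.ofLp := fun i =>
  have := h.prob_ctx
  have := h.prob
  (h.run.contextLaw.coord_bdd i).comp_snd

theorem dotProduct_param_bdd (h : IsTunedRun p c P ℱ D 𝒳 CX CΘ CE Cl) {t : ℕ}
    (ht : t ∈ Finset.Icc 1 c.T) (a : Fin K) :
    BddMeas ((ℱ (t - 1)).prod inferInstance) (P.prod D)
      fun z => z.2.ofLp ⬝ᵥ (p.param t z.1 a).ofLp :=
  have := h.prob_ctx
  (h.ctx_coord_bdd _).dotProduct fun i => (h.param_bdd ht a i).comp_fst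

/-- The quadratic form that controls the second moment of the loss estimate of arm `a`. -/
noncomputable def _root_.LinBandit.Trial.resForm (p : Trial Ω K d) (c : Tuning)
    (D : Measure (Vec d)) (t : ℕ) (a : Fin K) (ω : Ω) (x : Vec d) : ℝ :=
  ∑ k ∈ Finset.range (p.simCount t ω + 1),
    x.ofLp ⬝ᵥ ((quadMap (resMoment D (p.policy c t ω) c.δ a))^[k] 1 *ᵥ x.ofLp)

theorem resForm_nonneg (h : IsTunedRun p c P ℱ D 𝒳 CX CΘ CE Cl) {t : ℕ}
    (ht : t ∈ Finset.Icc 1 c.T) (a : Fin K) (ω : Ω) (x : Vec d) : 0 ≤ p.resForm c D t a ω x :=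
  Finset.sum_nonneg fun k _ =>
    (h.isMoments ht ω).quadNonneg_iterate (a := a) k IsMoments.quadNonneg_one _

theorem resForm_bdd (h : IsTunedRun p c P ℱ D 𝒳 CX CΘ CE Cl) {t : ℕ}
    (ht : t ∈ Finset.Icc 1 c.T) (a : Fin K) :
    BddMeas ((ℱ (t - 1)).prod inferInstance) (P.prod D) fun z => p.resForm c D t a z.1 z.2 := by
  have := h.prob_ctx
  refine BddMeas.select (F := fun n (z : Ω × Vec d) => ∑ k ∈ Finset.range (n + 1),
    z.2.ofLp ⬝ᵥ ((quadMap (resMoment D (p.policy c t z.1) c.δ a))^[k] 1 *ᵥ z.2.ofLp))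
    (fun n => .sum _ fun k => ?_)
    (M := fun z => p.simCount t z.1) (N := ⌊2 * (c.T * c.β₁)⌋₊ + 1)
    ((h.simCount_measurable ht).comp (@measurable_fst _ _ (ℱ (t - 1)) _))
    fun z => Nat.lt_succ_of_le (h.simCount_le ht z.1)
  have hL := quadMap_iterate_bdd (h.isResampling ht a).snd_meas (MatBdd.const 1) k
  exact (h.ctx_coord_bdd _).dotProduct
    (MatBdd.mulVec (fun i j => (hL i j).comp_fst) (h.ctx_coord_bdd _))

/-- The bias of the loss estimates, averaged against a weight that is known before the round. -/
theorem integral_mul_lossEst_ge (h : IsTunedRun p c P ℱ D 𝒳 CX CΘ CE Cl) {t : ℕ}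
    (ht : t ∈ Finset.Icc 1 c.T) (a : Fin K) {W : Ω × Vec d → ℝ}
    (hW : BddMeas ((ℱ (t - 1)).prod inferInstance) (P.prod D) W) :
    ∫ z, W z * (z.2.ofLp ⬝ᵥ (p.param t z.1 a).ofLp) ∂(P.prod D)
        - CX * CΘ * ∫ z, |W z| * p.biasBound c CX t z.1 ∂(P.prod D)
      ≤ ∫ z, W z * p.lossEst c t z.1 a z.2 ∂(P.prod D) := by
  have := h.prob_ctx
  have := h.prob
  have hpast : ℱ (t - 1) ≤ mΩ := ℱ.le _
  have hW' := hW.mono_prod hpast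
  have h1 := (hW.mul (h.dotProduct_param_bdd ht a)).mono_prod hpast
  have h2 := (hW.abs.mul (h.biasBound_bdd ht).comp_fst).mono_prod hpast
  have h3 := hW'.mul (h.lossEst_bdd ht a)
  have h4 := h1.sub ((BddMeas.const (CX * CΘ)).mul h2)
  rw [← integral_const_mul, ← integral_sub h1.integrable ((BddMeas.const _).mul h2).integrable,
    integral_prod_symm _ h4.integrable, integral_prod_symm _ h3.integrable]
  refine integral_mono_ae h4.integrable.integral_prod_right h3.integrable.integral_prod_right ?_
  filter_upwards [hW.ae_slice hpast, h4.ae_slice le_rfl, h.run.contextLaw.ae_norm_le]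
    with x hwx h4x hx
  rw [h.integral_mul_lossEst ht a x hwx]
  have hR := (h.isResampling ht a).fst_meas
  have hθ := h.param_bdd ht a
  have hbias : BddMeas (ℱ (t - 1)) P fun ω => x.ofLp ⬝ᵥ
      ((1 - c.δ • armMoment D (p.policy c t ω) a) ^ (p.simCount t ω + 1)
        *ᵥ (p.param t ω a).ofLp) :=
    BddMeas.select (F := fun n ω => x.ofLp ⬝ᵥ
      ((1 - c.δ • armMoment D (p.policy c t ω) a) ^ (n + 1) *ᵥ (p.param t ω a).ofLp))
      (fun n => (VecBdd.const _).dotProduct ((hR.pow _).mulVec hθ))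
      (h.simCount_measurable ht) (N := ⌊2 * (c.T * c.β₁)⌋₊ + 1)
      fun ω => Nat.lt_succ_of_le (h.simCount_le ht ω)
  have h5 : BddMeas (ℱ (t - 1)) P fun ω => W (ω, x) * (x.ofLp ⬝ᵥ (p.param t ω a).ofLp
      - x.ofLp ⬝ᵥ ((1 - c.δ • armMoment D (p.policy c t ω) a) ^ (p.simCount t ω + 1)
        *ᵥ (p.param t ω a).ofLp)) :=
    hwx.mul (((VecBdd.const _).dotProduct hθ).sub hbias)
  refine integral_mono_ae h4x.integrable (h5.mono hpast).integrable ?_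
  filter_upwards [h.run.bounded] with ω hω
  have h6 := h.abs_bias_le ht ω a hx (hω t ht a).1
  rw [mul_sub]
  set b := x.ofLp ⬝ᵥ ((1 - c.δ • armMoment D (p.policy c t ω) a) ^ (p.simCount t ω + 1)
        *ᵥ (p.param t ω a).ofLp)
  have h7 := (le_abs_self (W (ω, x) * b)).trans_eq (abs_mul _ _)
  have h8 := mul_le_mul_of_nonneg_left h6 (abs_nonneg (W (ω, x)))
  linarith

/-- The second moment of the loss estimates, averaged against a weight that is known before the
round. -/
theorem integral_prod_mul_lossEst_sq_le (h : IsTunedRun p c P ℱ D 𝒳 CX CΘ CE Cl) {t : ℕ}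
    (ht : t ∈ Finset.Icc 1 c.T) (a : Fin K) {W : Ω × Vec d → ℝ}
    (hW : BddMeas ((ℱ (t - 1)).prod inferInstance) (P.prod D) W) (hW0 : ∀ z, 0 ≤ W z) :
    ∫ z, W z * p.lossEst c t z.1 a z.2 ^ 2 ∂(P.prod D)
      ≤ 4 * Cl ^ 2 * c.δ * ∫ z, W z * p.resForm c D t a z.1 z.2 ∂(P.prod D) := by
  have := h.prob_ctx
  have := h.prob
  have hpast : ℱ (t - 1) ≤ mΩ := ℱ.le _
  have h1 := (hW.mul (h.resForm_bdd ht a)).mono_prod hpast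
  have h2 := (hW.mono_prod hpast).mul ((h.lossEst_bdd ht a).pow 2)
  rw [integral_prod_symm _ h1.integrable, integral_prod_symm _ h2.integrable,
    ← integral_const_mul]
  refine integral_mono_ae h2.integrable.integral_prod_right
    (h1.integrable.integral_prod_right.const_mul _) ?_
  filter_upwards [hW.ae_slice hpast] with x hwx
  exact h.integral_mul_lossEst_sq_le ht a x hwx fun ω => hW0 (ω, x)

/-- The context of a round may be replaced by an independent one. -/
theorem integral_fresh_ctx (h : IsTunedRun p c P ℱ D 𝒳 CX CΘ CE Cl) {t : ℕ}
    (ht : t ∈ Finset.Icc 1 c.T) {W : Ω × Vec d → ℝ}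
    (hW : BddMeas ((ℱ (t - 1)).prod inferInstance) (P.prod D) W) :
    ∫ ω, W (ω, p.ctx t ω) ∂P = ∫ z, W z ∂(P.prod D) := by
  have := h.prob_ctx
  have := h.prob
  have hpast : ℱ (t - 1) ≤ mΩ := ℱ.le _
  rw [integral_fresh hpast (h.ctx_measurable ht) (h.run.protocol.ctx_indep t ht)
    (h.run.protocol.ctx_law t ht) hW.1 (hW.ae_ae_le hpast),
    integral_prod_symm _ (hW.mono_prod hpast).integrable]

end IsTunedRun

end LinBandit

namespace LinBandit

/-! ### The regret against a fixed comparator -/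

open Matrix

namespace IsTunedRun

variable {Ω : Type u} {K d : ℕ} {mΩ : MeasurableSpace Ω} {p : Trial Ω K d} {c : Tuning}
    {P : Measure Ω} {ℱ : Filtration ℕ mΩ} {D : Measure (Vec d)} {𝒳 : Set (Vec d)}
    {CX CΘ CE Cl : ℝ}

theorem quadForm_bdd (h : IsTunedRun p c P ℱ D 𝒳 CX CΘ CE Cl) (A : Matrix (Fin d) (Fin d) ℝ) :
    BddMeas inferInstance D fun x : Vec d => x.ofLp ⬝ᵥ (A *ᵥ x.ofLp) :=
  VecBdd.dotProduct (fun i => h.run.contextLaw.coord_bdd i)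
    ((MatBdd.const A).mulVec fun i => h.run.contextLaw.coord_bdd i)

theorem resForm_bdd_right (h : IsTunedRun p c P ℱ D 𝒳 CX CΘ CE Cl) (t : ℕ) (a : Fin K) (ω : Ω) :
    BddMeas inferInstance D (p.resForm c D t a ω) :=
  .sum _ fun _ => h.quadForm_bdd _

theorem integral_policy_mul_resForm_le (h : IsTunedRun p c P ℱ D 𝒳 CX CΘ CE Cl) {t : ℕ}
    (ht : t ∈ Finset.Icc 1 c.T) (ω : Ω) (a : Fin K) :
    c.δ * (2 - c.δ * CX ^ 2) * ∫ x, p.policy c t ω x a * p.resForm c D t a ω x ∂D ≤ d := by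
  have := h.prob_ctx
  have hM := h.isMoments ht ω
  have hpol : BddMeas inferInstance D fun x => p.policy c t ω x a :=
    ⟨hM.pol.meas a, 1, Filter.Eventually.of_forall fun x => by
      rw [abs_of_nonneg (hM.pol.nonneg x a)]; exact hM.pol.le_one x a⟩
  refine le_of_eq_of_le ?_ (hM.sum_trace_le (a := a) (p.simCount t ω + 1))
  congr 1
  simp only [Trial.resForm, Finset.mul_sum]
  rw [integral_finsetSum _ fun k _ => (hpol.mul (h.quadForm_bdd _)).integrable]
  refine Finset.sum_congr rfl fun k _ => ?_
  have hb := h.quadForm_bdd ((quadMap (resMoment D (p.policy c t ω) c.δ a))^[k] 1)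
  obtain ⟨C, hC⟩ := hb.2
  rw [hM.pol.integral_roundLaw (φ := fun w => armInd a w.2 * (w.1.ofLp ⬝ᵥ
      ((quadMap (resMoment D (p.policy c t ω) c.δ a))^[k] 1 *ᵥ w.1.ofLp)))
    ((measurable_armInd a).mul (hb.1.comp measurable_fst)) ⟨C, ?_⟩]
  · refine integral_congr_ae (Filter.Eventually.of_forall fun x => ?_)
    simp [armInd]
  · filter_upwards [hC] with x hx b
    rw [abs_mul, abs_of_nonneg (armInd_nonneg _ _)]
    exact (mul_le_of_le_one_left (abs_nonneg _) (armInd_le_one _ _)).trans hx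

/-- The variance of the loss estimates under `q`: on the event that the policy follows `q` it is
controlled by a trace, and the remaining share `γ` by the smallest eigenvalue of the second
moments, which is itself of order `γ`. -/
theorem sum_integral_q_mul_resForm_le (h : IsTunedRun p c P ℱ D 𝒳 CX CΘ CE Cl) {t : ℕ}
    (ht : t ∈ Finset.Icc 1 c.T) (ω : Ω) :
    c.δ * (2 - c.δ * CX ^ 2) * ∫ x, ∑ a, p.q t ω x a * p.resForm c D t a ω x ∂D
      ≤ K * d + K * CX ^ 2 / c.lam := by
  have := h.prob_ctx
  have hM := h.isMoments ht ω
  have hK : (0 : ℝ) < K := by exact_mod_cast h.K_pos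
  have hlam := h.lam_pos
  have hγ := h.explore_mem ht ω
  set κ := c.δ * (2 - c.δ * CX ^ 2) with hκdef
  have hκ : 0 < κ := mul_pos h.δ_pos (by linarith [h.step])
  have hpol : ∀ a, BddMeas inferInstance D fun x => p.policy c t ω x a := fun a =>
    ⟨hM.pol.meas a, 1, Filter.Eventually.of_forall fun x => by
      rw [abs_of_nonneg (hM.pol.nonneg x a)]; exact hM.pol.le_one x a⟩
  have hq : ∀ a, BddMeas inferInstance D fun x => p.q t ω x a := fun a =>
    ⟨(h.meas_q ht a).comp (@measurable_prodMk_left _ _ (ℱ (t - 1)) _ ω), 1,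
      Filter.Eventually.of_forall fun x => by
        rw [abs_of_nonneg ((h.q_mem ht ω x).1 a)]; exact h.q_le_one ht _ _ a⟩
  have hG := h.resForm_bdd_right t (ω := ω)
  have hpt : ∀ a (x : Vec d), ‖x‖ ≤ CX →
      κ * (p.explore c t ω * p.resForm c D t a ω x) ≤ K * CX ^ 2 / c.lam := by
    intro a x hx
    have h1 := hM.sum_iterate_le (a := a) (η := κ * (p.explore c t ω / K * c.lam)) (fun y => by
      have := mul_le_mul_of_nonneg_left (h.armMoment_ge ht ω a y) hκ.le
      rwa [← mul_assoc] at this) (p.simCount t ω + 1) x.ofLp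
    rw [← norm_sq_eq_dotProduct] at h1
    have h2 : ‖x‖ ^ 2 ≤ CX ^ 2 := pow_le_pow_left₀ (norm_nonneg _) hx 2
    rw [le_div_iff₀ hlam]
    have e : κ * (p.explore c t ω * p.resForm c D t a ω x) * c.lam
        = K * (κ * (p.explore c t ω / K * c.lam) * p.resForm c D t a ω x) := by
      field_simp
    rw [e]
    exact mul_le_mul_of_nonneg_left (h1.trans h2) hK.le
  have hπG : ∀ a, BddMeas inferInstance D fun x =>
      p.policy c t ω x a * p.resForm c D t a ω x := fun a => (hpol a).mul (hG a)
  calc κ * ∫ x, ∑ a, p.q t ω x a * p.resForm c D t a ω x ∂D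
      = ∫ x, κ * ∑ a, p.q t ω x a * p.resForm c D t a ω x ∂D := (integral_const_mul _ _).symm
    _ ≤ ∫ x, (κ * ∑ a, p.policy c t ω x a * p.resForm c D t a ω x + K * CX ^ 2 / c.lam) ∂D := by
        refine integral_mono_ae ((BddMeas.const κ).mul (.sum _ fun a =>
          (hq a).mul (hG a))).integrable (((BddMeas.const κ).mul (.sum _ hπG)).add
            (.const _)).integrable ?_
        filter_upwards [h.run.contextLaw.ae_norm_le] with x hx
        have h1 : ∀ a, κ * (p.q t ω x a * p.resForm c D t a ω x)
            ≤ κ * (p.policy c t ω x a * p.resForm c D t a ω x)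
              + p.q t ω x a * (K * CX ^ 2 / c.lam) := by
          intro a
          have h2 := mul_le_mul_of_nonneg_right (h.q_le ht ω x a) (h.resForm_nonneg ht a ω x)
          have h3 := mul_le_mul_of_nonneg_left h2 hκ.le
          have h4 := mul_le_mul_of_nonneg_left (hpt a x hx) ((h.q_mem ht ω x).1 a)
          linarith
        have h2 := Finset.sum_le_sum fun a (_ : a ∈ Finset.univ) => h1 a
        rw [Finset.sum_add_distrib, ← Finset.sum_mul, (h.q_mem ht ω x).2, one_mul,
          ← Finset.mul_sum, ← Finset.mul_sum] at h2
        exact h2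
    _ = ∑ a, κ * ∫ x, p.policy c t ω x a * p.resForm c D t a ω x ∂D + K * CX ^ 2 / c.lam := by
        rw [integral_add ((BddMeas.const κ).mul (.sum _ hπG)).integrable (integrable_const _),
          integral_const_mul, integral_finsetSum _ fun a _ => (hπG a).integrable, Finset.mul_sum]
        simp
    _ ≤ ∑ _a : Fin K, (d : ℝ) + K * CX ^ 2 / c.lam :=
        add_le_add (Finset.sum_le_sum fun a _ => h.integral_policy_mul_resForm_le ht ω a) le_rfl
    _ = _ := by simp

theorem comparator_bdd (h : IsTunedRun p c P ℱ D 𝒳 CX CΘ CE Cl) {ρ : Vec d → Fin K}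
    (hρ : Measurable ρ) (t : ℕ) (a : Fin K) :
    BddMeas ((ℱ t).prod inferInstance) (P.prod D) fun z : Ω × Vec d => armInd a (ρ z.2) :=
  have := h.prob_ctx
  have := h.prob
  BddMeas.comp_snd ⟨meas_armInd hρ a, 1, Filter.Eventually.of_forall fun _ => by
    rw [abs_of_nonneg (armInd_nonneg _ _)]; exact armInd_le_one _ _⟩

theorem sum_armInd (b : Fin K) (f : Fin K → ℝ) : ∑ a, armInd a b * f a = f b := by
  simp [armInd]

theorem afterCtx_le (h : IsTunedRun p c P ℱ D 𝒳 CX CΘ CE Cl) {t : ℕ}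
    (ht : t ∈ Finset.Icc 1 c.T) : p.afterCtx ℱ t ≤ mΩ :=
  le_sup_left.trans (h.afterArm_le ht)

theorem policy_ctx_bdd (h : IsTunedRun p c P ℱ D 𝒳 CX CΘ CE Cl) {t : ℕ}
    (ht : t ∈ Finset.Icc 1 c.T) (a : Fin K) :
    BddMeas mΩ P fun ω => p.policy c t ω (p.ctx t ω) a := by
  have hm := (IsRandomPolicy.mono (ℱ.le (t - 1)) (h.randomPolicy ht)).meas a
  have hpair : Measurable fun ω => (ω, p.ctx t ω) := measurable_id.prodMk (h.ctx_measurable ht)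
  have hcomp := hm.comp hpair
  simp only [Function.comp_def] at hcomp
  refine ⟨hcomp, 1, Filter.Eventually.of_forall fun ω => ?_⟩
  have hp := (h.randomPolicy ht).isPolicy ω
  rw [abs_of_nonneg (hp.nonneg _ a)]
  exact hp.le_one _ a

theorem integral_armInd_mul (h : IsTunedRun p c P ℱ D 𝒳 CX CΘ CE Cl) {t : ℕ}
    (ht : t ∈ Finset.Icc 1 c.T) (a : Fin K) {f : Ω → ℝ} (hf : BddMeas (p.afterCtx ℱ t) P f) :
    ∫ ω, armInd a (p.arm t ω) * f ω ∂P = ∫ ω, p.policy c t ω (p.ctx t ω) a * f ω ∂P := by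
  have := h.prob
  have hind : ∀ ω, armInd a (p.arm t ω)
      = ({ω | p.arm t ω = a}.indicator fun _ => (1 : ℝ)) ω := fun ω => by
    by_cases hω : p.arm t ω = a <;> simp [armInd, hω]
  have harm : MeasurableSet {ω | p.arm t ω = a} :=
    (((h.run.protocol.meas_arm t ht).mono (ℱ.le t) le_rfl)) (measurableSet_singleton a)
  simp only [hind, mul_comm _ (f _)]
  exact integral_mul_of_condExp (h.afterCtx_le ht) hf
    (BddMeas.indicator (μ := P) harm).integrable (h.run.protocol.arm_law t ht a)

/-- The expected excess loss of a round as an average over an independent context. -/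
theorem integral_excess (h : IsTunedRun p c P ℱ D 𝒳 CX CΘ CE Cl) {ρ : Vec d → Fin K}
    (hρ : Measurable ρ) {t : ℕ} (ht : t ∈ Finset.Icc 1 c.T) :
    ∫ ω, (p.loss t ω (p.arm t ω) (p.ctx t ω) - p.loss t ω (ρ (p.ctx t ω)) (p.ctx t ω)) ∂P
      = ∑ a, ∫ z, (p.policy c t z.1 z.2 a - armInd a (ρ z.2))
          * (z.2.ofLp ⬝ᵥ (p.param t z.1 a).ofLp) ∂(P.prod D) := by
  have := h.prob_ctx
  have := h.prob
  have hpast : ℱ (t - 1) ≤ mΩ := ℱ.le _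
  have hctxm : Measurable[p.afterCtx ℱ t] (p.ctx t) :=
    (comap_measurable _).mono le_sup_right le_rfl
  have hac : p.afterCtx ℱ t ≤ p.afterArm ℱ t := le_sup_left
  have hcm := h.afterCtx_le ht
  have hρb : ∀ a, BddMeas (p.afterCtx ℱ t) P fun ω => armInd a (ρ (p.ctx t ω)) := fun a =>
    ⟨meas_armInd (hρ.comp hctxm) a, 1, Filter.Eventually.of_forall fun _ => by
      rw [abs_of_nonneg (armInd_nonneg _ _)]; exact armInd_le_one _ _⟩
  have hm : ∀ a, BddMeas (p.afterCtx ℱ t) P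
      fun ω => (p.ctx t ω).ofLp ⬝ᵥ (p.param t ω a).ofLp := fun a => by
    refine VecBdd.dotProduct (fun i => ⟨meas_coord hctxm i, CX, ?_⟩)
      ((h.param_bdd ht a).mono le_sup_left)
    filter_upwards [h.ae_norm_ctx_le ht] with ω hω using (abs_coord_le _ i).trans hω
  have hdiff : ∀ a, BddMeas (p.afterArm ℱ t) P
      fun ω => armInd a (p.arm t ω) - armInd a (ρ (p.ctx t ω)) := fun a =>
    (armInd_bdd_afterArm a).sub ((hρb a).mono hac)
  have hA := fun a => ((hdiff a).mul ((hm a).mono hac)).mono (h.afterArm_le ht)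
  have hN := fun a => ((hdiff a).mono (h.afterArm_le ht)).mul (h.noise_bdd ht a)
  have e : ∀ ω, p.loss t ω (p.arm t ω) (p.ctx t ω) - p.loss t ω (ρ (p.ctx t ω)) (p.ctx t ω)
      = ∑ a, ((armInd a (p.arm t ω) - armInd a (ρ (p.ctx t ω)))
          * ((p.ctx t ω).ofLp ⬝ᵥ (p.param t ω a).ofLp)
        + (armInd a (p.arm t ω) - armInd a (ρ (p.ctx t ω))) * p.noise t ω a) := by
    intro ω
    have hl : ∀ b, p.loss t ω b (p.ctx t ω) = ∑ a, armInd a b *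
        ((p.ctx t ω).ofLp ⬝ᵥ (p.param t ω a).ofLp + p.noise t ω a) := fun b => by
      rw [sum_armInd b fun a => (p.ctx t ω).ofLp ⬝ᵥ (p.param t ω a).ofLp + p.noise t ω a,
        Trial.loss, inner_eq_dotProduct]
    rw [hl, hl, ← Finset.sum_sub_distrib]
    exact Finset.sum_congr rfl fun a _ => by ring
  simp only [e]
  rw [integral_finsetSum _ fun a _ => ((hA a).add (hN a)).integrable]
  refine Finset.sum_congr rfl fun a _ => ?_
  rw [integral_add (hA a).integrable (hN a).integrable, h.integral_mul_noise ht a (hdiff a),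
    add_zero]
  have hW : BddMeas ((ℱ (t - 1)).prod inferInstance) (P.prod D) fun z =>
      (p.policy c t z.1 z.2 a - armInd a (ρ z.2)) * (z.2.ofLp ⬝ᵥ (p.param t z.1 a).ofLp) :=
    ((h.policy_bdd ht a).sub (h.comparator_bdd hρ _ a)).mul (h.dotProduct_param_bdd ht a)
  rw [← h.integral_fresh_ctx ht hW]
  have hpolX := h.policy_ctx_bdd ht a
  have hm' := (hm a).mono hcm
  have hρ' := (hρb a).mono hcm
  simp only [sub_mul]
  rw [integral_sub (((armInd_bdd_afterArm a).mono (h.afterArm_le ht)).mul hm').integrable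
    (hρ'.mul hm').integrable, integral_sub (hpolX.mul hm').integrable (hρ'.mul hm').integrable]
  congr 1
  exact h.integral_armInd_mul ht a (hm a)

end IsTunedRun

end LinBandit

namespace LinBandit

/-! ### The expected regret bound -/

open Matrix

theorem sum_abs_sub_le_two {K : ℕ} {q u : Fin K → ℝ} (hq : q ∈ stdSimplex ℝ (Fin K))
    (hu : u ∈ stdSimplex ℝ (Fin K)) : ∑ a, |q a - u a| ≤ 2 := by
  calc ∑ a, |q a - u a| ≤ ∑ a, (q a + u a) := Finset.sum_le_sum fun a _ =>
        abs_le.2 ⟨by linarith [hq.1 a, hu.1 a], by linarith [hq.1 a, hu.1 a]⟩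
    _ = 2 := by rw [Finset.sum_add_distrib, hq.2, hu.2]; norm_num

theorem armInd_mem_stdSimplex {K : ℕ} (b : Fin K) :
    (fun a => armInd a b) ∈ stdSimplex ℝ (Fin K) :=
  ⟨fun a => armInd_nonneg a b, by simp [armInd]⟩

namespace IsTunedRun

variable {Ω : Type u} {K d : ℕ} {mΩ : MeasurableSpace Ω} {p : Trial Ω K d} {c : Tuning}
    {P : Measure Ω} {ℱ : Filtration ℕ mΩ} {D : Measure (Vec d)} {𝒳 : Set (Vec d)}
    {CX CΘ CE Cl : ℝ}

/-- The exploration rate and the bias bound together, per round. -/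
theorem explore_add_biasBound_le (h : IsTunedRun p c P ℱ D 𝒳 CX CΘ CE Cl) {t : ℕ}
    (ht : t ∈ Finset.Icc 1 c.T) (ω : Ω) :
    p.explore c t ω + p.biasBound c CX t ω
      ≤ (K * Real.log c.T / (c.δ * c.lam) + 1 / (1 - max 0 (c.δ * CX ^ 2 - 1))) / c.β₁ * (1 / √t)
        + Real.exp 1 / c.T := by
  have h1 := h.explore_le ht ω
  have h2 := h.one_div_rate_le ht ω
  have h3 := h.one_sub_max_pos
  have hδ := h.δ_pos
  have hlam := h.lam_pos
  have hβ := h.β₁_pos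
  set r := 1 - max 0 (c.δ * CX ^ 2 - 1)
  have e1 : K * Real.log c.T / (2 * c.δ * c.lam * c.β₁) * (1 / √t)
      = K * Real.log c.T / (c.δ * c.lam) / c.β₁ * (1 / √t) / 2 := by
    field_simp
  have e2 : 1 / (r * p.rate t ω) = 1 / r * (1 / p.rate t ω) := (one_div_mul_one_div _ _).symm
  have h4 : 1 / r * (1 / p.rate t ω) ≤ 1 / r * (1 / c.β₁ * (1 / √t)) :=
    mul_le_mul_of_nonneg_left h2 (by positivity)
  have e3 : 1 / r * (1 / c.β₁ * (1 / √t)) = 1 / r / c.β₁ * (1 / √t) := by ring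
  have e4 : p.biasBound c CX t ω
      = p.explore c t ω + Real.exp 1 / c.T + 1 / (r * p.rate t ω) := rfl
  rw [e4, e2, add_div, add_mul]
  linarith

/-- The excess loss of a round in terms of the loss estimates. -/
theorem integral_excess_le (h : IsTunedRun p c P ℱ D 𝒳 CX CΘ CE Cl) {ρ : Vec d → Fin K}
    (hρ : Measurable ρ) {t : ℕ} (ht : t ∈ Finset.Icc 1 c.T) :
    ∫ ω, (p.loss t ω (p.arm t ω) (p.ctx t ω) - p.loss t ω (ρ (p.ctx t ω)) (p.ctx t ω)) ∂P
      ≤ ∫ z, ∑ a, (p.q t z.1 z.2 a - armInd a (ρ z.2)) * p.lossEst c t z.1 a z.2 ∂(P.prod D)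
        + 2 * CX * CΘ * ((K * Real.log c.T / (c.δ * c.lam)
          + 1 / (1 - max 0 (c.δ * CX ^ 2 - 1))) / c.β₁ * (1 / √t) + Real.exp 1 / c.T) := by
  have := h.prob_ctx
  have := h.prob
  have hpast : ℱ (t - 1) ≤ mΩ := ℱ.le _
  have hCC : 0 ≤ CX * CΘ := mul_nonneg h.CX_pos.le h.CΘ_pos.le
  set B := (K * Real.log c.T / (c.δ * c.lam)
          + 1 / (1 - max 0 (c.δ * CX ^ 2 - 1))) / c.β₁ * (1 / √t) + Real.exp 1 / c.T with hB
  have hu := fun a => h.comparator_bdd hρ (t - 1) a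
  have hqu := fun a => (h.q_bdd ht a).sub (hu a)
  have hm := h.dotProduct_param_bdd ht
  have h1 := fun a => (((h.policy_bdd ht a).sub (hu a)).mul (hm a)).mono_prod hpast
  have h2 := fun a => ((hqu a).mul (hm a)).mono_prod hpast
  have h3 := fun a => ((hqu a).abs.mul (h.biasBound_bdd ht).comp_fst).mono_prod hpast
  have h4 := fun a => ((hqu a).mono_prod hpast).mul (h.lossEst_bdd ht a)
  rw [h.integral_excess hρ ht, ← integral_finsetSum _ fun a _ => (h1 a).integrable]
  have hbias := Finset.sum_le_sum fun a (_ : a ∈ Finset.univ) =>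
    h.integral_mul_lossEst_ge ht a (hqu a)
  rw [Finset.sum_sub_distrib, ← Finset.mul_sum, ← integral_finsetSum _ fun a _ => (h2 a).integrable,
    ← integral_finsetSum _ fun a _ => (h3 a).integrable,
    ← integral_finsetSum _ fun a _ => (h4 a).integrable] at hbias
  have hs2 := BddMeas.sum Finset.univ h2
  have hs3 := BddMeas.sum Finset.univ h3
  have hpt : ∫ z, ∑ a, (p.policy c t z.1 z.2 a - armInd a (ρ z.2))
        * (z.2.ofLp ⬝ᵥ (p.param t z.1 a).ofLp) ∂(P.prod D)
      ≤ ∫ z, ((∑ a, (p.q t z.1 z.2 a - armInd a (ρ z.2)) * (z.2.ofLp ⬝ᵥ (p.param t z.1 a).ofLp)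
          - CX * CΘ * ∑ a, |p.q t z.1 z.2 a - armInd a (ρ z.2)| * p.biasBound c CX t z.1)
          + 2 * CX * CΘ * B) ∂(P.prod D) := by
    refine integral_mono_ae (BddMeas.sum Finset.univ h1).integrable
      ((hs2.sub ((BddMeas.const _).mul hs3)).add (.const _)).integrable ?_
    have hparP : ∀ᵐ ω ∂P, ∀ a, ‖p.param t ω a‖ ≤ CΘ := by
      filter_upwards [h.run.bounded] with ω hω a using (hω t ht a).1
    have hpar : ∀ᵐ z ∂(P.prod D), ∀ a, ‖p.param t z.1 a‖ ≤ CΘ :=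
      Measure.quasiMeasurePreserving_fst.ae hparP
    filter_upwards [h.ae_prod_norm_le, hpar] with z hx hθ
    have hγ := h.explore_mem ht z.1
    have hqm := h.q_mem ht z.1 z.2
    have hK : (0 : ℝ) < K := by exact_mod_cast h.K_pos
    have hmb : ∀ a, |z.2.ofLp ⬝ᵥ (p.param t z.1 a).ofLp| ≤ CX * CΘ := fun a => by
      rw [← inner_eq_dotProduct]
      exact (abs_real_inner_le_norm _ _).trans
        (mul_le_mul hx (hθ a) (norm_nonneg _) h.CX_pos.le)
    -- mixing in the uniform distribution moves the policy by at most `2 γ` in `ℓ¹`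
    have hmix : ∑ a, (p.policy c t z.1 z.2 a - armInd a (ρ z.2))
          * (z.2.ofLp ⬝ᵥ (p.param t z.1 a).ofLp)
        ≤ ∑ a, (p.q t z.1 z.2 a - armInd a (ρ z.2)) * (z.2.ofLp ⬝ᵥ (p.param t z.1 a).ofLp)
          + 2 * (CX * CΘ) * p.explore c t z.1 := by
      have hunif : (fun _ : Fin K => 1 / (K : ℝ)) ∈ stdSimplex ℝ (Fin K) :=
        ⟨fun _ => by positivity, by simp [hK.ne']⟩
      have h5 := sum_abs_sub_le_two hunif hqm
      have h6 : ∀ a, (p.policy c t z.1 z.2 a - armInd a (ρ z.2))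
            * (z.2.ofLp ⬝ᵥ (p.param t z.1 a).ofLp)
          ≤ (p.q t z.1 z.2 a - armInd a (ρ z.2)) * (z.2.ofLp ⬝ᵥ (p.param t z.1 a).ofLp)
            + |1 / (K : ℝ) - p.q t z.1 z.2 a| * (p.explore c t z.1 * (CX * CΘ)) := by
        intro a
        set m := z.2.ofLp ⬝ᵥ (p.param t z.1 a).ofLp
        have e : (p.policy c t z.1 z.2 a - armInd a (ρ z.2)) * m
            = (p.q t z.1 z.2 a - armInd a (ρ z.2)) * m
              + p.explore c t z.1 * ((1 / (K : ℝ) - p.q t z.1 z.2 a) * m) := by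
          rw [Trial.policy]; ring
        have h7 : (1 / (K : ℝ) - p.q t z.1 z.2 a) * m
            ≤ |1 / (K : ℝ) - p.q t z.1 z.2 a| * (CX * CΘ) := by
          refine (le_abs_self _).trans ?_
          rw [abs_mul]
          exact mul_le_mul_of_nonneg_left (hmb a) (abs_nonneg _)
        have h8 := mul_le_mul_of_nonneg_left h7 hγ.1.le
        rw [e]
        linarith
      have h7 := Finset.sum_le_sum fun a (_ : a ∈ Finset.univ) => h6 a
      rw [Finset.sum_add_distrib, ← Finset.sum_mul] at h7
      have h8 := mul_le_mul_of_nonneg_right h5 (mul_nonneg hγ.1.le hCC)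
      linarith
    have hvar : ∑ a, |p.q t z.1 z.2 a - armInd a (ρ z.2)| * p.biasBound c CX t z.1
        ≤ 2 * p.biasBound c CX t z.1 := by
      rw [← Finset.sum_mul]
      exact mul_le_mul_of_nonneg_right (sum_abs_sub_le_two hqm (armInd_mem_stdSimplex _))
        (h.biasBound_nonneg ht z.1)
    have h9 := mul_le_mul_of_nonneg_left hvar hCC
    have h10 := mul_le_mul_of_nonneg_left (h.explore_add_biasBound_le ht z.1) hCC
    rw [← hB] at h10
    linarith
  rw [integral_add (hs2.sub ((BddMeas.const _).mul hs3)).integrable (integrable_const _),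
    integral_sub hs2.integrable ((BddMeas.const _).mul hs3).integrable, integral_const_mul] at hpt
  simp only [integral_const, probReal_univ, smul_eq_mul, one_mul] at hpt
  linarith

/-- The stability term of a round. -/
theorem integral_stability_le (h : IsTunedRun p c P ℱ D 𝒳 CX CΘ CE Cl) {t : ℕ}
    (ht : t ∈ Finset.Icc 1 c.T) :
    ∫ z, (∑ a, p.q t z.1 z.2 a * p.lossEst c t z.1 a z.2 ^ 2) / p.rate t z.1 ∂(P.prod D)
      ≤ 4 * Cl ^ 2 / (2 - c.δ * CX ^ 2) * (K * d + K * CX ^ 2 / c.lam) / c.β₁ * (1 / √t) := by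
  have := h.prob_ctx
  have := h.prob
  have ht' := Finset.mem_Icc.1 ht
  have hpast : ℱ (t - 1) ≤ mΩ := ℱ.le _
  have hδ := h.δ_pos
  have hκ : 0 < 2 - c.δ * CX ^ 2 := by linarith [h.step]
  have hβ := h.β₁_pos
  have hw := fun a => (h.q_bdd ht a).mul (h.one_div_rate_bdd ht).comp_fst
  have hw0 : ∀ a (z : Ω × Vec d), 0 ≤ p.q t z.1 z.2 a * (1 / p.rate t z.1) := fun a z =>
    mul_nonneg ((h.q_mem ht _ _).1 a) (one_div_pos.2 (h.rate_pos ht'.1 (by omega) _)).le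
  have hl := fun a => ((hw a).mono_prod hpast).mul ((h.lossEst_bdd ht a).pow 2)
  have hG := fun a => (hw a).mul (h.resForm_bdd ht a)
  have hqG := fun a => ((h.q_bdd ht a).mul (h.resForm_bdd ht a)).mono_prod hpast
  have e : ∀ z : Ω × Vec d,
      (∑ a, p.q t z.1 z.2 a * p.lossEst c t z.1 a z.2 ^ 2) / p.rate t z.1
        = ∑ a, p.q t z.1 z.2 a * (1 / p.rate t z.1) * p.lossEst c t z.1 a z.2 ^ 2 := by
    intro z
    rw [Finset.sum_div]
    exact Finset.sum_congr rfl fun a _ => by ring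
  have hint : ∫ z, ∑ a, p.q t z.1 z.2 a * p.resForm c D t a z.1 z.2 ∂(P.prod D)
      ≤ (K * d + K * CX ^ 2 / c.lam) / (c.δ * (2 - c.δ * CX ^ 2)) := by
    have hs := BddMeas.sum Finset.univ hqG
    rw [integral_prod _ hs.integrable]
    have h1 : ∀ ω, ∫ x, ∑ a, p.q t ω x a * p.resForm c D t a ω x ∂D
        ≤ (K * d + K * CX ^ 2 / c.lam) / (c.δ * (2 - c.δ * CX ^ 2)) := fun ω => by
      rw [le_div_iff₀' (mul_pos hδ hκ)]
      exact h.sum_integral_q_mul_resForm_le ht ω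
    calc _ ≤ ∫ _, (K * d + K * CX ^ 2 / c.lam) / (c.δ * (2 - c.δ * CX ^ 2)) ∂P :=
          integral_mono hs.integrable.integral_prod_left (integrable_const _) h1
      _ = _ := by simp
  simp only [e]
  rw [integral_finsetSum _ fun a _ => (hl a).integrable]
  calc ∑ a, ∫ z, p.q t z.1 z.2 a * (1 / p.rate t z.1) * p.lossEst c t z.1 a z.2 ^ 2 ∂(P.prod D)
      ≤ ∑ a, 4 * Cl ^ 2 * c.δ * ∫ z, p.q t z.1 z.2 a * (1 / p.rate t z.1)
          * p.resForm c D t a z.1 z.2 ∂(P.prod D) :=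
        Finset.sum_le_sum fun a _ => h.integral_prod_mul_lossEst_sq_le ht a (hw a) (hw0 a)
    _ = 4 * Cl ^ 2 * c.δ * ∫ z, ∑ a, p.q t z.1 z.2 a * (1 / p.rate t z.1)
          * p.resForm c D t a z.1 z.2 ∂(P.prod D) := by
        rw [← Finset.mul_sum,
          integral_finsetSum _ fun a _ => ((hG a).mono_prod hpast).integrable]
    _ ≤ 4 * Cl ^ 2 * c.δ * ∫ z, 1 / c.β₁ * (1 / √t) * ∑ a, p.q t z.1 z.2 a
          * p.resForm c D t a z.1 z.2 ∂(P.prod D) := by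
        refine mul_le_mul_of_nonneg_left ?_ (by positivity)
        refine integral_mono
          (BddMeas.sum Finset.univ fun a => (hG a).mono_prod hpast).integrable
          ((BddMeas.const _).mul (.sum Finset.univ hqG)).integrable fun z => ?_
        simp only [Finset.mul_sum]
        refine Finset.sum_le_sum fun a _ => ?_
        have h1 := mul_le_mul_of_nonneg_right (h.one_div_rate_le ht z.1)
          (mul_nonneg ((h.q_mem ht z.1 z.2).1 a) (h.resForm_nonneg ht a z.1 z.2))
        linarith
    _ ≤ 4 * Cl ^ 2 * c.δ * (1 / c.β₁ * (1 / √t) *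
          ((K * d + K * CX ^ 2 / c.lam) / (c.δ * (2 - c.δ * CX ^ 2)))) := by
        rw [integral_const_mul]
        gcongr
    _ = _ := by field_simp

/-- The penalty term: after exchanging the independent context for the one observed in the round,
the entropies are those that drive the rates. -/
theorem integral_penalty_le (h : IsTunedRun p c P ℱ D 𝒳 CX CΘ CE Cl) :
    ∫ z, ∑ t ∈ Finset.Ico 1 c.T, (p.rate (t + 1) z.1 - p.rate t z.1)
        * entropy (p.q (t + 1) z.1 z.2) ∂(P.prod D) ≤ Real.log K * (2 * c.β₁ * √c.T) := by
  have := h.prob_ctx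
  have := h.prob
  have hW : ∀ t ∈ Finset.Ico 1 c.T, BddMeas ((ℱ (t + 1 - 1)).prod inferInstance) (P.prod D)
      fun z => (p.rate (t + 1) z.1 - p.rate t z.1) * entropy (p.q (t + 1) z.1 z.2) := by
    intro t ht
    rw [Finset.mem_Ico] at ht
    exact ((h.rate_bdd (by omega) (by omega)).sub
      ((h.rate_bdd ht.1 (by omega)).mono (ℱ.mono (by omega)))).comp_fst.mul
        (h.entropy_bdd (Finset.mem_Icc.2 ⟨by omega, by omega⟩))
  have hX : ∀ t ∈ Finset.Ico 1 c.T, Integrable (fun ω => (p.rate (t + 1) ω - p.rate t ω)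
      * entropy (p.q (t + 1) ω (p.ctx (t + 1) ω))) P := by
    intro t ht
    have ht1 : t + 1 ∈ Finset.Icc 1 c.T := by
      rw [Finset.mem_Ico] at ht; exact Finset.mem_Icc.2 ⟨by omega, by omega⟩
    have hpair : Measurable fun ω => (ω, p.ctx (t + 1) ω) :=
      measurable_id.prodMk (h.ctx_measurable ht1)
    have hent := ((h.entropy_bdd (D := D) ht1).mono_prod (ℱ.le _)).1.comp hpair
    simp only [Function.comp_def] at hent
    have hentb : BddMeas mΩ P fun ω => entropy (p.q (t + 1) ω (p.ctx (t + 1) ω)) := by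
      refine ⟨hent, Real.log K, Filter.Eventually.of_forall fun ω => ?_⟩
      rw [abs_of_nonneg (entropy_nonneg (h.q_mem ht1 _ _))]
      exact entropy_le h.K_pos (h.q_mem ht1 _ _)
    rw [Finset.mem_Ico] at ht
    exact ((((h.rate_bdd (by omega) (by omega)).mono (ℱ.le _)).sub
      ((h.rate_bdd ht.1 (by omega)).mono (ℱ.le _))).mul hentb).integrable
  rw [integral_finsetSum _ fun t ht => ((hW t ht).mono_prod (ℱ.le _)).integrable]
  calc _ = ∑ t ∈ Finset.Ico 1 c.T, ∫ ω, (p.rate (t + 1) ω - p.rate t ω)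
          * entropy (p.q (t + 1) ω (p.ctx (t + 1) ω)) ∂P := by
        refine Finset.sum_congr rfl fun t ht => ?_
        have ht1 : t + 1 ∈ Finset.Icc 1 c.T := by
          rw [Finset.mem_Ico] at ht; exact Finset.mem_Icc.2 ⟨by omega, by omega⟩
        exact (h.integral_fresh_ctx ht1 (hW t ht)).symm
    _ = ∫ ω, ∑ t ∈ Finset.Ico 1 c.T, (p.rate (t + 1) ω - p.rate t ω)
          * entropy (p.q (t + 1) ω (p.ctx (t + 1) ω)) ∂P := (integral_finsetSum _ hX).symm
    _ ≤ ∫ _, Real.log K * (2 * c.β₁ * √c.T) ∂P := by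
        refine integral_mono (integrable_finsetSum _ hX) (integrable_const _) fun ω => ?_
        have hlog := h.log_K_pos
        have h1 := sum_rate_diff_le (β := fun t => p.rate t ω)
          (h := fun s => (Real.log K)⁻¹ * entropy (p.q s ω (p.ctx s ω))) h.β₁_pos
          (h.normEntropy_le_one ω) (h.normEntropy_nonneg ω) (h.rate_rec ω)
        have h2 := mul_le_mul_of_nonneg_left h1 hlog.le
        refine le_of_eq_of_le ?_ h2
        rw [Finset.mul_sum]
        exact Finset.sum_congr rfl fun t _ => by field_simp
    _ = _ := by simp

theorem regretAgainst_le (h : IsTunedRun p c P ℱ D 𝒳 CX CΘ CE Cl) {ρ : Vec d → Fin K}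
    (hρ : Measurable ρ) :
    p.regretAgainst P c.T ρ ≤ c.β₁ * Real.log K + Real.log K * (2 * c.β₁ * √c.T)
      + (Real.exp CX * (4 * Cl ^ 2 / (2 - c.δ * CX ^ 2) * (K * d + K * CX ^ 2 / c.lam)) + CX
        + 2 * CX * CΘ * (K * Real.log c.T / (c.δ * c.lam)
          + 1 / (1 - max 0 (c.δ * CX ^ 2 - 1)))) / c.β₁ * (2 * √c.T)
      + 2 * CX * CΘ * Real.exp 1 := by
  have := h.prob_ctx
  have := h.prob
  have hβ := h.β₁_pos
  have hCX := h.CX_pos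
  have hCΘ := h.CΘ_pos
  have hκ : 0 < 2 - c.δ * CX ^ 2 := by linarith [h.step]
  have hlam := h.lam_pos
  have hT0 : (0 : ℝ) < c.T := by have := h.two_le_T; positivity
  have hr := h.one_sub_max_pos
  have hlogT := h.log_T_pos
  have hδ := h.δ_pos
  set B := K * Real.log c.T / (c.δ * c.lam) + 1 / (1 - max 0 (c.δ * CX ^ 2 - 1)) with hB
  set V := 4 * Cl ^ 2 / (2 - c.δ * CX ^ 2) * (K * d + K * CX ^ 2 / c.lam) with hV
  have hB0 : 0 ≤ B := by positivity
  have hV0 : 0 ≤ V := by positivity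
  have hex : ∀ t ∈ Finset.Icc 1 c.T, Integrable (fun ω =>
      p.loss t ω (p.arm t ω) (p.ctx t ω) - p.loss t ω (ρ (p.ctx t ω)) (p.ctx t ω)) P := by
    intro t ht
    have hl : ∀ {f : Ω → Fin K}, Measurable f →
        BddMeas mΩ P fun ω => p.loss t ω (f ω) (p.ctx t ω) := by
      intro f hf
      have e : ∀ ω, p.loss t ω (f ω) (p.ctx t ω)
          = ∑ a, armInd a (f ω) * p.loss t ω a (p.ctx t ω) := fun ω =>
        (sum_armInd (f ω) fun a => p.loss t ω a (p.ctx t ω)).symm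
      simp only [e]
      refine .sum _ fun a => ⟨(meas_armInd hf a).mul (h.meas_loss ht (ℱ.le _)
        (h.ctx_measurable ht) ((h.run.protocol.meas_noise t ht).mono (ℱ.le t) le_rfl) a), Cl, ?_⟩
      filter_upwards [h.ae_loss_le ht] with ω hω
      rw [abs_mul, abs_of_nonneg (armInd_nonneg _ _)]
      exact (mul_le_of_le_one_left (abs_nonneg _) (armInd_le_one _ _)).trans (hω a)
    exact ((hl ((h.run.protocol.meas_arm t ht).mono (ℱ.le t) le_rfl)).sub
      (hl (hρ.comp (h.ctx_measurable ht)))).integrable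
  have hql : ∀ t ∈ Finset.Icc 1 c.T, BddMeas (mΩ.prod inferInstance) (P.prod D) fun z =>
      ∑ a, (p.q t z.1 z.2 a - armInd a (ρ z.2)) * p.lossEst c t z.1 a z.2 := fun t ht =>
    .sum _ fun a => (((h.q_bdd ht a).sub (h.comparator_bdd hρ (t - 1) a)).mono_prod
      (ℱ.le _)).mul (h.lossEst_bdd ht a)
  have hstab : ∀ t ∈ Finset.Icc 1 c.T, BddMeas (mΩ.prod inferInstance) (P.prod D) fun z =>
      (∑ a, p.q t z.1 z.2 a * p.lossEst c t z.1 a z.2 ^ 2) / p.rate t z.1 := fun t ht => by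
    have := (BddMeas.sum Finset.univ fun a => ((h.q_bdd ht a).mono_prod (ℱ.le _)).mul
      ((h.lossEst_bdd ht a).pow 2)).mul ((h.one_div_rate_bdd ht).mono (ℱ.le _)).comp_fst
    simpa only [mul_one_div] using this
  have hinv : ∀ t ∈ Finset.Icc 1 c.T, BddMeas (mΩ.prod inferInstance) (P.prod D) fun z =>
      CX / p.rate t z.1 := fun t ht => by
    have := (BddMeas.const CX).mul (((h.one_div_rate_bdd ht).mono (ℱ.le _)).comp_fst (D := D))
    simpa only [mul_one_div] using this
  have hpen : BddMeas (mΩ.prod inferInstance) (P.prod D) fun z =>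
      ∑ t ∈ Finset.Ico 1 c.T, (p.rate (t + 1) z.1 - p.rate t z.1)
        * entropy (p.q (t + 1) z.1 z.2) := .sum_mem _ fun t ht => by
    rw [Finset.mem_Ico] at ht
    exact (((h.rate_bdd (by omega) (by omega)).mono (ℱ.le _)).sub
      ((h.rate_bdd ht.1 (by omega)).mono (ℱ.le _))).comp_fst.mul
        ((h.entropy_bdd (Finset.mem_Icc.2 ⟨by omega, by omega⟩)).mono_prod (ℱ.le _))
  have hst2 : ∀ t ∈ Finset.Icc 1 c.T, BddMeas (mΩ.prod inferInstance) (P.prod D) fun z =>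
      Real.exp CX * ((∑ a, p.q t z.1 z.2 a * p.lossEst c t z.1 a z.2 ^ 2) / p.rate t z.1)
        + CX / p.rate t z.1 := fun t ht => ((BddMeas.const _).mul (hstab t ht)).add (hinv t ht)
  have hftrl : ∫ z, ∑ t ∈ Finset.Icc 1 c.T,
        ∑ a, (p.q t z.1 z.2 a - armInd a (ρ z.2)) * p.lossEst c t z.1 a z.2 ∂(P.prod D)
      ≤ ∫ z, (c.β₁ * Real.log K
        + ∑ t ∈ Finset.Ico 1 c.T, (p.rate (t + 1) z.1 - p.rate t z.1)
          * entropy (p.q (t + 1) z.1 z.2)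
        + ∑ t ∈ Finset.Icc 1 c.T, (Real.exp CX *
            ((∑ a, p.q t z.1 z.2 a * p.lossEst c t z.1 a z.2 ^ 2) / p.rate t z.1)
              + CX / p.rate t z.1)) ∂(P.prod D) := by
    refine integral_mono_ae (BddMeas.sum_mem _ hql).integrable
      (((BddMeas.const _).add hpen).add (.sum_mem _ hst2)).integrable ?_
    have h1 : ∀ᵐ z ∂(P.prod D), ∀ (x : Vec d), ‖x‖ ≤ CX → ∀ u ∈ stdSimplex ℝ (Fin K),
      ∑ t ∈ Finset.Icc 1 c.T, ∑ a, (p.q t z.1 x a - u a) * p.lossEst c t z.1 a x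
      ≤ c.β₁ * Real.log K
        + ∑ t ∈ Finset.Ico 1 c.T, (p.rate (t + 1) z.1 - p.rate t z.1) * entropy (p.q (t + 1) z.1 x)
        + ∑ t ∈ Finset.Icc 1 c.T, (Real.exp CX *
            ((∑ a, p.q t z.1 x a * p.lossEst c t z.1 a x ^ 2) / p.rate t z.1)
              + CX / p.rate t z.1) := Measure.quasiMeasurePreserving_fst.ae h.ae_ftrl_le
    filter_upwards [h1, h.ae_prod_norm_le] with z hz hx
    exact hz z.2 hx _ (armInd_mem_stdSimplex (ρ z.2))
  rw [integral_add ((BddMeas.const _).add hpen).integrable (BddMeas.sum_mem _ hst2).integrable,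
    integral_add (integrable_const _) hpen.integrable,
    integral_finsetSum _ fun t ht => (hst2 t ht).integrable,
    integral_finsetSum _ fun t ht => (hql t ht).integrable] at hftrl
  simp only [integral_const, probReal_univ, smul_eq_mul, one_mul] at hftrl
  have hround : ∀ t ∈ Finset.Icc 1 c.T, ∫ z, (Real.exp CX *
      ((∑ a, p.q t z.1 z.2 a * p.lossEst c t z.1 a z.2 ^ 2) / p.rate t z.1)
        + CX / p.rate t z.1) ∂(P.prod D) ≤ (Real.exp CX * V + CX) / c.β₁ * (1 / √t) := by
    intro t ht
    rw [integral_add ((BddMeas.const _).mul (hstab t ht)).integrable (hinv t ht).integrable,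
      integral_const_mul]
    have h1 := mul_le_mul_of_nonneg_left (h.integral_stability_le ht) (Real.exp_pos CX).le
    have h2 : ∫ z, CX / p.rate t z.1 ∂(P.prod D) ≤ ∫ _, CX * (1 / c.β₁ * (1 / √t)) ∂(P.prod D) :=
      integral_mono (hinv t ht).integrable (integrable_const _) fun z => by
        simp only
        rw [div_eq_mul_one_div]
        exact mul_le_mul_of_nonneg_left (h.one_div_rate_le ht z.1) hCX.le
    simp only [integral_const, probReal_univ, smul_eq_mul, one_mul] at h2
    rw [← hV] at h1
    have e : (Real.exp CX * V + CX) / c.β₁ * (1 / √t)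
        = Real.exp CX * (V / c.β₁ * (1 / √t)) + CX * (1 / c.β₁ * (1 / √t)) := by ring
    rw [e]
    exact add_le_add h1 h2
  have hsum := Finset.sum_le_sum hround
  have hexc := Finset.sum_le_sum fun t ht => h.integral_excess_le hρ (t := t) ht
  rw [Trial.regretAgainst, integral_finsetSum _ hex]
  rw [Finset.sum_add_distrib, ← Finset.mul_sum, Finset.sum_add_distrib, ← Finset.mul_sum,
    ← hB] at hexc
  rw [← Finset.mul_sum] at hsum
  have hconst : ∑ _t ∈ Finset.Icc 1 c.T, Real.exp 1 / (c.T : ℝ) = Real.exp 1 := by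
    rw [Finset.sum_const, Nat.card_Icc, Nat.add_sub_cancel, nsmul_eq_mul]
    field_simp
  rw [hconst] at hexc
  have hS := sum_one_div_sqrt_le c.T
  have hpen' := h.integral_penalty_le
  have h1 : (Real.exp CX * V + CX) / c.β₁ * ∑ t ∈ Finset.Icc 1 c.T, 1 / √(t : ℝ)
      ≤ (Real.exp CX * V + CX) / c.β₁ * (2 * √c.T) :=
    mul_le_mul_of_nonneg_left hS (by positivity)
  have h2 : 2 * CX * CΘ * (B / c.β₁ * ∑ t ∈ Finset.Icc 1 c.T, 1 / √(t : ℝ))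
      ≤ 2 * CX * CΘ * (B / c.β₁ * (2 * √c.T)) :=
    mul_le_mul_of_nonneg_left (mul_le_mul_of_nonneg_left hS (by positivity)) (by positivity)
  have e : (Real.exp CX * V + CX + 2 * CX * CΘ * B) / c.β₁ * (2 * √c.T)
      = (Real.exp CX * V + CX) / c.β₁ * (2 * √c.T)
        + 2 * CX * CΘ * (B / c.β₁ * (2 * √c.T)) := by ring
  rw [e]
  linarith

end IsTunedRun

end LinBandit

namespace LinBandit

/-! ### The form of the bound -/

theorem sqrt_le_div_add_mul {y u v b : ℝ} (hb : 0 < b) (hu : 0 ≤ u) (hv : 0 ≤ v)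
    (h : y / 4 ≤ u * v) : √y ≤ u / b + b * v := by
  rw [Real.sqrt_le_left (by positivity)]
  have e : u / b * (b * v) = u * v := by field_simp
  nlinarith [sq_nonneg (u / b - b * v)]

theorem half_lt_log_two : 1 / 2 < Real.log 2 := by linarith [Real.log_two_gt_d9]

theorem half_le_sqrt_log {K : ℕ} (hK : 2 ≤ K) : 1 / 2 ≤ √(Real.log K) := by
  refine Real.le_sqrt_of_sq_le ?_
  have : Real.log 2 ≤ Real.log K := Real.log_le_log two_pos (by exact_mod_cast hK)
  linarith [half_lt_log_two]

theorem log_mul_natCast {K T : ℕ} (hK : 2 ≤ K) (hT : 2 ≤ T) :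
    Real.log (K * T) = Real.log K + Real.log T :=
  Real.log_mul (by positivity) (by positivity)

theorem one_le_log_mul {K T : ℕ} (hK : 2 ≤ K) (hT : 2 ≤ T) : 1 ≤ Real.log (K * T) := by
  have h1 : Real.log 2 ≤ Real.log K := Real.log_le_log two_pos (by exact_mod_cast hK)
  have h2 : Real.log 2 ≤ Real.log T := Real.log_le_log two_pos (by exact_mod_cast hT)
  rw [log_mul_natCast hK hT]
  linarith [half_lt_log_two]

/-- The factor by which `K log T (log T / (δ λ log K) + d)` dominates the terms of the regret bound
that are inversely proportional to the initial rate. -/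
noncomputable def varConst (CX CΘ Cl : ℝ) : ℝ :=
  2 * (Real.exp CX * (4 * Cl ^ 2 / (2 - stepSize CX Cl * CX ^ 2))
    * (1 + CX ^ 2 * stepSize CX Cl) + CX
    + 2 * CX * CΘ * (1 / (1 - max 0 (stepSize CX Cl * CX ^ 2 - 1)))) + 2 * CX * CΘ

/-- The constant of the regret bound. -/
noncomputable def regretConst (CX CΘ Cl : ℝ) : ℝ :=
  3 + 2 * varConst CX CΘ Cl + 2 * CX * CΘ * Real.exp 1 + 2 * Cl

namespace IsTunedRun

variable {Ω : Type u} {K d : ℕ} {mΩ : MeasurableSpace Ω} {p : Trial Ω K d} {c : Tuning}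
    {P : Measure Ω} {ℱ : Filtration ℕ mΩ} {D : Measure (Vec d)} {𝒳 : Set (Vec d)}
    {CX CΘ CE Cl : ℝ}

theorem one_le_dimTerm (h : IsTunedRun p c P ℱ D 𝒳 CX CΘ CE Cl) :
    1 ≤ dimTerm K d c.T c.δ c.lam := by
  have hd : (1 : ℝ) ≤ d := by exact_mod_cast h.run.contextLaw.dim_pos
  have : 0 ≤ Real.log c.T / (c.δ * c.lam * Real.log K) :=
    div_nonneg h.log_T_pos.le (mul_pos (mul_pos h.δ_pos h.lam_pos) h.log_K_pos).le
  rw [dimTerm]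
  linarith

theorem half_le_log_T (h : IsTunedRun p c P ℱ D 𝒳 CX CΘ CE Cl) : 1 / 2 ≤ Real.log c.T :=
  half_lt_log_two.le.trans (Real.log_le_log two_pos (by exact_mod_cast h.two_le_T))

theorem quarter_le (h : IsTunedRun p c P ℱ D 𝒳 CX CΘ CE Cl) :
    (K : ℝ) / 4 ≤ K * Real.log c.T * dimTerm K d c.T c.δ c.lam * √(Real.log K) := by
  have h1 := h.half_le_log_T
  have h2 := half_le_sqrt_log h.two_le_K
  have h3 := h.one_le_dimTerm
  have hK : (0 : ℝ) < K := by exact_mod_cast h.K_pos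
  calc (K : ℝ) / 4 = K * (1 / 2) * 1 * (1 / 2) := by ring
    _ ≤ _ := by gcongr

theorem sqrt_K_le (h : IsTunedRun p c P ℱ D 𝒳 CX CΘ CE Cl) :
    √K ≤ K * Real.log c.T / c.β₁ * dimTerm K d c.T c.δ c.lam + c.β₁ * √(Real.log K) := by
  have h3 := h.one_le_dimTerm
  have := sqrt_le_div_add_mul h.β₁_pos
    (mul_nonneg (mul_nonneg (Nat.cast_nonneg K) h.log_T_pos.le) (by linarith))
    (Real.sqrt_nonneg (Real.log K)) h.quarter_le
  rwa [mul_div_right_comm] at this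

theorem varConst_nonneg (h : IsTunedRun p c P ℱ D 𝒳 CX CΘ CE Cl) : 0 ≤ varConst CX CΘ Cl := by
  have h1 := h.step
  have h2 := h.one_sub_max_pos
  have h3 := h.δ_pos
  have h4 := h.CX_pos
  have h5 := h.CΘ_pos
  rw [h.δ_eq] at h1 h2 h3
  have h6 : 0 < 2 - stepSize CX Cl * CX ^ 2 := by linarith
  unfold varConst
  positivity

theorem varTerm_le (h : IsTunedRun p c P ℱ D 𝒳 CX CΘ CE Cl) (hKT : K ≤ c.T) :
    Real.exp CX * (4 * Cl ^ 2 / (2 - c.δ * CX ^ 2) * (K * d + K * CX ^ 2 / c.lam)) + CX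
        + 2 * CX * CΘ * (K * Real.log c.T / (c.δ * c.lam)
          + 1 / (1 - max 0 (c.δ * CX ^ 2 - 1)))
      ≤ varConst CX CΘ Cl * (K * Real.log c.T * dimTerm K d c.T c.δ c.lam) := by
  have hδ := h.δ_pos
  have hlam := h.lam_pos
  have hk := h.log_K_pos
  have hX1 := h.one_le_dimTerm
  have hκ : 0 < 2 - c.δ * CX ^ 2 := by linarith [h.step]
  have hr := h.one_sub_max_pos
  have hCX := h.CX_pos
  have hCΘ := h.CΘ_pos
  have hL := h.half_le_log_T
  have hK2 : (2 : ℝ) ≤ K := by exact_mod_cast h.two_le_K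
  have hkL : Real.log K ≤ Real.log c.T :=
    Real.log_le_log (by linarith) (by exact_mod_cast hKT)
  -- this is where `K ≤ T` enters: it gives `log T / log K ≥ 1`
  have hXlam : 1 / (c.δ * c.lam) ≤ dimTerm K d c.T c.δ c.lam := by
    have h1 : 1 / (c.δ * c.lam) ≤ Real.log c.T / (c.δ * c.lam * Real.log K) := by
      rw [div_le_div_iff₀ (by positivity) (by positivity), one_mul, mul_comm]
      exact mul_le_mul_of_nonneg_right hkL (by positivity)
    have h2 : (0 : ℝ) ≤ d := Nat.cast_nonneg d
    rw [dimTerm]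
    linarith
  have hXd : (d : ℝ) ≤ dimTerm K d c.T c.δ c.lam := by
    have : 0 ≤ Real.log c.T / (c.δ * c.lam * Real.log K) := by positivity
    rw [dimTerm]
    linarith
  set X := dimTerm K d c.T c.δ c.lam with hXdef
  set L := Real.log c.T with hLdef
  have hY : K * X ≤ 2 * (K * L * X) := by
    have := mul_le_mul_of_nonneg_left hL (show 0 ≤ 2 * (K * X) by positivity)
    linarith
  have hY1 : 1 ≤ 2 * (K * L * X) := by
    have : (1 : ℝ) ≤ K * X := by
      have := mul_le_mul hK2 hX1 zero_le_one (by linarith)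
      linarith
    linarith
  have h1 : K * d + K * CX ^ 2 / c.lam ≤ (1 + CX ^ 2 * c.δ) * (2 * (K * L * X)) := by
    have e : K * CX ^ 2 / c.lam = CX ^ 2 * c.δ * (K * (1 / (c.δ * c.lam))) := by field_simp
    have h2 : (K : ℝ) * d ≤ 2 * (K * L * X) :=
      (mul_le_mul_of_nonneg_left hXd (by positivity)).trans hY
    have h3 : CX ^ 2 * c.δ * (K * (1 / (c.δ * c.lam))) ≤ CX ^ 2 * c.δ * (2 * (K * L * X)) :=
      mul_le_mul_of_nonneg_left
        ((mul_le_mul_of_nonneg_left hXlam (by positivity)).trans hY) (by positivity)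
    rw [e]
    linarith
  have h2 : K * L / (c.δ * c.lam) ≤ K * L * X := by
    rw [div_eq_mul_one_div]
    exact mul_le_mul_of_nonneg_left hXlam (by positivity)
  set κ' := 4 * Cl ^ 2 / (2 - c.δ * CX ^ 2) with hκ'
  set r' := 1 / (1 - max 0 (c.δ * CX ^ 2 - 1)) with hr'
  have hκ'0 : 0 ≤ κ' := by positivity
  have hr'0 : 0 ≤ r' := by positivity
  have e : varConst CX CΘ Cl = 2 * (Real.exp CX * κ' * (1 + CX ^ 2 * c.δ) + CX
      + 2 * CX * CΘ * r') + 2 * CX * CΘ := by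
    rw [varConst, ← h.δ_eq]
  have h3 : Real.exp CX * (κ' * (K * d + K * CX ^ 2 / c.lam))
      ≤ Real.exp CX * (κ' * ((1 + CX ^ 2 * c.δ) * (2 * (K * L * X)))) := by gcongr
  have h4 : CX * 1 ≤ CX * (2 * (K * L * X)) := mul_le_mul_of_nonneg_left hY1 hCX.le
  have h5 : 2 * CX * CΘ * (K * L / (c.δ * c.lam)) ≤ 2 * CX * CΘ * (K * L * X) :=
    mul_le_mul_of_nonneg_left h2 (by positivity)
  have h6 : 2 * CX * CΘ * r' * 1 ≤ 2 * CX * CΘ * r' * (2 * (K * L * X)) :=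
    mul_le_mul_of_nonneg_left hY1 (by positivity)
  rw [e]
  linarith

/-- The regret bound when there are at most as many arms as rounds. -/
theorem regretAgainst_le_of_le (h : IsTunedRun p c P ℱ D 𝒳 CX CΘ CE Cl) (hKT : K ≤ c.T)
    {ρ : Vec d → Fin K} (hρ : Measurable ρ) :
    p.regretAgainst P c.T ρ ≤ (3 + 2 * varConst CX CΘ Cl + 2 * CX * CΘ * Real.exp 1)
      * ((K * Real.log c.T / c.β₁ * dimTerm K d c.T c.δ c.lam + c.β₁ * √(Real.log K))
        * √(Real.log (K * c.T)) * √c.T) := by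
  have hmain := h.regretAgainst_le hρ
  have hvar := h.varTerm_le hKT
  have hV := h.varConst_nonneg
  have hβ := h.β₁_pos
  have hX1 := h.one_le_dimTerm
  have hL := h.log_T_pos
  have hk := h.log_K_pos
  have hCX := h.CX_pos
  have hCΘ := h.CΘ_pos
  have hK1 : (1 : ℝ) ≤ K := by exact_mod_cast h.K_pos
  have hT1 : 1 ≤ √(c.T : ℝ) := Real.one_le_sqrt.2 (by
    have := h.two_le_T; exact_mod_cast (by omega : 1 ≤ c.T))
  have hl1 : 1 ≤ √(Real.log (K * c.T)) := Real.one_le_sqrt.2 (one_le_log_mul h.two_le_K h.two_le_T)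
  have hlk : √(Real.log K) ≤ √(Real.log (K * c.T)) := Real.sqrt_le_sqrt (by
    rw [log_mul_natCast h.two_le_K h.two_le_T]; linarith)
  have hG1 : 1 ≤ K * Real.log c.T / c.β₁ * dimTerm K d c.T c.δ c.lam + c.β₁ * √(Real.log K) :=
    (Real.one_le_sqrt.2 hK1).trans h.sqrt_K_le
  set A := Real.exp CX * (4 * Cl ^ 2 / (2 - c.δ * CX ^ 2) * (K * d + K * CX ^ 2 / c.lam)) + CX
        + 2 * CX * CΘ * (K * Real.log c.T / (c.δ * c.lam)
          + 1 / (1 - max 0 (c.δ * CX ^ 2 - 1))) with hA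
  set X := dimTerm K d c.T c.δ c.lam with hX
  set s := √(Real.log K) with hs
  set l := √(Real.log (K * c.T)) with hl
  set w := √(c.T : ℝ) with hw
  set V := varConst CX CΘ Cl with hVdef
  have hs0 : 0 ≤ s := Real.sqrt_nonneg _
  have hss : Real.log K = s * s := (Real.mul_self_sqrt hk.le).symm
  have hU : 0 ≤ K * Real.log c.T / c.β₁ * X := by positivity
  have h1 : c.β₁ * Real.log K + Real.log K * (2 * c.β₁ * w) ≤ 3 * (c.β₁ * s * l * w) := by
    have h2 : c.β₁ * Real.log K * 1 ≤ c.β₁ * Real.log K * w :=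
      mul_le_mul_of_nonneg_left hT1 (by positivity)
    have h3 : c.β₁ * s * w * s ≤ c.β₁ * s * w * l := mul_le_mul_of_nonneg_left hlk (by positivity)
    rw [hss] at h2 ⊢
    linarith
  have h2 : A / c.β₁ * (2 * w) ≤ 2 * V * (K * Real.log c.T / c.β₁ * X * l * w) := by
    have h3 : A / c.β₁ ≤ V * (K * Real.log c.T / c.β₁ * X) := by
      rw [div_le_iff₀ hβ]
      refine hvar.trans_eq ?_
      field_simp
    have h4 : V * (K * Real.log c.T / c.β₁ * X) * (2 * w) * 1
        ≤ V * (K * Real.log c.T / c.β₁ * X) * (2 * w) * l :=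
      mul_le_mul_of_nonneg_left hl1 (by positivity)
    have h5 := mul_le_mul_of_nonneg_right h3 (show 0 ≤ 2 * w by positivity)
    linarith
  have h3 : 1 ≤ (K * Real.log c.T / c.β₁ * X + c.β₁ * s) * l * w := by
    have := mul_le_mul (mul_le_mul hG1 hl1 zero_le_one (by linarith)) hT1 zero_le_one
      (by positivity)
    linarith
  have h4 : 2 * CX * CΘ * Real.exp 1 * 1
      ≤ 2 * CX * CΘ * Real.exp 1 * ((K * Real.log c.T / c.β₁ * X + c.β₁ * s) * l * w) :=
    mul_le_mul_of_nonneg_left h3 (by positivity)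
  have h5 : 0 ≤ 3 * (K * Real.log c.T / c.β₁ * X * l * w) := by positivity
  have h6 : 0 ≤ 2 * V * (c.β₁ * s * l * w) := by positivity
  linarith

/-- The regret is at most `2 Cl T`, whatever the algorithm does. -/
theorem regretAgainst_le_trivial (h : IsTunedRun p c P ℱ D 𝒳 CX CΘ CE Cl) (ρ : Vec d → Fin K) :
    p.regretAgainst P c.T ρ ≤ 2 * Cl * c.T := by
  have := h.prob
  have hall : ∀ᵐ ω ∂P, ∀ t ∈ Finset.Icc 1 c.T, ∀ a, |p.loss t ω a (p.ctx t ω)| ≤ Cl := by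
    rw [ae_all_iff]
    intro t
    by_cases ht : t ∈ Finset.Icc 1 c.T
    · filter_upwards [h.ae_loss_le ht] with ω hω _ using hω
    · exact Filter.Eventually.of_forall fun ω ht' => absurd ht' ht
  have h1 := norm_integral_le_of_norm_le_const (μ := P) (C := 2 * Cl * c.T)
    (f := fun ω => ∑ t ∈ Finset.Icc 1 c.T,
      (p.loss t ω (p.arm t ω) (p.ctx t ω) - p.loss t ω (ρ (p.ctx t ω)) (p.ctx t ω))) (by
    filter_upwards [hall] with ω hω
    refine (Finset.abs_sum_le_sum_abs _ _).trans ?_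
    calc _ ≤ ∑ _t ∈ Finset.Icc 1 c.T, 2 * Cl := Finset.sum_le_sum fun t ht => by
          have := abs_le.1 (hω t ht (p.arm t ω))
          have := abs_le.1 (hω t ht (ρ (p.ctx t ω)))
          exact abs_le.2 ⟨by linarith, by linarith⟩
      _ = _ := by rw [Finset.sum_const, Nat.card_Icc, Nat.add_sub_cancel, nsmul_eq_mul]; ring)
  rw [probReal_univ, mul_one] at h1
  exact (le_abs_self _).trans h1

theorem regret_le (h : IsTunedRun p c P ℱ D 𝒳 CX CΘ CE Cl) :
    p.regret P c.T ≤ regretConst CX CΘ Cl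
      * ((K * Real.log c.T / c.β₁ * dimTerm K d c.T c.δ c.lam + c.β₁ * √(Real.log K))
        * √(Real.log (K * c.T)) * √c.T) := by
  have : Nonempty {ρ : Vec d → Fin K // Measurable ρ} :=
    ⟨⟨fun _ => ⟨0, h.K_pos⟩, measurable_const⟩⟩
  refine ciSup_le fun ρ => ?_
  have hV := h.varConst_nonneg
  have hCX := h.CX_pos
  have hCΘ := h.CΘ_pos
  have hCl := h.Cl_pos
  have hG := h.sqrt_K_le
  set G := K * Real.log c.T / c.β₁ * dimTerm K d c.T c.δ c.lam + c.β₁ * √(Real.log K) with hGdef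
  have hG0 : 0 ≤ G := (Real.sqrt_nonneg _).trans hG
  have hl1 : 1 ≤ √(Real.log (K * c.T)) := Real.one_le_sqrt.2 (one_le_log_mul h.two_le_K h.two_le_T)
  have hbound : 0 ≤ G * √(Real.log (K * c.T)) * √c.T := by positivity
  rcases le_total K c.T with hKT | hKT
  · refine (h.regretAgainst_le_of_le hKT ρ.2).trans ?_
    rw [← hGdef]
    refine mul_le_mul_of_nonneg_right ?_ hbound
    rw [regretConst]
    linarith
  · -- with more arms than rounds the bound exceeds `T`
    have hTT : (c.T : ℝ) ≤ G * √(Real.log (K * c.T)) * √c.T := by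
      have h1 : √(c.T : ℝ) ≤ G :=
        (Real.sqrt_le_sqrt (by exact_mod_cast hKT)).trans hG
      calc (c.T : ℝ) = √c.T * 1 * √c.T := by rw [mul_one, Real.mul_self_sqrt (Nat.cast_nonneg _)]
        _ ≤ _ := by gcongr
    calc p.regretAgainst P c.T ρ.1 ≤ 2 * Cl * c.T := h.regretAgainst_le_trivial ρ.1
      _ ≤ 2 * Cl * (G * √(Real.log (K * c.T)) * √c.T) :=
          mul_le_mul_of_nonneg_left hTT (by positivity)
      _ ≤ _ := mul_le_mul_of_nonneg_right (by
          have := Real.exp_pos 1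
          rw [regretConst]
          have : 0 ≤ 2 * CX * CΘ * Real.exp 1 := by positivity
          linarith) hbound

end IsTunedRun

/-- The factor lost by the tuned rate relative to the optimal one. -/
noncomputable def tunedConst (CX Cl : ℝ) : ℝ := 2 / (Cl * CX) + Cl * CX

theorem tunedRate_bound_le {K d T : ℕ} {CX Cl lam : ℝ} (hK : 2 ≤ K) (hT : 2 ≤ T)
    (hω : 0 < Cl * CX)
    (hY : 0 < K * Real.log T * dimTerm K d T (stepSize CX Cl) lam) :
    (K * Real.log T / tunedRate K d T CX Cl lam * dimTerm K d T (stepSize CX Cl) lam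
        + tunedRate K d T CX Cl lam * √(Real.log K)) * √(Real.log (K * T)) * √T
      ≤ tunedConst CX Cl * (Real.log (K * T) * √(K * Real.log K * T * Real.log T
          * dimTerm K d T (stepSize CX Cl) lam)) := by
  have hk : 0 ≤ Real.log K := Real.log_natCast_nonneg K
  have hs := half_le_sqrt_log hK
  have hl := one_le_log_mul hK hT
  set X := dimTerm K d T (stepSize CX Cl) lam
  set y := √(K * Real.log T * X) with hy
  have hy0 : 0 < y := Real.sqrt_pos.2 hY
  have hyy : K * Real.log T * X = y * y := (Real.mul_self_sqrt hY.le).symm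
  have e1 : √(K * Real.log K * T * Real.log T * X) = y * √(Real.log K) * √T := by
    rw [hy, ← Real.sqrt_mul hY.le, ← Real.sqrt_mul (mul_nonneg hY.le hk)]
    congr 1
    ring
  have e2 : K * Real.log T / tunedRate K d T CX Cl lam * X = y / (Cl * CX) := by
    rw [tunedRate, ← hy, div_mul_eq_mul_div, hyy]
    field_simp
  have hsl : √(Real.log (K * T)) ≤ Real.log (K * T) := by
    rw [Real.sqrt_le_left (by linarith)]
    nlinarith
  rw [e1, e2, tunedRate, ← hy]
  have h1 : y / (Cl * CX) + Cl * CX * y * √(Real.log K) ≤ tunedConst CX Cl * (y * √(Real.log K)) := by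
    have h2 : y / (Cl * CX) * (1 / 2) ≤ y / (Cl * CX) * √(Real.log K) :=
      mul_le_mul_of_nonneg_left hs (by positivity)
    have e : tunedConst CX Cl * (y * √(Real.log K))
        = 2 * (y / (Cl * CX) * √(Real.log K)) + Cl * CX * y * √(Real.log K) := by
      rw [tunedConst]; ring
    rw [e]
    linarith
  have h0 : 0 ≤ tunedConst CX Cl * (y * √(Real.log K)) := by
    unfold tunedConst; positivity
  calc _ ≤ tunedConst CX Cl * (y * √(Real.log K)) * Real.log (K * T) * √T := by gcongr
    _ = _ := by ring

/-- For fixed numbers of arms and dimensions the bound grows like `√T (log T)²`. -/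
theorem tuned_bound_le_sqrt_mul_log_sq {K d T : ℕ} {δ lam : ℝ} (hK : 2 ≤ K) (hT : 2 ≤ T)
    (hδ : 0 < δ) (hlam : 0 < lam) :
    Real.log (K * T) * √(K * Real.log K * T * Real.log T * dimTerm K d T δ lam)
      ≤ (2 * Real.log K + 1) * √(K * Real.log K * (1 / (δ * lam * Real.log K) + 2 * d))
        * (√T * Real.log T ^ 2) := by
  have hk : 0 < Real.log K := Real.log_pos (by exact_mod_cast hK)
  have hL : 1 / 2 ≤ Real.log T :=
    half_lt_log_two.le.trans (Real.log_le_log two_pos (by exact_mod_cast hT))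
  have hd : (0 : ℝ) ≤ d := Nat.cast_nonneg d
  set L := Real.log T
  have h1 : Real.log (K * T) ≤ (2 * Real.log K + 1) * L := by
    rw [log_mul_natCast hK hT]
    have := mul_le_mul_of_nonneg_left hL hk.le
    linarith
  have h2 : dimTerm K d T δ lam ≤ L * (1 / (δ * lam * Real.log K) + 2 * d) := by
    have := mul_le_mul_of_nonneg_left hL hd
    have e : L * (1 / (δ * lam * Real.log K) + 2 * d)
        = L / (δ * lam * Real.log K) + 2 * (d * L) := by ring
    rw [e, dimTerm]
    linarith
  set Y := 1 / (δ * lam * Real.log K) + 2 * (d : ℝ)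
  have hY : 0 ≤ Y := by positivity
  have h3 : √(K * Real.log K * T * L * dimTerm K d T δ lam) ≤ √(K * Real.log K * Y) * √T * L := by
    have e : √(K * Real.log K * Y) * √T * L = √(K * Real.log K * Y * T * L ^ 2) := by
      have hL0 : 0 ≤ L := by linarith
      rw [Real.sqrt_mul' _ (sq_nonneg L), Real.sqrt_mul' _ (Nat.cast_nonneg T), Real.sqrt_sq hL0]
    rw [e]
    refine Real.sqrt_le_sqrt ?_
    have := mul_le_mul_of_nonneg_left h2 (show 0 ≤ K * Real.log K * T * L by positivity)
    refine this.trans_eq ?_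
    ring
  calc _ ≤ ((2 * Real.log K + 1) * L) * (√(K * Real.log K * Y) * √T * L) := by gcongr
    _ = _ := by ring

end LinBandit

theorem mainTheorem2 (CX CΘ CE Cl : ℝ) (hCX : 0 < CX) (hCΘ : 0 < CΘ) (hCE : 0 < CE)
    (hCl : 0 < Cl) (hstep : LinBandit.stepSize CX Cl * CX ^ 2 < 2) :
    (∃ C : ℝ, 0 < C ∧
      ∀ (K d T : ℕ) (lam : ℝ), 2 ≤ K → 2 ≤ T →
      ∀ (Ω : Type u) [mΩ : MeasurableSpace Ω] (P : Measure Ω) [IsProbabilityMeasure P]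
        (ℱ : Filtration ℕ mΩ) (D : Measure (LinBandit.Vec d)) (𝒳 : Set (LinBandit.Vec d))
        (p : LinBandit.Trial Ω K d),
      (∀ β₁ : ℝ, 0 < β₁ →
        p.IsRun ⟨T, LinBandit.stepSize CX Cl, lam, β₁⟩ P ℱ D 𝒳 CX CΘ CE Cl →
        p.regret P T ≤
          C * ((K * Real.log T / β₁ * LinBandit.dimTerm K d T (LinBandit.stepSize CX Cl) lam
              + β₁ * √(Real.log K)) * √(Real.log (K * T)) * √T)) ∧
      (p.IsRun ⟨T, LinBandit.stepSize CX Cl, lam, LinBandit.tunedRate K d T CX Cl lam⟩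
          P ℱ D 𝒳 CX CΘ CE Cl →
        p.regret P T ≤
          C * (Real.log (K * T) * √(K * Real.log K * T * Real.log T
            * LinBandit.dimTerm K d T (LinBandit.stepSize CX Cl) lam)))) ∧
    (∀ (K d : ℕ) (lam : ℝ), 2 ≤ K → ∃ C : ℝ, 0 < C ∧ ∀ T : ℕ, 2 ≤ T →
      ∀ (Ω : Type u) [mΩ : MeasurableSpace Ω] (P : Measure Ω) [IsProbabilityMeasure P]
        (ℱ : Filtration ℕ mΩ) (D : Measure (LinBandit.Vec d)) (𝒳 : Set (LinBandit.Vec d))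
        (p : LinBandit.Trial Ω K d),
      p.IsRun ⟨T, LinBandit.stepSize CX Cl, lam, LinBandit.tunedRate K d T CX Cl lam⟩
          P ℱ D 𝒳 CX CΘ CE Cl →
        p.regret P T ≤ C * (√T * Real.log T ^ 2)) := by
  have hω : 0 < Cl * CX := mul_pos hCl hCX
  have hδ : 0 < LinBandit.stepSize CX Cl := by rw [LinBandit.stepSize]; positivity
  set δ := LinBandit.stepSize CX Cl with hδdef
  have hr : max 0 (δ * CX ^ 2 - 1) < 1 := max_lt one_pos (by linarith)
  have hC : 0 < LinBandit.regretConst CX CΘ Cl := by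
    have h1 : 0 < 2 - LinBandit.stepSize CX Cl * CX ^ 2 := by linarith
    have h2 : 0 < 1 - max 0 (LinBandit.stepSize CX Cl * CX ^ 2 - 1) := by linarith
    have h3 : 0 ≤ LinBandit.varConst CX CΘ Cl := by unfold LinBandit.varConst; positivity
    unfold LinBandit.regretConst
    positivity
  have hC' : 0 < LinBandit.tunedConst CX Cl := by unfold LinBandit.tunedConst; positivity
  have hrun : ∀ {K d T : ℕ} {lam β₁ : ℝ}, 2 ≤ K → 2 ≤ T → 0 < β₁ →
      ∀ {Ω : Type u} [mΩ : MeasurableSpace Ω] {P : Measure Ω} [IsProbabilityMeasure P]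
        {ℱ : Filtration ℕ mΩ} {D : Measure (LinBandit.Vec d)} {𝒳 : Set (LinBandit.Vec d)}
        {p : LinBandit.Trial Ω K d}, p.IsRun ⟨T, δ, lam, β₁⟩ P ℱ D 𝒳 CX CΘ CE Cl →
      LinBandit.IsTunedRun p ⟨T, δ, lam, β₁⟩ P ℱ D 𝒳 CX CΘ CE Cl := by
    intro K d T lam β₁ hK hT hβ Ω mΩ P hP ℱ D 𝒳 p h
    exact ⟨h, hP, hK, hT, hβ, hCX, hCΘ, hCl, rfl, hstep⟩
  -- the tuned rate is positive as soon as there is a run, since then `λ > 0` and `d ≥ 1`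
  have hpos : ∀ {K d T : ℕ} {lam : ℝ}, 2 ≤ K → 2 ≤ T → 0 < lam → 0 < d →
      0 < K * Real.log T * LinBandit.dimTerm K d T δ lam := by
    intro K d T lam hK hT hlam hd
    have h1 : 0 < Real.log K := Real.log_pos (by exact_mod_cast hK)
    have h2 : 0 < Real.log T := Real.log_pos (by exact_mod_cast hT)
    have h3 : (0 : ℝ) < d := by exact_mod_cast hd
    unfold LinBandit.dimTerm
    positivity
  have htuned : ∀ {K d T : ℕ} {lam : ℝ}, 2 ≤ K → 2 ≤ T →
      ∀ {Ω : Type u} [mΩ : MeasurableSpace Ω] {P : Measure Ω} [IsProbabilityMeasure P]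
        {ℱ : Filtration ℕ mΩ} {D : Measure (LinBandit.Vec d)} {𝒳 : Set (LinBandit.Vec d)}
        {p : LinBandit.Trial Ω K d},
      p.IsRun ⟨T, δ, lam, LinBandit.tunedRate K d T CX Cl lam⟩ P ℱ D 𝒳 CX CΘ CE Cl →
      p.regret P T ≤ LinBandit.regretConst CX CΘ Cl * (LinBandit.tunedConst CX Cl *
        (Real.log (K * T) * √(K * Real.log K * T * Real.log T
          * LinBandit.dimTerm K d T δ lam))) := by
    intro K d T lam hK hT Ω mΩ P hP ℱ D 𝒳 p h
    have hY := hpos hK hT h.contextLaw.lam_pos h.contextLaw.dim_pos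
    have hβ : 0 < LinBandit.tunedRate K d T CX Cl lam := mul_pos hω (Real.sqrt_pos.2 hY)
    exact (hrun hK hT hβ h).regret_le.trans
      (mul_le_mul_of_nonneg_left (LinBandit.tunedRate_bound_le hK hT hω hY) hC.le)
  refine ⟨⟨LinBandit.regretConst CX CΘ Cl * (1 + LinBandit.tunedConst CX Cl), by positivity,
    fun K d T lam hK hT Ω mΩ P hP ℱ D 𝒳 p => ⟨fun β₁ hβ h => ?_, fun h => ?_⟩⟩,
    fun K d lam hK => ?_⟩
  · have h0 := h.contextLaw.lam_pos
    have h1 := (hrun hK hT hβ h).regret_le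
    have hY := (hpos hK hT h0 h.contextLaw.dim_pos).le
    refine h1.trans ?_
    rw [mul_assoc (LinBandit.regretConst CX CΘ Cl)]
    refine mul_le_mul_of_nonneg_left (le_mul_of_one_le_left ?_
      (le_add_of_nonneg_right hC'.le)) hC.le
    have e : K * Real.log T / β₁ * LinBandit.dimTerm K d T δ lam
        = K * Real.log T * LinBandit.dimTerm K d T δ lam / β₁ := (mul_div_right_comm _ _ _).symm
    rw [e]
    positivity
  · refine (htuned hK hT h).trans ?_
    rw [mul_assoc (LinBandit.regretConst CX CΘ Cl)]
    have h0 : 0 ≤ Real.log (K * T) := by linarith [LinBandit.one_le_log_mul hK hT]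
    exact mul_le_mul_of_nonneg_left
      (mul_le_mul_of_nonneg_right (le_add_of_nonneg_left zero_le_one) (by positivity)) hC.le
  · rcases le_or_gt lam 0 with hlam | hlam
    · exact ⟨1, one_pos, fun T hT Ω mΩ P hP ℱ D 𝒳 p h =>
        absurd h.contextLaw.lam_pos hlam.not_gt⟩
    have hk : 0 < Real.log K := Real.log_pos (by exact_mod_cast hK)
    refine ⟨LinBandit.regretConst CX CΘ Cl * (LinBandit.tunedConst CX Cl *
      ((2 * Real.log K + 1) * √(K * Real.log K * (1 / (δ * lam * Real.log K) + 2 * d)))),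
      by positivity, fun T hT Ω mΩ P hP ℱ D 𝒳 p h => (htuned hK hT h).trans ?_⟩
    have := mul_le_mul_of_nonneg_left (mul_le_mul_of_nonneg_left
      (LinBandit.tuned_bound_le_sqrt_mul_log_sq (d := d) hK hT hδ hlam) hC'.le) hC.le
    refine this.trans_eq ?_
    ring
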